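/- Let $N\ge 2$, let $\Omega\subset\mathbb{R}^N$ be a bounded domain, and let $p\ge 2$, $s_1\in(0,1)$, $s_p\in\left(0,\frac{p-1}{p}\right]$. For $q\ge 1$, $\gamma\in(0,1)$ and $A\subset\mathbb{R}^N$ put $$[u]_{W^{\gamma,q}(A)}:=\left(\int_A\int_A\frac{|u(x)-u(y)|^q}{|x-y|^{N+\gamma q}}\,dx\,dy\right)^{1/q},$$ let $W^{\gamma,q}(A)$ be the set of $u\in L^q(A)$ with $[u]_{W^{\gamma,q}(A)}<\infty$, and let $W^{\gamma,q}_{\mathrm{loc}}(\Omega)$ be the set of $u$ that belong to $W^{\gamma,q}(V)$ for every open $V\subset\subset\Omega$. Let $L^{p-1}_{s_pp}(\mathbb{R}^N)$ be the set of $u\in L^{p-1}_{\mathrm{loc}}(\mathbb{R}^N)$ with $\int_{\mathbb{R}^N}\frac{|u(x)|^{p-1}}{(1+|x|)^{N+s_pp}}\,dx<\infty$, and let $$\mathrm{Tail}(u;x_0,R):=\left(R^{s_pp}\int_{\mathbb{R}^N\setminus B_R(x_0)}\frac{|u(x)|^{p-1}}{|x-x_0|^{N+s_pp}}\,dx\right)^{\frac1{p-1}}.$$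 A function $u\in W^{s_1,1}_{\mathrm{loc}}(\Omega)\cap W^{s_p,p}_{\mathrm{loc}}(\Omega)\cap L^{p-1}_{s_pp}(\mathbb{R}^N)$ is called a weak solution of $(-\Delta_1)^{s_1}u+(-\Delta_p)^{s_p}u=0$ in $\Omega$ if there is $Z\in L^\infty(\mathbb{R}^N\times\mathbb{R}^N)$ with $Z(x,y)\in\mathrm{sgn}(u(x)-u(y))$ for almost every $(x,y)$, where $\mathrm{sgn}(t)=\{t/|t|\}$ for $t\neq0$ and $\mathrm{sgn}(0)=[-1,1]$, such that $$\int_{\mathbb{R}^N}\int_{\mathbb{R}^N}Z(x,y)\frac{\varphi(x)-\varphi(y)}{|x-y|^{N+s_1}}\,dx\,dy+\int_{\mathbb{R}^N}\int_{\mathbb{R}^N}\frac{|u(x)-u(y)|^{p-2}(u(x)-u(y))(\varphi(x)-\varphi(y))}{|x-y|^{N+s_pp}}\,dx\,dy=0$$ for every $\varphi\in W^{s_1,1}(\mathbb{R}^N)\cap W^{s_p,p}(\mathbb{R}^N)$ with compact support in $\Omega$. Theorem. Let $q\ge p$ and $\gamma\in\left(0,\frac{s_pp}{p-1}\right)$.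 If $u$ is a weak solution in this sense and $u\in L^\infty_{\mathrm{loc}}(\Omega)$, then $u\in W^{\gamma,q}_{\mathrm{loc}}(\Omega)$. Moreover, there are constants $C,\kappa>0$ depending only on $N,p,q,s_1,s_p,\gamma$ such that, for every such $\Omega$ and $u$, every ball $B_R=B_R(x_0)\subset\subset\Omega$ with $R\in(0,1)$ and every $r\in(0,R)$, with $B_r=B_r(x_0)$, $$[u]^q_{W^{\gamma,q}(B_r)}\le\frac{C\left(\mathcal{T}+[u]_{W^{s_p,p}(B_R)}+1\right)^q}{(R-r)^\kappa},\qquad \mathcal{T}:=\|u\|_{L^\infty(B_R(x_0))}+\mathrm{Tail}(u;x_0,R).$$ -/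

import Mathlib

open MeasureTheory
open scoped ENNReal

noncomputable section

namespace NonlocalOneP

/-- The Gagliardo seminorm `[u]_{W^{s,q}(A)}`, with values in `[0, ∞]`. (On the diagonal, which is a
null set, the real quotient takes the value `0`.) -/
def gagliardo {N : ℕ} (s q : ℝ) (u : EuclideanSpace ℝ (Fin N) → ℝ)
    (A : Set (EuclideanSpace ℝ (Fin N))) : ℝ≥0∞ :=
  (∫⁻ x in A, ∫⁻ y in A,
    ENNReal.ofReal (|u x - u y| ^ q / ‖x - y‖ ^ ((N : ℝ) + s * q))) ^ (1 / q)

/-- `u ∈ W^{s,q}(A)`. -/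
def MemW {N : ℕ} (s q : ℝ) (u : EuclideanSpace ℝ (Fin N) → ℝ)
    (A : Set (EuclideanSpace ℝ (Fin N))) : Prop :=
  MemLp u (ENNReal.ofReal q) (volume.restrict A) ∧ gagliardo s q u A < ∞

/-- `u ∈ W^{s,q}_loc(Ω)`: `u ∈ W^{s,q}(V)` for every open `V ⊂⊂ Ω`. -/
def MemWLoc {N : ℕ} (s q : ℝ) (u : EuclideanSpace ℝ (Fin N) → ℝ)
    (Ω : Set (EuclideanSpace ℝ (Fin N))) : Prop :=
  ∀ V : Set (EuclideanSpace ℝ (Fin N)), IsOpen V → IsCompact (closure V) → closure V ⊆ Ω →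
    MemW s q u V

/-- `u ∈ L^∞_loc(Ω)`. -/
def LocallyBounded {N : ℕ} (u : EuclideanSpace ℝ (Fin N) → ℝ)
    (Ω : Set (EuclideanSpace ℝ (Fin N))) : Prop :=
  ∀ V : Set (EuclideanSpace ℝ (Fin N)), IsOpen V → IsCompact (closure V) → closure V ⊆ Ω →
    MemLp u ∞ (volume.restrict V)

/-- The tail space `L^q_a(ℝ^N)`. -/
def MemTailSpace {N : ℕ} (q a : ℝ) (u : EuclideanSpace ℝ (Fin N) → ℝ) : Prop :=
  (∀ K : Set (EuclideanSpace ℝ (Fin N)), IsCompact K →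
    MemLp u (ENNReal.ofReal q) (volume.restrict K)) ∧
  ∫⁻ x, ENNReal.ofReal (|u x| ^ q / (1 + ‖x‖) ^ ((N : ℝ) + a)) < ∞

/-- `Tail(u; x₀, R)`, with values in `[0, ∞]`. -/
def tail {N : ℕ} (p sp : ℝ) (u : EuclideanSpace ℝ (Fin N) → ℝ)
    (x₀ : EuclideanSpace ℝ (Fin N)) (R : ℝ) : ℝ≥0∞ :=
  (ENNReal.ofReal (R ^ (sp * p)) *
    ∫⁻ x in (Metric.ball x₀ R)ᶜ,
      ENNReal.ofReal (|u x| ^ (p - 1) / ‖x - x₀‖ ^ ((N : ℝ) + sp * p))) ^ (1 / (p - 1))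

/-- `𝒯 = ‖u‖_{L^∞(B_R(x₀))} + Tail(u; x₀, R)`. -/
def supTail {N : ℕ} (p sp : ℝ) (u : EuclideanSpace ℝ (Fin N) → ℝ)
    (x₀ : EuclideanSpace ℝ (Fin N)) (R : ℝ) : ℝ≥0∞ :=
  eLpNorm u ∞ (volume.restrict (Metric.ball x₀ R)) + tail p sp u x₀ R

/-- The set-valued sign function: `sgn t = {t / |t|}` for `t ≠ 0` and `sgn 0 = [-1, 1]`. -/
def sgnSet (t : ℝ) : Set ℝ :=
  {z | z ∈ Set.Icc (-1) 1 ∧ (t ≠ 0 → z = t / |t|)}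

/-- Weak solutions of `(-Δ₁)^{s₁} u + (-Δ_p)^{s_p} u = 0` in `Ω`. The test functions are the
`φ ∈ W^{s₁,1}(ℝ^N) ∩ W^{s_p,p}(ℝ^N)` with compact support in `Ω`. These belong to
`W₀^{s₁,1}(Ω) ∩ W₀^{s_p,p}(Ω)` for every usual meaning of the latter, and for them both
double integrals converge absolutely, by the membership conditions on `u`. -/
structure IsWeakSolution {N : ℕ} (p s₁ sp : ℝ) (Ω : Set (EuclideanSpace ℝ (Fin N)))
    (u : EuclideanSpace ℝ (Fin N) → ℝ) : Prop where
  memW_one : MemWLoc s₁ 1 u Ω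
  memW_p : MemWLoc sp p u Ω
  memTail : MemTailSpace (p - 1) (sp * p) u
  exists_sign : ∃ Z : EuclideanSpace ℝ (Fin N) × EuclideanSpace ℝ (Fin N) → ℝ,
    MemLp Z ∞ (volume.prod volume) ∧
    (∀ᵐ z ∂(volume.prod volume), Z z ∈ sgnSet (u z.1 - u z.2)) ∧
    ∀ φ : EuclideanSpace ℝ (Fin N) → ℝ,
      MemW s₁ 1 φ Set.univ → MemW sp p φ Set.univ → HasCompactSupport φ → tsupport φ ⊆ Ω →
      (∫ z, Z z * (φ z.1 - φ z.2) / ‖z.1 - z.2‖ ^ ((N : ℝ) + s₁) ∂(volume.prod volume)) +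
      (∫ z, |u z.1 - u z.2| ^ (p - 2) * (u z.1 - u z.2) * (φ z.1 - φ z.2) /
        ‖z.1 - z.2‖ ^ ((N : ℝ) + sp * p) ∂(volume.prod volume)) = 0

end NonlocalOneP

end

/-!
Subtract the equations of `u (· + h)` and `u`, and test the result with a cutoff times a signed
power `β` of the difference `u (· + h) - u`. Monotonicity of `sgn` gives the 1-part a sign up to
tail terms, and strong monotonicity of the `p`-part turns the result into a Caccioppoli estimate
for this difference in the energy of order `sp * p` and exponent `p - 1 + β`. It controls second
differences, hence, by Marchaud's inequality, raises the differentiability of `u` from `γ` to any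
order below `(sp * p + γ * β) / (p - 1 + β)`, which for `γ < sp * p / (p - 1)` is a convex
combination of `γ` and `sp * p / (p - 1)`: iterating exhausts the range. The integrability exponent
is raised in unit steps by interpolation with `L^∞`.
-/

namespace NonlocalOneP

open Metric Set

variable {N : ℕ}

local notation "𝔼" => EuclideanSpace ℝ (Fin N)

/-- The signed power `|t|^e t`. -/
noncomputable def spow (e t : ℝ) : ℝ := |t| ^ e * t

theorem measurable_spow (e : ℝ) : Measurable (spow e) := by
  unfold spow; fun_prop

theorem spow_neg (e t : ℝ) : spow e (-t) = -spow e t := by simp [spow]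

theorem spow_of_nonneg {e t : ℝ} (he : 0 ≤ e) (ht : 0 ≤ t) : spow e t = t ^ (e + 1) := by
  rw [spow, abs_of_nonneg ht, Real.rpow_add_one' ht (by linarith)]

theorem spow_of_nonpos {e t : ℝ} (he : 0 ≤ e) (ht : t ≤ 0) : spow e t = -(-t) ^ (e + 1) := by
  rw [← spow_of_nonneg he (neg_nonneg.2 ht), spow_neg, neg_neg]

theorem abs_spow {e : ℝ} (he : 0 ≤ e) (t : ℝ) : |spow e t| = |t| ^ (e + 1) := by
  rw [spow, abs_mul, abs_of_nonneg (Real.rpow_nonneg (abs_nonneg t) e),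
    Real.rpow_add_one' (abs_nonneg t) (by linarith)]

theorem add_rpow_le_two_rpow {a b m : ℝ} (ha : 0 ≤ a) (hb : 0 ≤ b) (hm : 0 ≤ m) :
    (a + b) ^ m ≤ 2 ^ m * (a ^ m + b ^ m) :=
  calc (a + b) ^ m ≤ (2 * max a b) ^ m :=
        Real.rpow_le_rpow (by positivity) (by linarith [le_max_left a b, le_max_right a b]) hm
    _ = 2 ^ m * max a b ^ m := Real.mul_rpow (by norm_num) (by positivity)
    _ ≤ 2 ^ m * (a ^ m + b ^ m) := by
        gcongr
        rcases max_choice a b with h | h <;> rw [h]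
        · linarith [Real.rpow_nonneg hb m]
        · linarith [Real.rpow_nonneg ha m]

theorem abs_sub_rpow_le {m : ℝ} (hm : 0 ≤ m) (a b : ℝ) :
    |a - b| ^ m ≤ 2 ^ m * (|a| ^ m + |b| ^ m) :=
  (Real.rpow_le_rpow (abs_nonneg _) (abs_sub a b) hm).trans
    (add_rpow_le_two_rpow (abs_nonneg a) (abs_nonneg b) hm)

theorem sub_rpow_le_rpow_sub_rpow {e a b : ℝ} (he : 0 ≤ e) (hb : 0 ≤ b) (hab : b ≤ a) :
    (a - b) ^ (e + 1) ≤ 2 ^ (e + 1) * (a ^ (e + 1) - b ^ (e + 1)) := by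
  have hsuper := Real.add_rpow_le_rpow_add (sub_nonneg.2 hab) hb (p := e + 1) (by linarith)
  rw [sub_add_cancel] at hsuper
  have htwo : (1 : ℝ) ≤ 2 ^ (e + 1) := Real.one_le_rpow (by norm_num) (by linarith)
  have hpos : 0 ≤ (a - b) ^ (e + 1) := Real.rpow_nonneg (sub_nonneg.2 hab) _
  nlinarith

theorem rpow_sub_le_spow_sub {e a b : ℝ} (he : 0 ≤ e) (hab : b ≤ a) :
    (a - b) ^ (e + 1) ≤ 2 ^ (e + 1) * (spow e a - spow e b) := by
  rcases le_total 0 b with hb | hb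
  · rw [spow_of_nonneg he hb, spow_of_nonneg he (hb.trans hab)]
    exact sub_rpow_le_rpow_sub_rpow he hb hab
  rcases le_total 0 a with ha | ha
  · rw [spow_of_nonpos he hb, spow_of_nonneg he ha, sub_neg_eq_add, sub_eq_add_neg a b]
    exact add_rpow_le_two_rpow ha (neg_nonneg.2 hb) (by linarith)
  · have h := sub_rpow_le_rpow_sub_rpow he (neg_nonneg.2 ha) (neg_le_neg hab)
    rw [spow_of_nonpos he hb, spow_of_nonpos he ha]
    convert h using 2 <;> ring

theorem spow_mono {e : ℝ} (he : 0 ≤ e) : Monotone (spow e) := by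
  intro b a hab
  have h := (Real.rpow_nonneg (sub_nonneg.2 hab) (e + 1)).trans (rpow_sub_le_spow_sub he hab)
  exact sub_nonneg.1 (nonneg_of_mul_nonneg_right h (by positivity))

theorem rpow_add_one_sub_le {e L a b : ℝ} (he : 0 ≤ e) (hb : 0 ≤ b) (hab : b ≤ a) (haL : a ≤ L) :
    a ^ (e + 1) - b ^ (e + 1) ≤ (e + 1) * L ^ e * (a - b) := by
  rcases (hb.trans hab).eq_or_lt with rfl | ha
  · simp [le_antisymm hab hb]
  have hbernoulli := one_add_mul_self_le_rpow_one_add (s := b / a - 1) (p := e + 1)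
    (by linarith [div_nonneg hb ha.le]) (by linarith)
  rw [add_sub_cancel, Real.div_rpow hb ha.le, le_div_iff₀ (by positivity)] at hbernoulli
  have htangent : (1 + (e + 1) * (b / a - 1)) * a ^ (e + 1)
      = a ^ (e + 1) - (e + 1) * a ^ e * (a - b) := by
    rw [Real.rpow_add_one ha.ne']; field_simp; ring
  calc a ^ (e + 1) - b ^ (e + 1) ≤ (e + 1) * a ^ e * (a - b) := by linarith
    _ ≤ (e + 1) * L ^ e * (a - b) := by gcongr

theorem abs_spow_sub_le {e L a b : ℝ} (he : 0 ≤ e) (ha : |a| ≤ L) (hb : |b| ≤ L) :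
    |spow e a - spow e b| ≤ (e + 1) * L ^ e * |a - b| := by
  wlog hab : b ≤ a generalizing a b
  · rw [abs_sub_comm, abs_sub_comm a b]
    exact this hb ha (le_of_not_ge hab)
  rw [abs_of_nonneg (sub_nonneg.2 (spow_mono he hab)), abs_of_nonneg (sub_nonneg.2 hab)]
  rw [abs_le] at ha hb
  rcases le_total 0 b with hb0 | hb0
  · rw [spow_of_nonneg he hb0, spow_of_nonneg he (hb0.trans hab)]
    exact rpow_add_one_sub_le he hb0 hab ha.2
  rcases le_total 0 a with ha0 | ha0
  · rw [spow_of_nonpos he hb0, spow_of_nonneg he ha0]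
    have h₁ := rpow_add_one_sub_le he le_rfl ha0 ha.2
    have h₂ := rpow_add_one_sub_le he le_rfl (neg_nonneg.2 hb0) (neg_le.1 hb.1)
    rw [Real.zero_rpow (by linarith)] at h₁ h₂
    linarith
  · rw [spow_of_nonpos he hb0, spow_of_nonpos he ha0]
    have h := rpow_add_one_sub_le he (neg_nonneg.2 ha0) (neg_le_neg hab) (neg_le.1 hb.1)
    linarith

theorem abs_le_one_of_mem_sgnSet {t z : ℝ} (hz : z ∈ sgnSet t) : |z| ≤ 1 :=
  abs_le.2 hz.1

theorem neg_mem_sgnSet {t z : ℝ} (hz : z ∈ sgnSet t) : -z ∈ sgnSet (-t) :=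
  ⟨⟨neg_le_neg hz.1.2, neg_le.1 hz.1.1⟩, fun ht => by
    rw [abs_neg, neg_div, hz.2 (neg_ne_zero.1 ht)]⟩

theorem sgnSet_mono {a b y z : ℝ} (hab : b < a) (hy : y ∈ sgnSet a) (hz : z ∈ sgnSet b) :
    z ≤ y := by
  rcases lt_or_ge 0 a with ha | ha
  · rw [hy.2 ha.ne', abs_of_pos ha, div_self ha.ne']
    exact hz.1.2
  · have hb : b < 0 := hab.trans_le ha
    rw [hz.2 hb.ne, abs_of_neg hb, div_neg, div_self hb.ne]
    exact hy.1.1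

theorem setLIntegral_comp_add_right_le {G : Type*} [MeasurableSpace G] [AddGroup G]
    [MeasurableAdd G] {μ : Measure G} [μ.IsAddRightInvariant] (f : G → ℝ≥0∞) (g : G) {A B : Set G}
    (hA : MeasurableSet A) (hB : MeasurableSet B) (hAB : ∀ x ∈ A, x + g ∈ B) :
    ∫⁻ x in A, f (x + g) ∂μ ≤ ∫⁻ x in B, f x ∂μ := by
  rw [← lintegral_indicator hA, ← lintegral_indicator hB,
    ← lintegral_add_right_eq_self (B.indicator f) g]
  refine lintegral_mono fun x => ?_
  by_cases hx : x ∈ A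
  · simp [hx, hAB x hx]
  · simp [hx]

theorem exists_lintegral_ball_rpow_le (hN : 1 ≤ N) {τ : ℝ} (hτ : 0 < τ) :
    ∃ C : ℝ, 0 < C ∧ ∀ (x : 𝔼) (A : Set 𝔼), MeasurableSet A → A ⊆ ball x 2 →
      ∫⁻ y in A, ENNReal.ofReal (‖x - y‖ ^ (τ - N)) ≤ ENNReal.ofReal C := by
  have hint : IntegrableOn (fun y : 𝔼 => ‖y‖ ^ (τ - N)) (ball 0 2) := by
    refine integrableOn_ball_of_norm_le_rpow (C := 1) (α := N - τ) (by simpa using hN)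
      (by simp [hτ]) (.of_forall fun y => ?_)
      (by fun_prop : Measurable fun y : 𝔼 => ‖y‖ ^ (τ - N)).aestronglyMeasurable
    simp [Real.norm_of_nonneg (Real.rpow_nonneg (norm_nonneg y) _)]
  have hfin : ∫⁻ y in ball (0 : 𝔼) 2, ENNReal.ofReal (‖y‖ ^ (τ - N)) ≠ ∞ :=
    ((hasFiniteIntegral_iff_ofReal (.of_forall fun y => by positivity)).1 hint.2).ne
  refine ⟨(∫⁻ y in ball (0 : 𝔼) 2, ENNReal.ofReal (‖y‖ ^ (τ - N))).toReal + 1, by positivity,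
    fun x A hA hsub => ?_⟩
  calc ∫⁻ y in A, ENNReal.ofReal (‖x - y‖ ^ (τ - N))
      = ∫⁻ y in A, ENNReal.ofReal (‖y + -x‖ ^ (τ - N)) := by
        simp_rw [norm_sub_rev x, sub_eq_add_neg]
    _ ≤ ∫⁻ y in ball (0 : 𝔼) 2, ENNReal.ofReal (‖y‖ ^ (τ - N)) :=
        setLIntegral_comp_add_right_le (fun y : 𝔼 => ENNReal.ofReal (‖y‖ ^ (τ - N))) (-x) hA
          measurableSet_ball fun y hy => by
            simpa [dist_eq_norm, ← sub_eq_add_neg] using hsub hy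
    _ ≤ _ := by
        rw [ENNReal.ofReal_add (by positivity) (by positivity), ENNReal.ofReal_toReal hfin]
        exact le_self_add

theorem one_div_rpow_le_of_le {d ρ m : ℝ} (hm : 0 ≤ m) (hρ : 0 < ρ) (hρ1 : ρ ≤ 1) (hd : ρ ≤ d) :
    1 / d ^ m ≤ 2 ^ m * ρ ^ (-m) * (1 + d) ^ (-m) := by
  have hd0 : 0 < d := hρ.trans_le hd
  rw [Real.rpow_neg hρ.le, Real.rpow_neg (by positivity), ← div_eq_mul_inv, ← div_eq_mul_inv,
    div_div, ← Real.mul_rpow hρ.le (by positivity), one_div_le (by positivity) (by positivity),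
    one_div_div, ← Real.div_rpow (by positivity) (by norm_num)]
  gcongr
  nlinarith

theorem exists_lintegral_far_le {τ : ℝ} (hτ : 0 < τ) :
    ∃ C : ℝ, 0 < C ∧ ∀ (ρ : ℝ) (x : 𝔼), 0 < ρ → ρ ≤ 1 →
      ∫⁻ y in {y | ρ ≤ ‖x - y‖}, ENNReal.ofReal (1 / ‖x - y‖ ^ (N + τ)) ≤
        ENNReal.ofReal (C * ρ ^ (-(N + τ))) := by
  set m : ℝ := N + τ with hm
  have hm0 : 0 < m := by positivity
  set I := ∫⁻ y : 𝔼, ENNReal.ofReal ((1 + ‖y‖) ^ (-m))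
  have hfin : I ≠ ∞ := (finite_integral_one_add_norm (by simp [hm, hτ])).ne
  refine ⟨2 ^ m * (I.toReal + 1), by positivity, fun ρ x hρ hρ1 => ?_⟩
  calc ∫⁻ y in {y | ρ ≤ ‖x - y‖}, ENNReal.ofReal (1 / ‖x - y‖ ^ m)
      ≤ ∫⁻ y in {y | ρ ≤ ‖x - y‖}, ENNReal.ofReal (2 ^ m * ρ ^ (-m)) *
          ENNReal.ofReal ((1 + ‖x - y‖) ^ (-m)) :=
        setLIntegral_mono' (measurableSet_le (by fun_prop) (by fun_prop)) fun y hy => by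
          rw [← ENNReal.ofReal_mul (by positivity)]
          exact ENNReal.ofReal_le_ofReal (one_div_rpow_le_of_le hm0.le hρ hρ1 hy)
    _ ≤ ∫⁻ y, ENNReal.ofReal (2 ^ m * ρ ^ (-m)) * ENNReal.ofReal ((1 + ‖x - y‖) ^ (-m)) :=
        setLIntegral_le_lintegral _ _
    _ = ENNReal.ofReal (2 ^ m * ρ ^ (-m)) * I := by
        rw [lintegral_const_mul' _ _ ENNReal.ofReal_ne_top,
          lintegral_sub_left_eq_self (fun y : 𝔼 => ENNReal.ofReal ((1 + ‖y‖) ^ (-m))) x]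
    _ = ENNReal.ofReal (2 ^ m * ρ ^ (-m) * I.toReal) := by
        rw [ENNReal.ofReal_mul (q := I.toReal) (by positivity), ENNReal.ofReal_toReal hfin]
    _ ≤ _ := by
        refine ENNReal.ofReal_le_ofReal ?_
        have : 0 ≤ 2 ^ m * ρ ^ (-m) := by positivity
        linarith

theorem exists_volume_ball_le : ∃ C : ℝ, 0 < C ∧ ∀ (x : 𝔼) (r : ℝ), r ≤ 1 →
    volume (ball x r) ≤ ENNReal.ofReal C := by
  refine ⟨(volume (ball (0 : 𝔼) 1)).toReal + 1, by positivity, fun x r hr => ?_⟩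
  refine (measure_mono (ball_subset_ball hr)).trans ?_
  rw [Measure.addHaar_ball_center, ENNReal.ofReal_add (by positivity) (by positivity),
    ENNReal.ofReal_toReal measure_ball_lt_top.ne]
  exact le_self_add

/-- The `q`-th power of a Gagliardo seminorm, with the exponent of `|x - y|` as a parameter:
`gagliardoEnergy (N + γ * q) q u A` is `[u]^q` for the seminorm of `W^{γ,q}(A)`. -/
noncomputable def gagliardoEnergy (e q : ℝ) (u : 𝔼 → ℝ) (A : Set 𝔼) : ℝ≥0∞ :=
  ∫⁻ x in A, ∫⁻ y in A, ENNReal.ofReal (|u x - u y| ^ q / ‖x - y‖ ^ e)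

theorem gagliardoEnergy_mono_set (e q : ℝ) (u : 𝔼 → ℝ) {A B : Set 𝔼} (h : A ⊆ B) :
    gagliardoEnergy e q u A ≤ gagliardoEnergy e q u B :=
  (lintegral_mono fun _ => lintegral_mono_set h).trans (lintegral_mono_set h)

theorem gagliardoEnergy_comp_add_right_le (e q : ℝ) (u : 𝔼 → ℝ) (h : 𝔼) {A B : Set 𝔼}
    (hA : MeasurableSet A) (hB : MeasurableSet B) (hAB : ∀ x ∈ A, x + h ∈ B) :
    gagliardoEnergy e q (fun x => u (x + h)) A ≤ gagliardoEnergy e q u B := by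
  refine le_trans (lintegral_mono fun x => ?_) (setLIntegral_comp_add_right_le
    (fun x => ∫⁻ y in B, ENNReal.ofReal (|u x - u y| ^ q / ‖x - y‖ ^ e)) h hA hB hAB)
  simpa using setLIntegral_comp_add_right_le
    (fun y => ENNReal.ofReal (|u (x + h) - u y| ^ q / ‖x + h - y‖ ^ e)) h hA hB hAB

theorem measurable_gagliardoEnergy_integrand {u : 𝔼 → ℝ} (hu : Measurable u) (e q : ℝ) :
    Measurable fun z : 𝔼 × 𝔼 => ENNReal.ofReal (|u z.1 - u z.2| ^ q / ‖z.1 - z.2‖ ^ e) := by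
  fun_prop

theorem measurable_fwdDiff {u : 𝔼 → ℝ} (hu : Measurable u) (h : 𝔼) : Measurable (fwdDiff h u) := by
  unfold fwdDiff; fun_prop

theorem add_mem_ball_of_norm_le {E : Type*} [SeminormedAddCommGroup E] {x₀ x h : E} {r ρ : ℝ}
    (hh : ‖h‖ ≤ ρ) (hx : x ∈ ball x₀ r) : x + h ∈ ball x₀ (r + ρ) := by
  rw [mem_ball, dist_eq_norm] at hx ⊢
  calc ‖x + h - x₀‖ = ‖(x - x₀) + h‖ := by congr 1; abel
    _ ≤ ‖x - x₀‖ + ‖h‖ := norm_add_le _ _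
    _ < r + ρ := by linarith

theorem abs_sub_rpow_le_mul_div {E : Type*} [NormedAddCommGroup E] {q e D : ℝ} (hq : 0 < q)
    (he : 0 ≤ e) (F : E → ℝ) {x y : E} (hD : ‖x - y‖ ≤ D) :
    |F x - F y| ^ q ≤ D ^ e * (|F x - F y| ^ q / ‖x - y‖ ^ e) := by
  rcases eq_or_ne x y with rfl | hxy
  · simp [Real.zero_rpow hq.ne']
  · have : 0 < ‖x - y‖ := norm_sub_pos_iff.2 hxy
    rw [mul_div_assoc', le_div_iff₀ (by positivity), mul_comm]
    gcongr

theorem abs_sub_rpow_le_of_norm_sub_le {E : Type*} [NormedAddCommGroup E] {q e D : ℝ} (hq : 0 < q)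
    (he : 0 ≤ e) (F : E → ℝ) {x y z : E} (hx : ‖x - z‖ ≤ D) (hy : ‖y - z‖ ≤ D) :
    |F y - F x| ^ q ≤ 2 ^ q * D ^ e *
      (|F y - F z| ^ q / ‖y - z‖ ^ e + |F x - F z| ^ q / ‖x - z‖ ^ e) :=
  calc |F y - F x| ^ q ≤ 2 ^ q * (|F y - F z| ^ q + |F x - F z| ^ q) := by
        rw [← sub_sub_sub_cancel_right (F y) (F x) (F z)]
        exact abs_sub_rpow_le hq.le _ _
    _ ≤ 2 ^ q * (D ^ e * (|F y - F z| ^ q / ‖y - z‖ ^ e) +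
          D ^ e * (|F x - F z| ^ q / ‖x - z‖ ^ e)) := by
        gcongr <;> exact abs_sub_rpow_le_mul_div hq he F ‹_›
    _ = _ := by ring

-- Both `F x` and `F (x + h)` are compared with the values of `F` on the ball of radius `‖h‖`.
theorem fwdDiff_rpow_mul_volume_le {q e : ℝ} (hq : 0 < q) (he : 0 ≤ e) {F : 𝔼 → ℝ}
    (hF : Measurable F) {x h : 𝔼} {B : Set 𝔼} (hB : ball x ‖h‖ ⊆ B) :
    ENNReal.ofReal (|fwdDiff h F x| ^ q) * volume (ball x ‖h‖) ≤
      ENNReal.ofReal (2 ^ q * (2 * ‖h‖) ^ e) *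
        ((∫⁻ z in B, ENNReal.ofReal (|F (x + h) - F z| ^ q / ‖x + h - z‖ ^ e)) +
          ∫⁻ z in B, ENNReal.ofReal (|F x - F z| ^ q / ‖x - z‖ ^ e)) := by
  rw [← setLIntegral_const]
  calc _ ≤ ∫⁻ z in ball x ‖h‖, ENNReal.ofReal (2 ^ q * (2 * ‖h‖) ^ e) *
          (ENNReal.ofReal (|F (x + h) - F z| ^ q / ‖x + h - z‖ ^ e) +
            ENNReal.ofReal (|F x - F z| ^ q / ‖x - z‖ ^ e)) := by
        refine setLIntegral_mono' measurableSet_ball fun z hz => ?_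
        rw [← ENNReal.ofReal_add (by positivity) (by positivity),
          ← ENNReal.ofReal_mul (by positivity)]
        have hxz : ‖x - z‖ < ‖h‖ := by rwa [mem_ball, dist_comm, dist_eq_norm] at hz
        have hyz : ‖x + h - z‖ ≤ 2 * ‖h‖ := by
          rw [add_sub_right_comm]
          linarith [norm_add_le (x - z) h]
        exact ENNReal.ofReal_le_ofReal
          (abs_sub_rpow_le_of_norm_sub_le hq he F (by linarith [norm_nonneg h]) hyz)
    _ ≤ _ := by
        rw [lintegral_const_mul' _ _ ENNReal.ofReal_ne_top, lintegral_add_left (by fun_prop)]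
        gcongr

theorem lintegral_fwdDiff_mul_volume_le {q e : ℝ} (hq : 0 < q) (he : 0 ≤ e) {F : 𝔼 → ℝ}
    (hF : Measurable F) {x₀ : 𝔼} {r ρ : ℝ} {h : 𝔼} (hρ : ‖h‖ ≤ ρ) :
    (∫⁻ x in ball x₀ r, ENNReal.ofReal (|fwdDiff h F x| ^ q)) * volume (ball (0 : 𝔼) ‖h‖) ≤
      ENNReal.ofReal (2 * (2 ^ q * (2 * ‖h‖) ^ e)) * gagliardoEnergy e q F (ball x₀ (r + ρ)) := by
  set B' := ball x₀ (r + ρ)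
  set Φ : 𝔼 → ℝ≥0∞ := fun x => ∫⁻ z in B', ENNReal.ofReal (|F x - F z| ^ q / ‖x - z‖ ^ e)
  have hΦ : Measurable Φ := (measurable_gagliardoEnergy_integrand hF e q).lintegral_prod_right'
  calc _ ≤ ∫⁻ x in ball x₀ r, ENNReal.ofReal (2 ^ q * (2 * ‖h‖) ^ e) * (Φ (x + h) + Φ x) := by
        rw [← lintegral_mul_const' _ _ measure_ball_lt_top.ne]
        refine setLIntegral_mono' measurableSet_ball fun x hx => ?_
        rw [← Measure.addHaar_ball_center volume x]
        exact fwdDiff_rpow_mul_volume_le hq he hF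
          (ball_subset_ball' (by rw [mem_ball] at hx; linarith))
    _ = ENNReal.ofReal (2 ^ q * (2 * ‖h‖) ^ e) *
          ((∫⁻ x in ball x₀ r, Φ (x + h)) + ∫⁻ x in ball x₀ r, Φ x) := by
        rw [lintegral_const_mul' _ _ ENNReal.ofReal_ne_top, lintegral_add_right _ hΦ]
    _ ≤ ENNReal.ofReal (2 ^ q * (2 * ‖h‖) ^ e) *
          (gagliardoEnergy e q F B' + gagliardoEnergy e q F B') :=
        mul_le_mul_right (add_le_add
          (setLIntegral_comp_add_right_le Φ h measurableSet_ball measurableSet_ball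
            fun x hx => add_mem_ball_of_norm_le hρ hx)
          (lintegral_mono_set (ball_subset_ball (by linarith [norm_nonneg h])))) _
    _ = _ := by
        rw [ENNReal.ofReal_mul (p := 2) (by norm_num), ENNReal.ofReal_ofNat]
        ring

theorem exists_lintegral_fwdDiff_le {q e : ℝ} (hq : 0 < q) (he : 0 ≤ e) :
    ∃ C : ℝ, 0 < C ∧ ∀ F : 𝔼 → ℝ, Measurable F → ∀ (x₀ : 𝔼) (r ρ : ℝ) (h : 𝔼), ‖h‖ ≤ ρ →
      ∫⁻ x in ball x₀ r, ENNReal.ofReal (|fwdDiff h F x| ^ q) ≤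
        ENNReal.ofReal (C * ‖h‖ ^ (e - N)) * gagliardoEnergy e q F (ball x₀ (r + ρ)) := by
  set c := (volume (ball (0 : 𝔼) 1)).toReal
  have hc : 0 < c :=
    ENNReal.toReal_pos (measure_ball_pos _ _ one_pos).ne' measure_ball_lt_top.ne
  refine ⟨2 * (2 ^ q * 2 ^ e) / c, by positivity, fun F hF x₀ r ρ h hρ => ?_⟩
  rcases eq_or_ne h 0 with rfl | hh
  · simp [fwdDiff, Real.zero_rpow hq.ne']
  have hpos : 0 < ‖h‖ := norm_pos_iff.2 hh
  have hvol : volume (ball (0 : 𝔼) ‖h‖) = ENNReal.ofReal (‖h‖ ^ (N : ℝ) * c) := by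
    rw [Measure.addHaar_ball_of_pos _ _ hpos, ENNReal.ofReal_mul (by positivity),
      ENNReal.ofReal_toReal measure_ball_lt_top.ne]
    simp
  have hmul := lintegral_fwdDiff_mul_volume_le hq he hF hρ (x₀ := x₀) (r := r)
  rw [← ENNReal.le_div_iff_mul_le (Or.inl (measure_ball_pos _ _ hpos).ne')
    (Or.inl measure_ball_lt_top.ne), hvol, ENNReal.mul_div_right_comm,
    ← ENNReal.ofReal_div_of_pos (by positivity)] at hmul
  convert hmul using 3
  rw [Real.mul_rpow (by norm_num) hpos.le, Real.rpow_sub hpos]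
  field_simp

theorem lintegral_abs_rpow_eq_eLpNorm_rpow {α : Type*} [MeasurableSpace α] {μ : Measure α} {q : ℝ}
    (hq : 0 < q) (f : α → ℝ) :
    ∫⁻ x, ENNReal.ofReal (|f x| ^ q) ∂μ = eLpNorm f (ENNReal.ofReal q) μ ^ q := by
  rw [eLpNorm_eq_lintegral_rpow_enorm_toReal (by simpa using hq) ENNReal.ofReal_ne_top,
    ENNReal.toReal_ofReal hq.le, ← ENNReal.rpow_mul, one_div_mul_cancel hq.ne', ENNReal.rpow_one]
  simp_rw [← ENNReal.ofReal_rpow_of_nonneg (abs_nonneg _) hq.le, Real.enorm_eq_ofReal_abs]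

theorem lintegral_abs_rpow_le_ofReal_rpow_iff {α : Type*} [MeasurableSpace α] {μ : Measure α}
    {q c : ℝ} (hq : 0 < q) (hc : 0 ≤ c) (f : α → ℝ) :
    ∫⁻ x, ENNReal.ofReal (|f x| ^ q) ∂μ ≤ ENNReal.ofReal (c ^ q) ↔
      eLpNorm f (ENNReal.ofReal q) μ ≤ ENNReal.ofReal c := by
  rw [lintegral_abs_rpow_eq_eLpNorm_rpow hq, ← ENNReal.ofReal_rpow_of_nonneg hc hq.le,
    ENNReal.rpow_le_rpow_iff hq]

/-- Marchaud's inequality. -/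
theorem le_rpow_norm_of_le_half_double {E : Type*} [NormedAddCommGroup E] [NormedSpace ℝ E]
    {α ρ L : ℝ} (hα : 0 ≤ α) (hα1 : α < 1) (hρ : 0 < ρ) (hρ1 : ρ ≤ 1) (hL : 0 ≤ L)
    {a : E → ℝ≥0∞} (hbd : ∀ h, ‖h‖ ≤ ρ → a h ≤ ENNReal.ofReal L)
    (hhalf : ∀ h, ‖h‖ ≤ ρ →
      a h ≤ ENNReal.ofReal 2⁻¹ * (a (h + h) + ENNReal.ofReal (L * ‖h‖ ^ α)))
    {h : E} (hh : ‖h‖ ≤ ρ) (h0 : h ≠ 0) :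
    a h ≤ ENNReal.ofReal (2 / (2 - 2 ^ α) * L * ρ ^ (-α) * ‖h‖ ^ α) := by
  have h2α : (2 : ℝ) ^ α < 2 := by
    simpa using Real.rpow_lt_rpow_of_exponent_lt (x := 2) (by norm_num) hα1
  have h2α1 : (1 : ℝ) ≤ 2 ^ α := Real.one_le_rpow (by norm_num) hα
  have hρα : 1 ≤ ρ ^ (-α) := Real.one_le_rpow_of_pos_of_le_one_of_nonpos hρ hρ1 (by linarith)
  set C : ℝ := 2 / (2 - 2 ^ α)
  have hCeq : C * (2 - 2 ^ α) = 2 := div_mul_cancel₀ _ (by linarith)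
  have hC2 : 2 ≤ C := by nlinarith
  have key (n : ℕ) : ∀ h : E, ‖h‖ ≤ ρ → ρ < 2 ^ n * ‖h‖ →
      a h ≤ ENNReal.ofReal (C * L * ρ ^ (-α) * ‖h‖ ^ α) := by
    induction n with
    | zero => intro h hle hlt; simp at hlt; linarith
    | succ n ih =>
      intro h hle hlt
      by_cases hbig : ρ < 2 * ‖h‖
      · refine (hbd h hle).trans (ENNReal.ofReal_le_ofReal ?_)
        have hratio : 1 ≤ 2 ^ α * (ρ ^ (-α) * ‖h‖ ^ α) := by
          rw [Real.rpow_neg hρ.le, ← mul_assoc, mul_right_comm, ← Real.mul_rpow (by norm_num)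
            (norm_nonneg h), ← div_eq_mul_inv, ← Real.div_rpow (by positivity) hρ.le]
          exact Real.one_le_rpow ((one_le_div hρ).2 hbig.le) hα
        calc L ≤ L * (2 ^ α * (ρ ^ (-α) * ‖h‖ ^ α)) := le_mul_of_one_le_right hL hratio
          _ ≤ L * (C * (ρ ^ (-α) * ‖h‖ ^ α)) := by gcongr; linarith
          _ = _ := by ring
      · have hdouble : ‖h + h‖ = 2 * ‖h‖ := by rw [← two_smul ℝ h, norm_smul]; simp
        have hprev := ih (h + h) (by rw [hdouble]; exact not_lt.1 hbig)
          (by rw [hdouble, ← mul_assoc, ← pow_succ]; exact hlt)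
        refine (hhalf h hle).trans ((mul_le_mul_right (add_le_add_left hprev _) _).trans ?_)
        rw [← ENNReal.ofReal_add (by positivity) (by positivity),
          ← ENNReal.ofReal_mul (by norm_num), hdouble, Real.mul_rpow (by norm_num) (norm_nonneg h)]
        refine ENNReal.ofReal_le_ofReal ?_
        have hLρ : L ≤ L * ρ ^ (-α) := le_mul_of_one_le_right hL hρα
        have hY : 0 ≤ L * ρ ^ (-α) * ‖h‖ ^ α := by positivity
        calc 2⁻¹ * (C * L * ρ ^ (-α) * (2 ^ α * ‖h‖ ^ α) + L * ‖h‖ ^ α)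
            ≤ 2⁻¹ * (C * L * ρ ^ (-α) * (2 ^ α * ‖h‖ ^ α) + L * ρ ^ (-α) * ‖h‖ ^ α) := by gcongr
          _ ≤ C * L * ρ ^ (-α) * ‖h‖ ^ α := by nlinarith
  obtain ⟨n, hn⟩ := pow_unbounded_of_one_lt (ρ / ‖h‖) one_lt_two
  exact key n h hh (by rwa [div_lt_iff₀ (norm_pos_iff.2 h0)] at hn)

theorem eLpNorm_fwdDiff_le_half {q : ℝ≥0∞} (hq : 1 ≤ q) {u : 𝔼 → ℝ} (hu : Measurable u) (h : 𝔼)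
    (μ : Measure 𝔼) :
    eLpNorm (fwdDiff h u) q μ ≤ ENNReal.ofReal 2⁻¹ *
      (eLpNorm (fwdDiff (h + h) u) q μ + eLpNorm (fwdDiff h (fwdDiff h u)) q μ) := by
  have hdecomp : fwdDiff h u =
      (2⁻¹ : ℝ) • (fwdDiff (h + h) u - fwdDiff h (fwdDiff h u)) := by
    ext x
    simp only [fwdDiff, Pi.smul_apply, Pi.sub_apply, smul_eq_mul, add_assoc]
    ring
  have hnorm : ‖(2⁻¹ : ℝ)‖ₑ = ENNReal.ofReal 2⁻¹ := Real.enorm_of_nonneg (by norm_num)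
  rw [hdecomp, eLpNorm_const_smul, hnorm, ← hdecomp]
  gcongr
  exact eLpNorm_sub_le (measurable_fwdDiff hu _).aestronglyMeasurable
    (measurable_fwdDiff (measurable_fwdDiff hu _) _).aestronglyMeasurable hq

theorem exists_lintegral_fwdDiff_le_of_iterate {q α : ℝ} (hq : 1 ≤ q) (hα : 0 ≤ α) (hα1 : α < 1) :
    ∃ C : ℝ, 0 < C ∧ ∀ u : 𝔼 → ℝ, Measurable u → ∀ (A : Set 𝔼) (ρ Q : ℝ), 0 < ρ → ρ ≤ 1 → 0 ≤ Q →
      (∀ h : 𝔼, ‖h‖ ≤ ρ → ∫⁻ x in A, ENNReal.ofReal (|fwdDiff h u x| ^ q) ≤ ENNReal.ofReal Q) →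
      (∀ h : 𝔼, ‖h‖ ≤ ρ → ∫⁻ x in A, ENNReal.ofReal (|fwdDiff h (fwdDiff h u) x| ^ q) ≤
        ENNReal.ofReal (Q * ‖h‖ ^ (α * q))) →
      ∀ h : 𝔼, ‖h‖ ≤ ρ → ∫⁻ x in A, ENNReal.ofReal (|fwdDiff h u x| ^ q) ≤
        ENNReal.ofReal (C * Q * ρ ^ (-(α * q)) * ‖h‖ ^ (α * q)) := by
  have hq0 : 0 < q := by linarith
  have h2α : (2 : ℝ) ^ α < 2 := by
    simpa using Real.rpow_lt_rpow_of_exponent_lt (x := 2) (by norm_num) hα1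
  set C : ℝ := 2 / (2 - 2 ^ α)
  have hC : 0 < C := div_pos two_pos (sub_pos.2 h2α)
  refine ⟨C ^ q, by positivity, fun u hu A ρ Q hρ hρ1 hQ hfst hsnd h hh => ?_⟩
  rcases eq_or_ne h 0 with rfl | h0
  · simp [fwdDiff, Real.zero_rpow hq0.ne']
  set L := Q ^ q⁻¹
  have hL : 0 ≤ L := by positivity
  have hLq : Q = L ^ q := (Real.rpow_inv_rpow hQ hq0.ne').symm
  have hpow (k : 𝔼) : Q * ‖k‖ ^ (α * q) = (L * ‖k‖ ^ α) ^ q := by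
    rw [Real.mul_rpow hL (by positivity), ← Real.rpow_mul (norm_nonneg k), hLq]
  have hgoal : C ^ q * Q * ρ ^ (-(α * q)) * ‖h‖ ^ (α * q)
      = (C * L * ρ ^ (-α) * ‖h‖ ^ α) ^ q := by
    rw [Real.mul_rpow (by positivity) (by positivity), Real.mul_rpow (by positivity)
      (by positivity), Real.mul_rpow hC.le hL, ← Real.rpow_mul (norm_nonneg h),
      ← Real.rpow_mul hρ.le, neg_mul, hLq]
  rw [hgoal, lintegral_abs_rpow_le_ofReal_rpow_iff hq0 (by positivity)]
  refine le_rpow_norm_of_le_half_double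
    (a := fun k => eLpNorm (fwdDiff k u) (ENNReal.ofReal q) (volume.restrict A)) hα hα1 hρ hρ1 hL
    (fun k hk => ?_) (fun k hk => ?_) hh h0
  · exact (lintegral_abs_rpow_le_ofReal_rpow_iff hq0 hL _).1 (hLq ▸ hfst k hk)
  · refine (eLpNorm_fwdDiff_le_half (ENNReal.one_le_ofReal.2 hq) hu k _).trans ?_
    gcongr
    exact (lintegral_abs_rpow_le_ofReal_rpow_iff hq0 (by positivity) _).1 (hpow k ▸ hsnd k hk)

theorem setLIntegral_kernel_le_near_add_far {q e ρ M : ℝ} (hq : 0 ≤ q) (he : 0 ≤ e) (hρ : 0 < ρ)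
    {u : 𝔼 → ℝ} {B : Set 𝔼} (hB : MeasurableSet B) (hM : ∀ y ∈ B, |u y| ≤ M) {x : 𝔼} (hx : x ∈ B) :
    ∫⁻ y in B, ENNReal.ofReal (|u x - u y| ^ q / ‖x - y‖ ^ e) ≤
      (∫⁻ k in ball (0 : 𝔼) ρ, ENNReal.ofReal (‖k‖ ^ (-e)) *
        ENNReal.ofReal (|fwdDiff k u x| ^ q)) +
      ENNReal.ofReal ((2 * M) ^ q * ρ ^ (-e)) * volume B := by
  rw [← lintegral_inter_add_sdiff _ B (measurableSet_ball (x := x) (ε := ρ))]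
  refine add_le_add ?_ ?_
  · have hshift := setLIntegral_comp_add_right_le (μ := volume) (fun k : 𝔼 =>
      ENNReal.ofReal (‖k‖ ^ (-e)) * ENNReal.ofReal (|fwdDiff k u x| ^ q)) (-x)
      (hB.inter measurableSet_ball) (measurableSet_ball (x := (0 : 𝔼)) (ε := ρ))
      fun y (hy : y ∈ B ∩ ball x ρ) => by
        simpa [dist_eq_norm, ← sub_eq_add_neg] using hy.2
    refine le_trans (le_of_eq (lintegral_congr fun y => ?_)) hshift
    rw [← ENNReal.ofReal_mul (by positivity), fwdDiff, ← sub_eq_add_neg, add_sub_cancel,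
      abs_sub_comm, norm_sub_rev, Real.rpow_neg (norm_nonneg _), div_eq_inv_mul]
  · calc _ ≤ ∫⁻ _ in B \ ball x ρ, ENNReal.ofReal ((2 * M) ^ q * ρ ^ (-e)) := by
          refine setLIntegral_mono' (hB.diff measurableSet_ball) fun y hy =>
            ENNReal.ofReal_le_ofReal ?_
          have hfar : ρ ≤ ‖x - y‖ := by
            simpa [dist_comm, dist_eq_norm] using hy.2
          have hosc : |u x - u y| ≤ 2 * M := by
            linarith [abs_sub (u x) (u y), hM x hx, hM y hy.1]
          rw [div_eq_mul_inv, ← Real.rpow_neg (norm_nonneg _)]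
          exact mul_le_mul (Real.rpow_le_rpow (abs_nonneg _) hosc hq)
            (Real.rpow_le_rpow_of_nonpos hρ hfar (by linarith)) (by positivity)
            (Real.rpow_nonneg ((abs_nonneg _).trans hosc) q)
      _ ≤ _ := by
          rw [setLIntegral_const]
          gcongr
          exact sdiff_subset

theorem exists_lintegral_norm_rpow_mul_le (hN : 1 ≤ N) {e b : ℝ} (heb : e < N + b) :
    ∃ C : ℝ, 0 < C ∧ ∀ (G : 𝔼 → ℝ≥0∞) (ρ K : ℝ), ρ ≤ 1 → 0 ≤ K → G 0 = 0 →
      (∀ h : 𝔼, ‖h‖ ≤ ρ → G h ≤ ENNReal.ofReal (K * ‖h‖ ^ b)) →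
      ∫⁻ h in ball (0 : 𝔼) ρ, ENNReal.ofReal (‖h‖ ^ (-e)) * G h ≤ ENNReal.ofReal (C * K) := by
  obtain ⟨C, hC, hnear⟩ := exists_lintegral_ball_rpow_le hN (τ := N + b - e) (by linarith)
  refine ⟨C, hC, fun G ρ K hρ1 hK hG0 hG => ?_⟩
  calc _ ≤ ∫⁻ h in ball (0 : 𝔼) ρ, ENNReal.ofReal K *
          ENNReal.ofReal (‖(0 : 𝔼) - h‖ ^ ((N + b - e) - N)) := by
        refine setLIntegral_mono' measurableSet_ball fun h hh => ?_
        rcases eq_or_ne h 0 with rfl | h0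
        · simp [hG0]
        rw [mem_ball_zero_iff] at hh
        refine (mul_le_mul_right (hG h hh.le) _).trans (le_of_eq ?_)
        rw [← ENNReal.ofReal_mul (by positivity), ← ENNReal.ofReal_mul hK, zero_sub, norm_neg,
          mul_left_comm, ← Real.rpow_add (norm_pos_iff.2 h0)]
        congr 3
        ring
    _ ≤ ENNReal.ofReal K * ENNReal.ofReal C := by
        rw [lintegral_const_mul' _ _ ENNReal.ofReal_ne_top]
        gcongr
        exact hnear 0 _ measurableSet_ball (ball_subset_ball (by linarith))
    _ = _ := by rw [← ENNReal.ofReal_mul hK, mul_comm]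

theorem exists_gagliardoEnergy_le_of_fwdDiff (hN : 1 ≤ N) {q e b : ℝ} (hq : 0 < q) (he : 0 ≤ e)
    (heb : e < N + b) :
    ∃ C : ℝ, 0 < C ∧ ∀ u : 𝔼 → ℝ, Measurable u → ∀ (x₀ : 𝔼) (r ρ K M : ℝ), r ≤ 1 → 0 < ρ →
      ρ ≤ 1 → 0 ≤ K → 0 ≤ M → (∀ x ∈ ball x₀ r, |u x| ≤ M) →
      (∀ h : 𝔼, ‖h‖ ≤ ρ → ∫⁻ x in ball x₀ r, ENNReal.ofReal (|fwdDiff h u x| ^ q) ≤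
        ENNReal.ofReal (K * ‖h‖ ^ b)) →
      gagliardoEnergy e q u (ball x₀ r) ≤ ENNReal.ofReal (C * (K + M ^ q * ρ ^ (-e))) := by
  obtain ⟨C₁, hC₁, hnear⟩ := exists_lintegral_norm_rpow_mul_le hN heb
  obtain ⟨C₂, hC₂, hvol⟩ := exists_volume_ball_le (N := N)
  set C := max C₁ (2 ^ q * C₂ * C₂)
  refine ⟨C, lt_of_lt_of_le hC₁ (le_max_left _ _),
    fun u hu x₀ r ρ K M hr hρ hρ1 hK hM hbd hdiff => ?_⟩
  set B := ball x₀ r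
  have hmeas : Measurable fun z : 𝔼 × 𝔼 =>
      ENNReal.ofReal (‖z.2‖ ^ (-e)) * ENNReal.ofReal (|fwdDiff z.2 u z.1| ^ q) := by
    unfold fwdDiff; fun_prop
  calc gagliardoEnergy e q u B
      ≤ ∫⁻ x in B, ((∫⁻ k in ball (0 : 𝔼) ρ, ENNReal.ofReal (‖k‖ ^ (-e)) *
          ENNReal.ofReal (|fwdDiff k u x| ^ q)) +
          ENNReal.ofReal ((2 * M) ^ q * ρ ^ (-e)) * volume B) :=
        setLIntegral_mono' measurableSet_ball fun _ hx =>
          setLIntegral_kernel_le_near_add_far hq.le he hρ measurableSet_ball hbd hx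
    _ = (∫⁻ k in ball (0 : 𝔼) ρ, ENNReal.ofReal (‖k‖ ^ (-e)) *
          ∫⁻ x in B, ENNReal.ofReal (|fwdDiff k u x| ^ q)) +
          ENNReal.ofReal ((2 * M) ^ q * ρ ^ (-e)) * volume B * volume B := by
        rw [lintegral_add_right _ measurable_const, setLIntegral_const,
          lintegral_lintegral_swap hmeas.aemeasurable]
        simp_rw [lintegral_const_mul' _ _ ENNReal.ofReal_ne_top]
    _ ≤ ENNReal.ofReal (C₁ * K) +
          ENNReal.ofReal ((2 * M) ^ q * ρ ^ (-e)) * ENNReal.ofReal C₂ * ENNReal.ofReal C₂ := by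
        gcongr
        · exact hnear _ ρ K hρ1 hK (by simp [fwdDiff, Real.zero_rpow hq.ne']) hdiff
        all_goals exact hvol x₀ r hr
    _ = ENNReal.ofReal (C₁ * K + 2 ^ q * C₂ * C₂ * (M ^ q * ρ ^ (-e))) := by
        rw [← ENNReal.ofReal_mul (by positivity), ← ENNReal.ofReal_mul (by positivity),
          ← ENNReal.ofReal_add (by positivity) (by positivity), Real.mul_rpow (by norm_num) hM]
        congr 1
        ring
    _ ≤ _ := by
        refine ENNReal.ofReal_le_ofReal ?_
        rw [mul_add]
        gcongr
        exacts [le_max_left _ _, le_max_right _ _]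

theorem abs_kernel_sub_le {p a b z₁ z₀ k₁ kp : ℝ} (hp : 2 ≤ p) (hz₁ : |z₁| ≤ 1) (hz₀ : |z₀| ≤ 1)
    (hk₁ : 0 ≤ k₁) (hkp : 0 ≤ kp) :
    |(z₁ - z₀) * k₁ + (spow (p - 2) a - spow (p - 2) b) * kp| ≤
      2 * k₁ + (|a| ^ (p - 1) + |b| ^ (p - 1)) * kp := by
  have hspow (t : ℝ) : |spow (p - 2) t| = |t| ^ (p - 1) := by
    rw [abs_spow (by linarith)]; congr 1; ring
  refine (abs_add_le _ _).trans ?_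
  rw [abs_mul, abs_mul, abs_of_nonneg hk₁, abs_of_nonneg hkp, ← hspow a, ← hspow b]
  gcongr
  · linarith [abs_sub z₁ z₀]
  · exact abs_sub _ _

theorem abs_sub_rpow_mul_le_kernel_mul {p β A B a b z₁ z₀ k₁ kp : ℝ} (hp : 2 ≤ p) (hβ : 1 ≤ β)
    (hab : A - B = a - b) (hz₁ : z₁ ∈ sgnSet a) (hz₀ : z₀ ∈ sgnSet b) (hk₁ : 0 ≤ k₁)
    (hkp : 0 ≤ kp) :
    |A - B| ^ (p - 1 + β) * kp ≤ 2 ^ (p - 1 + β) *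
      (((z₁ - z₀) * k₁ + (spow (p - 2) a - spow (p - 2) b) * kp) *
        (spow (β - 1) A - spow (β - 1) B)) := by
  wlog hBA : B ≤ A generalizing A B a b z₁ z₀
  · have hswap := this (by linarith : B - A = b - a) hz₀ hz₁ (le_of_not_ge hBA)
    rw [abs_sub_comm]
    convert hswap using 2
    ring
  rcases hBA.eq_or_lt with rfl | hlt
  · simp [Real.zero_rpow (by linarith : p - 1 + β ≠ 0)]
  have hlt' : b < a := by linarith
  have hJ := rpow_sub_le_spow_sub (e := p - 2) (by linarith) hlt'.le
  have hg := rpow_sub_le_spow_sub (e := β - 1) (by linarith) hlt.le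
  rw [show p - 2 + 1 = p - 1 by ring, ← hab] at hJ
  rw [sub_add_cancel] at hg
  have hsgn : 0 ≤ (z₁ - z₀) * k₁ :=
    mul_nonneg (sub_nonneg.2 (sgnSet_mono hlt' hz₁ hz₀)) hk₁
  have hpos : 0 < A - B := by linarith
  have hg0 : 0 ≤ spow (β - 1) A - spow (β - 1) B :=
    sub_nonneg.2 (spow_mono (by linarith) hlt.le)
  rw [abs_of_pos hpos, Real.rpow_add hpos, Real.rpow_add (by norm_num)]
  calc (A - B) ^ (p - 1) * (A - B) ^ β * kp
      ≤ 2 ^ (p - 1) * (spow (p - 2) a - spow (p - 2) b) *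
          (2 ^ β * (spow (β - 1) A - spow (β - 1) B)) * kp :=
        mul_le_mul_of_nonneg_right
          (mul_le_mul hJ hg (by positivity) (le_trans (by positivity) hJ)) hkp
    _ = 2 ^ (p - 1) * 2 ^ β * ((0 + (spow (p - 2) a - spow (p - 2) b) * kp) *
        (spow (β - 1) A - spow (β - 1) B)) := by ring
    _ ≤ _ := by gcongr

/-- The pointwise form of the Caccioppoli inequality: `A`, `B` are the values of `Δ_h u` at `x`, `y`
and `a`, `b` are the differences of `u(· + h)` and `u`, so that `A - B = a - b`. -/
theorem min_mul_abs_sub_rpow_mul_le {p β A B a b z₁ z₀ ηx ηy k₁ kp : ℝ} (hp : 2 ≤ p) (hβ : 1 ≤ β)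
    (hab : A - B = a - b) (hz₁ : z₁ ∈ sgnSet a) (hz₀ : z₀ ∈ sgnSet b) (hηx : 0 ≤ ηx)
    (hηy : 0 ≤ ηy) (hk₁ : 0 ≤ k₁) (hkp : 0 ≤ kp) :
    min ηx ηy * (|A - B| ^ (p - 1 + β) * kp) ≤ 2 ^ (p - 1 + β) *
      (((z₁ - z₀) * k₁ + (spow (p - 2) a - spow (p - 2) b) * kp) *
        (spow (β - 1) A * ηx - spow (β - 1) B * ηy) +
        (2 * k₁ + (|a| ^ (p - 1) + |b| ^ (p - 1)) * kp) *
          (|A| ^ β * max (ηx - ηy) 0 + |B| ^ β * max (ηy - ηx) 0)) := by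
  wlog hle : ηy ≤ ηx generalizing A B a b z₁ z₀ ηx ηy
  · have hswap := this (A := B) (B := A) (a := -a) (b := -b) (z₁ := -z₁) (z₀ := -z₀)
      (by linarith) (neg_mem_sgnSet hz₁) (neg_mem_sgnSet hz₀) hηy hηx (le_of_not_ge hle)
    rw [min_comm, abs_sub_comm]
    convert hswap using 2
    simp only [spow_neg, abs_neg]
    ring
  rw [min_eq_right hle, max_eq_left (sub_nonneg.2 hle), max_eq_right (sub_nonpos.2 hle)]
  set K := (z₁ - z₀) * k₁ + (spow (p - 2) a - spow (p - 2) b) * kp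
  set Kb := 2 * k₁ + (|a| ^ (p - 1) + |b| ^ (p - 1)) * kp
  have hmain : ηy * (|A - B| ^ (p - 1 + β) * kp) ≤
      ηy * (2 ^ (p - 1 + β) * (K * (spow (β - 1) A - spow (β - 1) B))) :=
    mul_le_mul_of_nonneg_left (abs_sub_rpow_mul_le_kernel_mul hp hβ hab hz₁ hz₀ hk₁ hkp) hηy
  have herr : -(Kb * (|A| ^ β * (ηx - ηy))) ≤ K * (spow (β - 1) A * (ηx - ηy)) := by
    refine neg_le_of_abs_le ?_
    rw [abs_mul, abs_mul, abs_of_nonneg (sub_nonneg.2 hle), abs_spow (by linarith), sub_add_cancel]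
    have := abs_kernel_sub_le hp (a := a) (b := b) (abs_le_one_of_mem_sgnSet hz₁)
      (abs_le_one_of_mem_sgnSet hz₀) hk₁ hkp
    gcongr
  calc _ ≤ 2 ^ (p - 1 + β) * (ηy * (K * (spow (β - 1) A - spow (β - 1) B))) := by linarith
    _ ≤ 2 ^ (p - 1 + β) * (ηy * (K * (spow (β - 1) A - spow (β - 1) B)) +
          (K * (spow (β - 1) A * (ηx - ηy)) + Kb * (|A| ^ β * (ηx - ηy)))) := by
        gcongr; linarith
    _ = _ := by ring

theorem exists_setLIntegral_rpow_le {β q : ℝ} (hβ : 0 < β) (hβq : β < q) :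
    ∃ C : ℝ, 0 < C ∧ ∀ w : 𝔼 → ℝ, Measurable w → ∀ (x₀ : 𝔼) (r : ℝ), r ≤ 1 →
      ∫⁻ x in ball x₀ r, ENNReal.ofReal (|w x| ^ β) ≤
        ENNReal.ofReal C * (∫⁻ x in ball x₀ r, ENNReal.ofReal (|w x| ^ q)) ^ (β / q) := by
  obtain ⟨C, hC, hvol⟩ := exists_volume_ball_le (N := N)
  have hq : 0 < q := hβ.trans hβq
  have hβq' : 0 ≤ 1 - β / q := by rw [sub_nonneg, div_le_one hq]; exact hβq.le
  refine ⟨C ^ (1 - β / q), by positivity, fun w hw x₀ r hr => ?_⟩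
  have hpow (x : 𝔼) :
      ENNReal.ofReal (|w x| ^ β) = ENNReal.ofReal (|w x| ^ q) ^ (β / q) * 1 ^ (1 - β / q) := by
    rw [ENNReal.ofReal_rpow_of_nonneg (by positivity) (by positivity), ← Real.rpow_mul
      (abs_nonneg _), mul_div_cancel₀ _ hq.ne', ENNReal.one_rpow, mul_one]
  simp_rw [hpow]
  refine (ENNReal.lintegral_mul_norm_pow_le (by fun_prop) (by fun_prop) (by positivity) hβq'
    (by ring)).trans ?_
  rw [setLIntegral_one, mul_comm, ← ENNReal.ofReal_rpow_of_nonneg hC.le hβq']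
  gcongr
  exact hvol x₀ r hr

theorem ball_subset_ball_two {x₀ x : 𝔼} {r : ℝ} (hr : r ≤ 1) (hx : x ∈ ball x₀ r) :
    ball x₀ r ⊆ ball x 2 := by
  intro y hy
  rw [mem_ball] at *
  linarith [dist_triangle_right y x x₀]

theorem exists_setLIntegral_rpow_mul_kernel_le (hN : 1 ≤ N) {s β : ℝ} (hs : s < 1) :
    ∃ C : ℝ, 0 < C ∧ ∀ (w : 𝔼 → ℝ) (x₀ : 𝔼) (r : ℝ), r ≤ 1 →
      ∫⁻ x in ball x₀ r, ∫⁻ y in ball x₀ r,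
        ENNReal.ofReal (|w x| ^ β * (‖x - y‖ / ‖x - y‖ ^ (N + s))) ≤
        ENNReal.ofReal C * ∫⁻ x in ball x₀ r, ENNReal.ofReal (|w x| ^ β) := by
  obtain ⟨C, hC, hball⟩ := exists_lintegral_ball_rpow_le hN (τ := 1 - s) (by linarith)
  refine ⟨C, hC, fun w x₀ r hr => ?_⟩
  rw [← lintegral_const_mul' _ _ ENNReal.ofReal_ne_top]
  refine setLIntegral_mono' measurableSet_ball fun x hx => ?_
  simp_rw [ENNReal.ofReal_mul (Real.rpow_nonneg (abs_nonneg (w x)) β)]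
  rw [lintegral_const_mul' _ _ ENNReal.ofReal_ne_top, mul_comm]
  gcongr
  refine le_trans (lintegral_mono fun y => ENNReal.ofReal_le_ofReal ?_)
    (hball x _ measurableSet_ball (ball_subset_ball_two hr hx))
  rcases (norm_nonneg (x - y)).eq_or_lt with h0 | h0
  · rw [← h0, zero_div]; positivity
  · nth_rewrite 1 [← Real.rpow_one ‖x - y‖]
    rw [← Real.rpow_sub h0]
    apply le_of_eq; congr 1; ring

theorem mul_rpow_div_rpow_eq {n m β θ γ a b t : ℝ} (hm : 0 < m) (hβ : 0 < β) (ha : 0 ≤ a)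
    (hb : 0 ≤ b) (ht : 0 ≤ t) (hbt : t = 0 → b = 0) :
    a ^ β * (t * (b ^ m / t ^ (n + θ))) =
      (a ^ (m + β) * t ^ ((1 - θ + γ * m) * ((m + β) / β) - n)) ^ (β / (m + β)) *
        (b ^ (m + β) / t ^ (n + γ * (m + β))) ^ (m / (m + β)) := by
  have hq : 0 < m + β := by positivity
  rcases ht.eq_or_lt with rfl | ht
  · simp [hbt rfl, Real.zero_rpow hm.ne', Real.zero_rpow hq.ne',
      Real.zero_rpow (div_pos hm hq).ne']
  rw [Real.mul_rpow (by positivity) (by positivity), Real.div_rpow (by positivity) (by positivity),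
    ← Real.rpow_mul ha, ← Real.rpow_mul hb, ← Real.rpow_mul ht.le, ← Real.rpow_mul ht.le,
    mul_div_cancel₀ _ hq.ne', mul_div_cancel₀ _ hq.ne']
  have ht' : t / t ^ (n + θ) = t ^ (((1 - θ + γ * m) * ((m + β) / β) - n) * (β / (m + β))) /
      t ^ ((n + γ * (m + β)) * (m / (m + β))) := by
    nth_rewrite 1 [← Real.rpow_one t]
    rw [← Real.rpow_sub ht, ← Real.rpow_sub ht]
    congr 1
    field_simp
    ring
  linear_combination a ^ β * b ^ m * ht'

theorem exists_lintegral_holder_le (hN : 1 ≤ N) {m β θ γ : ℝ} (hm : 0 < m) (hβ : 0 < β)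
    (hτ : 0 < 1 - θ + γ * m) :
    ∃ C : ℝ, 0 < C ∧ ∀ (w v : 𝔼 → ℝ), Measurable w → Measurable v → ∀ (x₀ : 𝔼) (r : ℝ), r ≤ 1 →
      ∫⁻ x in ball x₀ r, ∫⁻ y in ball x₀ r,
        ENNReal.ofReal (|w x| ^ β * (‖x - y‖ * (|v x - v y| ^ m / ‖x - y‖ ^ (N + θ)))) ≤
        ENNReal.ofReal C *
          (∫⁻ x in ball x₀ r, ENNReal.ofReal (|w x| ^ (m + β))) ^ (β / (m + β)) *
          gagliardoEnergy (N + γ * (m + β)) (m + β) v (ball x₀ r) ^ (m / (m + β)) := by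
  set q := m + β with hq
  have hq0 : 0 < q := by positivity
  set τ := (1 - θ + γ * m) * (q / β)
  obtain ⟨C, hC, hball⟩ := exists_lintegral_ball_rpow_le hN (τ := τ) (by positivity)
  refine ⟨C ^ (β / q), by positivity, fun w v hw hv x₀ r hr => ?_⟩
  set μ := volume.restrict (ball x₀ r)
  set f : 𝔼 × 𝔼 → ℝ≥0∞ := fun z => ENNReal.ofReal (|w z.1| ^ q * ‖z.1 - z.2‖ ^ (τ - N))
  set g : 𝔼 × 𝔼 → ℝ≥0∞ := fun z =>
    ENNReal.ofReal (|v z.1 - v z.2| ^ q / ‖z.1 - z.2‖ ^ (N + γ * q))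
  have hf : Measurable f := by fun_prop
  have hg : Measurable g := by fun_prop
  have hf_le : ∫⁻ z, f z ∂(μ.prod μ) ≤
      ENNReal.ofReal C * ∫⁻ x in ball x₀ r, ENNReal.ofReal (|w x| ^ q) := by
    rw [lintegral_prod _ hf.aemeasurable, ← lintegral_const_mul' _ _ ENNReal.ofReal_ne_top]
    refine setLIntegral_mono' measurableSet_ball fun x hx => ?_
    simp_rw [f, ENNReal.ofReal_mul (Real.rpow_nonneg (abs_nonneg (w x)) q)]
    rw [lintegral_const_mul' _ _ ENNReal.ofReal_ne_top, mul_comm]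
    gcongr
    exact hball x _ measurableSet_ball (ball_subset_ball_two hr hx)
  calc _ = ∫⁻ z, f z ^ (β / q) * g z ^ (m / q) ∂(μ.prod μ) := by
        rw [lintegral_prod _ (by fun_prop)]
        refine lintegral_congr fun x => lintegral_congr fun y => ?_
        simp only [f, g]
        rw [ENNReal.ofReal_rpow_of_nonneg (by positivity) (by positivity),
          ENNReal.ofReal_rpow_of_nonneg (by positivity) (by positivity),
          ← ENNReal.ofReal_mul (by positivity), mul_rpow_div_rpow_eq (γ := γ) hm hβ
          (abs_nonneg _) (abs_nonneg _) (norm_nonneg _) fun h => by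
            rw [norm_sub_eq_zero_iff.1 h, sub_self, abs_zero]]
    _ ≤ (∫⁻ z, f z ∂(μ.prod μ)) ^ (β / q) * (∫⁻ z, g z ∂(μ.prod μ)) ^ (m / q) :=
        ENNReal.lintegral_mul_norm_pow_le hf.aemeasurable hg.aemeasurable (by positivity)
          (by positivity) (by rw [← add_div, add_comm, ← hq, div_self hq0.ne'])
    _ ≤ (ENNReal.ofReal C * ∫⁻ x in ball x₀ r, ENNReal.ofReal (|w x| ^ q)) ^ (β / q) *
          gagliardoEnergy (N + γ * q) q v (ball x₀ r) ^ (m / q) := by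
        rw [lintegral_prod g hg.aemeasurable]
        gcongr
        exact le_rfl
    _ = _ := by
        rw [ENNReal.mul_rpow_of_nonneg _ _ (by positivity),
          ENNReal.ofReal_rpow_of_nonneg hC.le (by positivity)]

theorem lintegral_le_of_le_add {α : Type*} [MeasurableSpace α] {μ : Measure α} {G I F : α → ℝ}
    {c : ℝ} (hc : 0 < c) (hI : Integrable I μ) (hI0 : ∫ z, I z ∂μ = 0) (hF : Measurable F)
    (hF0 : ∀ z, 0 ≤ F z) (hG0 : ∀ z, 0 ≤ G z) (h : ∀ z, G z ≤ c * (I z + F z)) :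
    ∫⁻ z, ENNReal.ofReal (G z) ∂μ ≤ ENNReal.ofReal c * ∫⁻ z, ENNReal.ofReal (F z) ∂μ := by
  by_cases hfin : ∫⁻ z, ENNReal.ofReal (F z) ∂μ = ∞
  · rw [hfin, ENNReal.mul_top (by simpa using hc)]
    exact le_top
  have hFi : Integrable F μ := ⟨hF.aestronglyMeasurable,
    (hasFiniteIntegral_iff_ofReal (.of_forall hF0)).2 (lt_top_iff_ne_top.2 hfin)⟩
  calc ∫⁻ z, ENNReal.ofReal (G z) ∂μ ≤ ∫⁻ z, ENNReal.ofReal (c * (I z + F z)) ∂μ :=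
        lintegral_mono fun z => ENNReal.ofReal_le_ofReal (h z)
    _ = ENNReal.ofReal (∫ z, c * (I z + F z) ∂μ) :=
        (ofReal_integral_eq_lintegral_ofReal ((hI.add hFi).const_mul c)
          (.of_forall fun z => (hG0 z).trans (h z))).symm
    _ = ENNReal.ofReal c * ∫⁻ z, ENNReal.ofReal (F z) ∂μ := by
        rw [integral_const_mul, integral_add hI hFi, hI0, zero_add, ENNReal.ofReal_mul hc.le,
          ofReal_integral_eq_lintegral_ofReal hFi (.of_forall hF0)]

theorem lintegral_prod_symm_le {α : Type*} [MeasurableSpace α] {μ : Measure α} [SFinite μ]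
    {F : α × α → ℝ≥0∞} (hF : Measurable F) (hsymm : ∀ z, F z.swap = F z) {A B : Set α}
    (hzero : ∀ x ∉ A, ∀ y ∉ A, F (x, y) = 0) (hAB : A ⊆ B) :
    ∫⁻ z, F z ∂(μ.prod μ) ≤
      (∫⁻ x in B, ∫⁻ y in B, F (x, y) ∂μ ∂μ) + 2 * ∫⁻ x in A, ∫⁻ y in Bᶜ, F (x, y) ∂μ ∂μ := by
  have hsupp : Function.support F ⊆ B ×ˢ B ∪ (A ×ˢ Bᶜ ∪ Bᶜ ×ˢ A) := by
    rintro ⟨x, y⟩ hz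
    have hA : x ∈ A ∨ y ∈ A := by
      by_contra! hA
      exact hz (hzero x hA.1 y hA.2)
    by_cases hx : x ∈ B <;> by_cases hy : y ∈ B <;>
      simp only [mem_union, mem_prod, mem_compl_iff, hx, hy] <;> grind
  have hswap : ∫⁻ z in Bᶜ ×ˢ A, F z ∂(μ.prod μ) = ∫⁻ x in A, ∫⁻ y in Bᶜ, F (x, y) ∂μ ∂μ := by
    rw [setLIntegral_prod_symm _ hF.aemeasurable]
    exact lintegral_congr fun x => lintegral_congr fun y => hsymm (x, y)
  rw [← setLIntegral_eq_of_support_subset hsupp]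
  refine (lintegral_union_le _ _ _).trans ?_
  rw [two_mul, setLIntegral_prod _ hF.aemeasurable]
  gcongr
  refine (lintegral_union_le _ _ _).trans ?_
  rw [setLIntegral_prod _ hF.aemeasurable, hswap]

/-- The Lipschitz cutoff function that is `1` on the ball of radius `r` and `0` off the ball of
radius `r + ρ`. -/
noncomputable def cutoff (x₀ : 𝔼) (r ρ : ℝ) (x : 𝔼) : ℝ :=
  max 0 (min 1 ((r + ρ - ‖x - x₀‖) / ρ))

theorem measurable_cutoff (x₀ : 𝔼) (r ρ : ℝ) : Measurable (cutoff x₀ r ρ) := by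
  unfold cutoff; fun_prop

theorem cutoff_nonneg (x₀ : 𝔼) (r ρ : ℝ) (x : 𝔼) : 0 ≤ cutoff x₀ r ρ x := le_max_left _ _

theorem cutoff_le_one (x₀ : 𝔼) (r ρ : ℝ) (x : 𝔼) : cutoff x₀ r ρ x ≤ 1 :=
  max_le zero_le_one (min_le_left _ _)

theorem cutoff_eq_one {x₀ x : 𝔼} {r ρ : ℝ} (hρ : 0 < ρ) (hx : x ∈ ball x₀ r) :
    cutoff x₀ r ρ x = 1 := by
  rw [mem_ball, dist_eq_norm] at hx
  rw [cutoff, min_eq_left, max_eq_right zero_le_one]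
  rw [le_div_iff₀ hρ]
  linarith

theorem cutoff_eq_zero {x₀ x : 𝔼} {r ρ : ℝ} (hρ : 0 < ρ) (hx : x ∉ ball x₀ (r + ρ)) :
    cutoff x₀ r ρ x = 0 := by
  rw [mem_ball, dist_eq_norm, not_lt] at hx
  exact max_eq_left ((min_le_right _ _).trans
    (div_nonpos_of_nonpos_of_nonneg (by linarith) hρ.le))

theorem abs_cutoff_sub_le (x₀ : 𝔼) (r : ℝ) {ρ : ℝ} (hρ : 0 < ρ) (x y : 𝔼) :
    |cutoff x₀ r ρ x - cutoff x₀ r ρ y| ≤ ‖x - y‖ / ρ := by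
  unfold cutoff
  rw [max_comm 0, max_comm 0, min_comm 1, min_comm 1]
  refine (abs_max_sub_max_le_abs _ _ _).trans ((abs_inf_sub_inf_le_abs _ _ _).trans ?_)
  rw [← sub_div, abs_div, abs_of_pos hρ, sub_sub_sub_cancel_left, abs_sub_comm]
  gcongr
  simpa using abs_norm_sub_norm_le (x - x₀) (y - x₀)

/-- The left-hand side of the weak formulation, where `Z` is the selection of
`sgn (u x - u y)`. -/
noncomputable def weakForm (p s₁ sp : ℝ) (Z : 𝔼 × 𝔼 → ℝ) (u φ : 𝔼 → ℝ) : ℝ :=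
  (∫ z, Z z * (φ z.1 - φ z.2) / ‖z.1 - z.2‖ ^ ((N : ℝ) + s₁) ∂(volume.prod volume)) +
  ∫ z, spow (p - 2) (u z.1 - u z.2) * (φ z.1 - φ z.2) /
    ‖z.1 - z.2‖ ^ ((N : ℝ) + sp * p) ∂(volume.prod volume)

theorem weakForm_comp_add_right (p s₁ sp : ℝ) (Z : 𝔼 × 𝔼 → ℝ) (u φ : 𝔼 → ℝ) (h : 𝔼) :
    weakForm p s₁ sp (fun z => Z (z + (h, h))) (fun x => u (x + h)) φ =
      weakForm p s₁ sp Z u (fun x => φ (x - h)) := by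
  unfold weakForm
  conv_rhs =>
    rw [← integral_add_right_eq_self _ ((h, h) : 𝔼 × 𝔼),
      ← integral_add_right_eq_self (μ := volume.prod volume) (fun z => spow _ _ * _ / _)
        ((h, h) : 𝔼 × 𝔼)]
  simp

/-- A bounded solution in the ball `B_R(x₀)` whose supremum, tail and energy on this ball are
controlled by `M`. In contrast to `IsWeakSolution`, the function and the selection of its sign are
measurable, and the bounds hold everywhere, not only almost everywhere. -/
structure LocalSolution (p s₁ sp : ℝ) (u : 𝔼 → ℝ) (x₀ : 𝔼) (R M : ℝ) : Prop where
  measurable : Measurable u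
  one_le : 1 ≤ M
  bound : ∀ x ∈ ball x₀ R, |u x| ≤ M
  tail_le : ∫⁻ x in (ball x₀ R)ᶜ, ENNReal.ofReal (|u x| ^ (p - 1) / ‖x - x₀‖ ^ (N + sp * p)) ≤
    ENNReal.ofReal (M ^ (p - 1) * R ^ (-(sp * p)))
  energy_le : gagliardoEnergy (N + sp * p) p u (ball x₀ R) ≤ ENNReal.ofReal (M ^ p)
  energy_one_lt_top : gagliardoEnergy (N + s₁ * 1) 1 u (ball x₀ R) < ∞
  exists_sign : ∃ Z : 𝔼 × 𝔼 → ℝ, Measurable Z ∧ (∀ z, Z z ∈ sgnSet (u z.1 - u z.2)) ∧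
    ∀ φ : 𝔼 → ℝ, MemW s₁ 1 φ univ → MemW sp p φ univ → HasCompactSupport φ →
      tsupport φ ⊆ ball x₀ R → weakForm p s₁ sp Z u φ = 0

theorem gagliardo_lt_top_iff {s q : ℝ} (hq : 0 < q) (u : 𝔼 → ℝ) (A : Set 𝔼) :
    gagliardo s q u A < ∞ ↔ gagliardoEnergy (N + s * q) q u A < ∞ := by
  unfold gagliardo gagliardoEnergy
  rw [ENNReal.rpow_lt_top_iff_of_pos (by positivity)]

theorem MemW.comp_sub_right {s m : ℝ} (hm : 0 < m) {φ : 𝔼 → ℝ} (h : 𝔼) (hφ : MemW s m φ univ) :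
    MemW s m (fun x => φ (x - h)) univ := by
  obtain ⟨hφLp, hφW⟩ := hφ
  refine ⟨?_, ?_⟩
  · rw [Measure.restrict_univ] at *
    exact hφLp.comp_measurePreserving (measurePreserving_sub_right volume h)
  · rw [gagliardo_lt_top_iff hm] at *
    simp_rw [sub_eq_add_neg]
    exact (gagliardoEnergy_comp_add_right_le _ m φ (-h) MeasurableSet.univ MeasurableSet.univ
      (by simp)).trans_lt hφW

theorem LocalSolution.comp_add_right {p s₁ sp R M : ℝ} (hp : 0 < p) {u : 𝔼 → ℝ} {x₀ : 𝔼}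
    (hu : LocalSolution p s₁ sp u x₀ R M) (h : 𝔼) :
    LocalSolution p s₁ sp (fun x => u (x + h)) (x₀ - h) R M := by
  have hball {x : 𝔼} : x ∈ ball (x₀ - h) R ↔ x + h ∈ ball x₀ R := by
    simp only [mem_ball, dist_eq_norm]
    rw [sub_sub_eq_add_sub]
  have hmeas := hu.measurable
  refine ⟨by fun_prop, hu.one_le, fun x hx => hu.bound _ (hball.1 hx), ?_, ?_, ?_, ?_⟩
  · refine le_trans (le_of_eq (lintegral_congr fun x => ?_)) ((setLIntegral_comp_add_right_le
      (fun x => ENNReal.ofReal (|u x| ^ (p - 1) / ‖x - x₀‖ ^ (N + sp * p))) h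
      measurableSet_ball.compl measurableSet_ball.compl
      fun x hx hx' => hx (hball.2 hx')).trans hu.tail_le)
    rw [sub_sub_eq_add_sub]
  · exact (gagliardoEnergy_comp_add_right_le _ _ u h measurableSet_ball measurableSet_ball
      fun x => hball.1).trans hu.energy_le
  · exact (gagliardoEnergy_comp_add_right_le _ _ u h measurableSet_ball measurableSet_ball
      fun x => hball.1).trans_lt hu.energy_one_lt_top
  · obtain ⟨Z, hZm, hZ, hweak⟩ := hu.exists_sign
    refine ⟨fun z => Z (z + (h, h)), by fun_prop, fun z => hZ _, fun φ h₁ hp' hcpt hsupp => ?_⟩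
    rw [weakForm_comp_add_right]
    have htsupp : tsupport (fun x => φ (x - h)) ⊆ (fun x => x - h) ⁻¹' tsupport φ :=
      tsupport_comp_subset_preimage φ (by fun_prop)
    refine hweak _ (h₁.comp_sub_right one_pos h) (hp'.comp_sub_right hp h)
      (hcpt.comp_homeomorph (Homeomorph.subRight h)) fun x hx => ?_
    simpa using hball.1 (hsupp (htsupp hx))

theorem mul_norm_sub_le_of_mem_ball {x₀ x y : 𝔼} {ρ R : ℝ} (hR : R ≤ 1) (hρ : 0 ≤ ρ)
    (hx : x ∈ ball x₀ (R - ρ)) (hy : y ∉ ball x₀ R) : ρ * ‖y - x₀‖ ≤ ‖x - y‖ := by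
  rw [mem_ball, dist_eq_norm] at hx hy
  have htri := norm_sub_le_norm_sub_add_norm_sub y x x₀
  rw [norm_sub_rev y x] at htri
  nlinarith [norm_nonneg (x - x₀)]

theorem setLIntegral_abs_rpow_div_le {m e M ρ R : ℝ} (hm : 0 ≤ m) (he : 0 ≤ e) (hR : R ≤ 1)
    (hρ : 0 < ρ) {u : 𝔼 → ℝ} {x₀ x : 𝔼} (hbd : ∀ y ∈ ball x₀ R, |u y| ≤ M)
    (hx : x ∈ ball x₀ (R - ρ)) :
    ∫⁻ y in {y | ρ ≤ ‖x - y‖}, ENNReal.ofReal (|u y| ^ m / ‖x - y‖ ^ e) ≤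
      ENNReal.ofReal (M ^ m) *
        (∫⁻ y in {y | ρ ≤ ‖x - y‖}, ENNReal.ofReal (1 / ‖x - y‖ ^ e)) +
      ENNReal.ofReal (ρ ^ (-e)) *
        ∫⁻ y in (ball x₀ R)ᶜ, ENNReal.ofReal (|u y| ^ m / ‖y - x₀‖ ^ e) := by
  have hfar : MeasurableSet {y | ρ ≤ ‖x - y‖} := measurableSet_le (by fun_prop) (by fun_prop)
  rw [← lintegral_const_mul' _ _ ENNReal.ofReal_ne_top,
    ← lintegral_const_mul' _ _ ENNReal.ofReal_ne_top,
    ← lintegral_inter_add_sdiff _ _ (measurableSet_ball (x := x₀) (ε := R))]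
  gcongr ?_ + ?_
  · refine (setLIntegral_mono' (hfar.inter measurableSet_ball) fun y hy => ?_).trans
      (lintegral_mono_set inter_subset_left)
    rw [← ENNReal.ofReal_mul (Real.rpow_nonneg ((abs_nonneg _).trans (hbd y hy.2)) _), mul_one_div]
    gcongr
    exact hbd y hy.2
  · refine (setLIntegral_mono' (hfar.diff measurableSet_ball) fun y hy => ?_).trans
      (lintegral_mono_set fun y hy => hy.2)
    have hdist := mul_norm_sub_le_of_mem_ball hR hρ.le hx hy.2
    have hy0 : 0 < ‖y - x₀‖ := by
      have hyR := hy.2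
      rw [mem_ball, dist_eq_norm] at hx hyR
      linarith [norm_nonneg (x - x₀)]
    rw [← ENNReal.ofReal_mul (by positivity)]
    refine ENNReal.ofReal_le_ofReal ?_
    calc |u y| ^ m / ‖x - y‖ ^ e ≤ |u y| ^ m / (ρ * ‖y - x₀‖) ^ e := by gcongr
      _ = _ := by
        rw [Real.mul_rpow hρ.le hy0.le, Real.rpow_neg hρ.le]
        field_simp

theorem setLIntegral_abs_sub_rpow_div_le {m e M : ℝ} (hm : 0 ≤ m) {u : 𝔼 → ℝ} {x : 𝔼}
    (hux : |u x| ≤ M) (A : Set 𝔼) :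
    ∫⁻ y in A, ENNReal.ofReal (|u x - u y| ^ m / ‖x - y‖ ^ e) ≤
      ENNReal.ofReal (2 ^ m) * (ENNReal.ofReal (M ^ m) *
        (∫⁻ y in A, ENNReal.ofReal (1 / ‖x - y‖ ^ e)) +
          ∫⁻ y in A, ENNReal.ofReal (|u y| ^ m / ‖x - y‖ ^ e)) := by
  have hM : 0 ≤ M := (abs_nonneg _).trans hux
  rw [← lintegral_const_mul' _ _ ENNReal.ofReal_ne_top, ← lintegral_add_left (by fun_prop),
    ← lintegral_const_mul' _ _ ENNReal.ofReal_ne_top]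
  refine lintegral_mono fun y => ?_
  rw [← ENNReal.ofReal_mul (by positivity), ← ENNReal.ofReal_add (by positivity) (by positivity),
    ← ENNReal.ofReal_mul (by positivity), mul_one_div, ← add_div, mul_div_assoc']
  gcongr
  exact (abs_sub_rpow_le hm _ _).trans (by gcongr)

theorem LocalSolution.exists_lintegral_tail_le {p s₁ sp : ℝ} (hp : 1 ≤ p) (hsp : 0 < sp) :
    ∃ C : ℝ, 0 < C ∧ ∀ (u : 𝔼 → ℝ) (x₀ : 𝔼) (R M : ℝ),
      LocalSolution p s₁ sp u x₀ R M → R ≤ 1 → ∀ (ρ : ℝ) (x : 𝔼), 0 < ρ →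
      x ∈ ball x₀ (R - ρ) →
      ∫⁻ y in {y | ρ ≤ ‖x - y‖}, ENNReal.ofReal (|u x - u y| ^ (p - 1) /
        ‖x - y‖ ^ (N + sp * p)) ≤
          ENNReal.ofReal (C * M ^ (p - 1) * ρ ^ (-(N + 2 * (sp * p)))) := by
  have hθ : 0 < sp * p := by positivity
  obtain ⟨C, hC, hfar⟩ := exists_lintegral_far_le (N := N) hθ
  set e : ℝ := N + sp * p
  have he0 : 0 < e := by positivity
  refine ⟨2 ^ (p - 1) * (2 * C + 1), by positivity, fun u x₀ R M hu hR ρ x hρ hx => ?_⟩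
  have hm : 0 ≤ p - 1 := by linarith
  have hM : 0 < M := by linarith [hu.one_le]
  have hρR : ρ < R := by linarith [pos_of_mem_ball hx]
  have hux : |u x| ≤ M := hu.bound x (ball_subset_ball (by linarith) hx)
  have hR_le : R ^ (-(sp * p)) ≤ ρ ^ (-(sp * p)) :=
    Real.rpow_le_rpow_of_nonpos hρ hρR.le (by linarith)
  have hρe : ρ ^ (-e) ≤ ρ ^ (-(N + 2 * (sp * p))) :=
    Real.rpow_le_rpow_of_exponent_ge hρ (by linarith) (by linarith)
  calc _ ≤ ENNReal.ofReal (2 ^ (p - 1)) * (ENNReal.ofReal (M ^ (p - 1)) *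
        (∫⁻ y in {y | ρ ≤ ‖x - y‖}, ENNReal.ofReal (1 / ‖x - y‖ ^ e)) +
          ∫⁻ y in {y | ρ ≤ ‖x - y‖}, ENNReal.ofReal (|u y| ^ (p - 1) / ‖x - y‖ ^ e)) :=
        setLIntegral_abs_sub_rpow_div_le hm hux _
    _ ≤ ENNReal.ofReal (2 ^ (p - 1)) * (ENNReal.ofReal (M ^ (p - 1)) *
        ENNReal.ofReal (C * ρ ^ (-e)) + (ENNReal.ofReal (M ^ (p - 1)) *
        ENNReal.ofReal (C * ρ ^ (-e)) + ENNReal.ofReal (ρ ^ (-e)) *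
          ENNReal.ofReal (M ^ (p - 1) * ρ ^ (-(sp * p))))) := by
        refine mul_le_mul_right (add_le_add (mul_le_mul_right (hfar ρ x hρ (by linarith)) _)
          ((setLIntegral_abs_rpow_div_le hm he0.le hR hρ hu.bound hx).trans
          ?_)) _
        gcongr
        · exact hfar ρ x hρ (by linarith)
        · exact hu.tail_le.trans (ENNReal.ofReal_le_ofReal (by gcongr))
    _ = ENNReal.ofReal (2 ^ (p - 1) * (2 * C * ρ ^ (-e) + ρ ^ (-e) * ρ ^ (-(sp * p))) *
          M ^ (p - 1)) := by
        simp_rw [← ENNReal.ofReal_mul (Real.rpow_nonneg hM.le _)]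
        rw [← ENNReal.ofReal_mul (by positivity), ← ENNReal.ofReal_add (by positivity)
          (by positivity), ← ENNReal.ofReal_add (by positivity) (by positivity),
          ← ENNReal.ofReal_mul (by positivity)]
        congr 1
        ring
    _ ≤ _ := by
        refine ENNReal.ofReal_le_ofReal ?_
        rw [← Real.rpow_add hρ, show -e + -(sp * p) = -(N + 2 * (sp * p)) by ring]
        calc _ ≤ 2 ^ (p - 1) * (2 * C * ρ ^ (-(N + 2 * (sp * p))) + ρ ^ (-(N + 2 * (sp * p)))) *
              M ^ (p - 1) := by gcongr
          _ = _ := by ring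

theorem le_norm_sub_of_mem_ball {x₀ x y : 𝔼} {r ρ : ℝ} (hx : x ∈ ball x₀ r)
    (hy : y ∉ ball x₀ (r + ρ)) : ρ ≤ ‖x - y‖ := by
  rw [mem_ball] at *
  rw [← dist_eq_norm]
  linarith [dist_triangle_left y x₀ x]

theorem gagliardoEnergy_eq_setLIntegral_prod {u : 𝔼 → ℝ} (hu : Measurable u) (e q : ℝ)
    (A : Set 𝔼) :
    gagliardoEnergy e q u A = ∫⁻ z in A ×ˢ A,
      ENNReal.ofReal (|u z.1 - u z.2| ^ q / ‖z.1 - z.2‖ ^ e) ∂(volume.prod volume) :=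
  (setLIntegral_prod _ (measurable_gagliardoEnergy_integrand hu e q).aemeasurable).symm

theorem gagliardoEnergy_sub_le {u v : 𝔼 → ℝ} (hu : Measurable u) (hv : Measurable v) (e : ℝ)
    {q : ℝ} (hq : 0 ≤ q) (A : Set 𝔼) :
    gagliardoEnergy e q (u - v) A ≤
      ENNReal.ofReal (2 ^ q) * (gagliardoEnergy e q u A + gagliardoEnergy e q v A) := by
  simp only [gagliardoEnergy_eq_setLIntegral_prod, hu, hv, hu.sub hv]
  rw [← lintegral_add_left (measurable_gagliardoEnergy_integrand hu e q),
    ← lintegral_const_mul' _ _ ENNReal.ofReal_ne_top]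
  refine lintegral_mono fun z => ?_
  rw [← ENNReal.ofReal_add (by positivity) (by positivity), ← ENNReal.ofReal_mul (by positivity),
    ← add_div, ← mul_div_assoc]
  refine ENNReal.ofReal_le_ofReal ?_
  gcongr
  rw [Pi.sub_apply, Pi.sub_apply, sub_sub_sub_comm]
  exact abs_sub_rpow_le hq _ _

theorem gagliardoEnergy_lt_top_of_abs_sub_le (hN : 1 ≤ N) {θ m L r : ℝ} {x₀ : 𝔼} (hm : 0 < m)
    (hθ : θ < m) (hr : r ≤ 1) (hL : 0 ≤ L) {φ w : 𝔼 → ℝ} (hw : Measurable w)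
    (hdiff : ∀ x ∈ ball x₀ r, ∀ y ∈ ball x₀ r, |φ x - φ y| ≤ L * (|w x - w y| + ‖x - y‖))
    (hfin : gagliardoEnergy (N + θ) m w (ball x₀ r) < ∞) :
    gagliardoEnergy (N + θ) m φ (ball x₀ r) < ∞ := by
  obtain ⟨C, -, hnear⟩ := exists_lintegral_ball_rpow_le hN (τ := m - θ) (by linarith)
  have hpt : ∀ x ∈ ball x₀ r, ∀ y ∈ ball x₀ r,
      ENNReal.ofReal (|φ x - φ y| ^ m / ‖x - y‖ ^ (N + θ)) ≤ ENNReal.ofReal (L ^ m * 2 ^ m) *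
        (ENNReal.ofReal (|w x - w y| ^ m / ‖x - y‖ ^ (N + θ)) +
          ENNReal.ofReal (‖x - y‖ ^ (m - θ - N))) := by
    intro x hx y hy
    rw [← ENNReal.ofReal_add (by positivity) (by positivity), ← ENNReal.ofReal_mul (by positivity)]
    refine ENNReal.ofReal_le_ofReal ?_
    rcases (norm_nonneg (x - y)).eq_or_lt with h0 | h0
    · rw [norm_sub_eq_zero_iff.1 h0.symm, sub_self, abs_zero, Real.zero_rpow hm.ne', zero_div]
      positivity
    rw [show m - θ - N = m - (N + θ) by ring, Real.rpow_sub h0, ← add_div, ← mul_div_assoc,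
      mul_assoc]
    gcongr
    calc |φ x - φ y| ^ m ≤ (L * (|w x - w y| + ‖x - y‖)) ^ m := by gcongr; exact hdiff x hx y hy
      _ = L ^ m * (|w x - w y| + ‖x - y‖) ^ m := Real.mul_rpow hL (by positivity)
      _ ≤ _ := by gcongr; exact add_rpow_le_two_rpow (by positivity) (by positivity) hm.le
  calc _ ≤ ∫⁻ x in ball x₀ r, ENNReal.ofReal (L ^ m * 2 ^ m) *
        ((∫⁻ y in ball x₀ r, ENNReal.ofReal (|w x - w y| ^ m / ‖x - y‖ ^ (N + θ))) +
          ENNReal.ofReal C) := by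
        refine setLIntegral_mono' measurableSet_ball fun x hx =>
          (setLIntegral_mono' measurableSet_ball (hpt x hx)).trans ?_
        rw [lintegral_const_mul' _ _ ENNReal.ofReal_ne_top, lintegral_add_left (by fun_prop)]
        gcongr
        exact hnear x _ measurableSet_ball (ball_subset_ball_two hr hx)
    _ = ENNReal.ofReal (L ^ m * 2 ^ m) * (gagliardoEnergy (N + θ) m w (ball x₀ r) +
          ENNReal.ofReal C * volume (ball x₀ r)) := by
        rw [lintegral_const_mul' _ _ ENNReal.ofReal_ne_top, lintegral_add_right _ measurable_const,
          setLIntegral_const, gagliardoEnergy]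
    _ < ∞ := ENNReal.mul_lt_top ENNReal.ofReal_lt_top (ENNReal.add_lt_top.2
        ⟨hfin, ENNReal.mul_lt_top ENNReal.ofReal_lt_top measure_ball_lt_top⟩)

theorem gagliardoEnergy_univ_lt_top {θ m L r ρ : ℝ} {x₀ : 𝔼} (hθ : 0 < θ) (hm : 0 < m)
    (hρ : 0 < ρ) (hρ1 : ρ ≤ 1) {φ : 𝔼 → ℝ} (hφ : Measurable φ) (hbd : ∀ x, |φ x| ≤ L)
    (hsupp : ∀ x ∉ ball x₀ r, φ x = 0)
    (hfin : gagliardoEnergy (N + θ) m φ (ball x₀ (r + ρ)) < ∞) :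
    gagliardoEnergy (N + θ) m φ univ < ∞ := by
  obtain ⟨C, -, hfar⟩ := exists_lintegral_far_le (N := N) hθ
  have hsub : ball x₀ r ⊆ ball x₀ (r + ρ) := ball_subset_ball (by linarith)
  rw [gagliardoEnergy_eq_setLIntegral_prod hφ, univ_prod_univ, setLIntegral_univ]
  refine (lintegral_prod_symm_le (measurable_gagliardoEnergy_integrand hφ _ m)
    (fun z => by rw [Prod.fst_swap, Prod.snd_swap, abs_sub_comm, norm_sub_rev])
    (fun _ hx _ hy => by simp [hsupp _ hx, hsupp _ hy, Real.zero_rpow hm.ne'])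
    hsub).trans_lt (ENNReal.add_lt_top.2 ⟨hfin, ENNReal.mul_lt_top (by simp) ?_⟩)
  calc _ ≤ ∫⁻ _ in ball x₀ r, ENNReal.ofReal (L ^ m) * ENNReal.ofReal (C * ρ ^ (-(N + θ))) := by
        refine setLIntegral_mono' measurableSet_ball fun x hx => ?_
        refine le_trans ?_ (mul_le_mul_right (hfar ρ x hρ hρ1) _)
        rw [← lintegral_const_mul' _ _ ENNReal.ofReal_ne_top]
        refine (setLIntegral_mono' measurableSet_ball.compl fun y hy => ?_).trans
          (lintegral_mono_set fun _ hy => le_norm_sub_of_mem_ball hx hy)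
        have hL : 0 ≤ L := (abs_nonneg _).trans (hbd x₀)
        rw [← ENNReal.ofReal_mul (by positivity), mul_one_div, hsupp y fun h => hy (hsub h),
          sub_zero]
        gcongr
        exact hbd x
    _ < ∞ := by
        rw [setLIntegral_const]
        exact ENNReal.mul_lt_top (ENNReal.mul_lt_top ENNReal.ofReal_lt_top
          ENNReal.ofReal_lt_top) measure_ball_lt_top

theorem support_subset_closedBall {φ : 𝔼 → ℝ} {x₀ : 𝔼} {r : ℝ}
    (hsupp : ∀ x ∉ ball x₀ r, φ x = 0) : Function.support φ ⊆ closedBall x₀ r :=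
  (Function.support_subset_iff'.2 hsupp).trans ball_subset_closedBall

theorem hasCompactSupport_of_ball {φ : 𝔼 → ℝ} {x₀ : 𝔼} {r : ℝ}
    (hsupp : ∀ x ∉ ball x₀ r, φ x = 0) : HasCompactSupport φ :=
  .of_support_subset_isCompact (isCompact_closedBall x₀ r) (support_subset_closedBall hsupp)

theorem tsupport_subset_ball {φ : 𝔼 → ℝ} {x₀ : 𝔼} {r R : ℝ} (hr : r < R)
    (hsupp : ∀ x ∉ ball x₀ r, φ x = 0) : tsupport φ ⊆ ball x₀ R :=
  (closure_minimal (support_subset_closedBall hsupp) isClosed_closedBall).trans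
    (closedBall_subset_ball hr)

theorem memW_of_abs_sub_le (hN : 1 ≤ N) {s m L L' r ρ : ℝ} {x₀ : 𝔼} (hs0 : 0 < s) (hs1 : s < 1)
    (hm : 0 < m) (hρ : 0 < ρ) (hr0 : 0 ≤ r) (hr : r + ρ ≤ 1) (hL' : 0 ≤ L') {φ w : 𝔼 → ℝ}
    (hφ : Measurable φ) (hw : Measurable w) (hbd : ∀ x, |φ x| ≤ L)
    (hsupp : ∀ x ∉ ball x₀ r, φ x = 0)
    (hdiff : ∀ x ∈ ball x₀ (r + ρ), ∀ y ∈ ball x₀ (r + ρ),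
      |φ x - φ y| ≤ L' * (|w x - w y| + ‖x - y‖))
    (hfin : gagliardoEnergy (N + s * m) m w (ball x₀ (r + ρ)) < ∞) : MemW s m φ univ := by
  refine ⟨?_, (gagliardo_lt_top_iff hm _ _).2 ?_⟩
  · rw [Measure.restrict_univ]
    exact (hasCompactSupport_of_ball hsupp).memLp_of_bound hφ.aestronglyMeasurable L
      (.of_forall hbd)
  · exact gagliardoEnergy_univ_lt_top (by positivity) hm hρ (by linarith) hφ hbd hsupp
      (gagliardoEnergy_lt_top_of_abs_sub_le hN hm (by nlinarith) hr hL' hw hdiff hfin)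

theorem integrable_sign_part {s₁ : ℝ} {φ : 𝔼 → ℝ} {Z : 𝔼 × 𝔼 → ℝ} (hφm : Measurable φ)
    (hφ : MemW s₁ 1 φ univ) (hZ : Measurable Z) (hZ1 : ∀ z, |Z z| ≤ 1) :
    Integrable (fun z : 𝔼 × 𝔼 => Z z * (φ z.1 - φ z.2) / ‖z.1 - z.2‖ ^ ((N : ℝ) + s₁))
      (volume.prod volume) := by
  have hfin := (gagliardo_lt_top_iff one_pos φ univ).1 hφ.2
  rw [gagliardoEnergy_eq_setLIntegral_prod hφm, univ_prod_univ, setLIntegral_univ] at hfin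
  refine ⟨(by fun_prop : Measurable _).aestronglyMeasurable, ?_⟩
  rw [hasFiniteIntegral_iff_norm]
  refine (lintegral_mono fun z => ENNReal.ofReal_le_ofReal ?_).trans_lt hfin
  rw [Real.norm_eq_abs, abs_div, abs_mul, Real.rpow_one, mul_one,
    abs_of_nonneg (Real.rpow_nonneg (norm_nonneg _) _)]
  gcongr
  exact mul_le_of_le_one_left (abs_nonneg _) (hZ1 z)

theorem rpow_sub_one_mul_le_add {p a b : ℝ} (hp : 1 ≤ p) (ha : 0 ≤ a) (hb : 0 ≤ b) :
    a ^ (p - 1) * b ≤ a ^ p + b ^ p := by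
  have hpow {t : ℝ} (ht : 0 ≤ t) : t ^ (p - 1) * t = t ^ p := by
    rw [← Real.rpow_add_one' ht (by linarith), sub_add_cancel]
  rcases le_total a b with h | h
  · calc a ^ (p - 1) * b ≤ b ^ (p - 1) * b := by gcongr
      _ ≤ _ := by rw [hpow hb]; exact le_add_of_nonneg_left (by positivity)
  · calc a ^ (p - 1) * b ≤ a ^ (p - 1) * a := by gcongr
      _ ≤ _ := by rw [hpow ha]; exact le_add_of_nonneg_right (by positivity)

theorem setLIntegral_far_lt_top {m e L T r ρ : ℝ} {x₀ : 𝔼} {φ v : 𝔼 → ℝ} (hbd : ∀ x, |φ x| ≤ L)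
    (hsupp : ∀ x ∉ ball x₀ r, φ x = 0) (hρ : 0 < ρ)
    (hfar : ∀ x ∈ ball x₀ r, ∫⁻ y in {y | ρ ≤ ‖x - y‖}, ENNReal.ofReal
      (|v x - v y| ^ m / ‖x - y‖ ^ e) ≤ ENNReal.ofReal T) :
    ∫⁻ x in ball x₀ r, ∫⁻ y in (ball x₀ (r + ρ))ᶜ,
      ENNReal.ofReal (|v x - v y| ^ m * |φ x - φ y| / ‖x - y‖ ^ e) < ∞ := by
  have hL : 0 ≤ L := (abs_nonneg _).trans (hbd x₀)
  calc _ ≤ ∫⁻ _ in ball x₀ r, ENNReal.ofReal L * ENNReal.ofReal T := by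
        refine setLIntegral_mono' measurableSet_ball fun x hx => ?_
        refine le_trans ?_ (mul_le_mul_right (hfar x hx) _)
        rw [← lintegral_const_mul' _ _ ENNReal.ofReal_ne_top]
        refine (setLIntegral_mono' measurableSet_ball.compl fun y hy => ?_).trans
          (lintegral_mono_set fun _ hy => le_norm_sub_of_mem_ball hx hy)
        rw [← ENNReal.ofReal_mul hL, hsupp y fun h => hy (ball_subset_ball (by linarith) h),
          sub_zero, mul_comm, mul_div_assoc]
        gcongr
        exact hbd x
    _ < ∞ := by
        rw [setLIntegral_const]
        exact ENNReal.mul_lt_top (ENNReal.mul_lt_top ENNReal.ofReal_lt_top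
          ENNReal.ofReal_lt_top) measure_ball_lt_top

theorem integrable_power_part {p sp L T r ρ : ℝ} {x₀ : 𝔼} (hp : 2 ≤ p) (hρ : 0 < ρ)
    {φ v : 𝔼 → ℝ} (hφm : Measurable φ) (hv : Measurable v)
    (hφ : MemW sp p φ univ) (hbd : ∀ x, |φ x| ≤ L) (hsupp : ∀ x ∉ ball x₀ r, φ x = 0)
    (hnear : gagliardoEnergy (N + sp * p) p v (ball x₀ (r + ρ)) < ∞)
    (hfar : ∀ x ∈ ball x₀ r, ∫⁻ y in {y | ρ ≤ ‖x - y‖}, ENNReal.ofReal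
      (|v x - v y| ^ (p - 1) / ‖x - y‖ ^ (N + sp * p)) ≤ ENNReal.ofReal T) :
    Integrable (fun z : 𝔼 × 𝔼 => spow (p - 2) (v z.1 - v z.2) * (φ z.1 - φ z.2) /
      ‖z.1 - z.2‖ ^ ((N : ℝ) + sp * p)) (volume.prod volume) := by
  have hspow := measurable_spow (p - 2)
  have hsub : ball x₀ r ⊆ ball x₀ (r + ρ) := ball_subset_ball (by linarith)
  have hφfin := (gagliardoEnergy_mono_set _ _ _ (subset_univ (ball x₀ (r + ρ)))).trans_lt
    ((gagliardo_lt_top_iff (by linarith) φ univ).1 hφ.2)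
  set e : ℝ := N + sp * p
  have hnorm (z : 𝔼 × 𝔼) : ‖spow (p - 2) (v z.1 - v z.2) * (φ z.1 - φ z.2) / ‖z.1 - z.2‖ ^ e‖ =
      |v z.1 - v z.2| ^ (p - 1) * |φ z.1 - φ z.2| / ‖z.1 - z.2‖ ^ e := by
    rw [Real.norm_eq_abs, abs_div, abs_mul, abs_spow (by linarith),
      abs_of_nonneg (Real.rpow_nonneg (norm_nonneg _) _), show p - 2 + 1 = p - 1 by ring]
  refine ⟨(by fun_prop : Measurable _).aestronglyMeasurable, ?_⟩
  simp_rw [hasFiniteIntegral_iff_norm, hnorm]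
  have hmeas : Measurable fun z : 𝔼 × 𝔼 =>
      ENNReal.ofReal (|v z.1 - v z.2| ^ (p - 1) * |φ z.1 - φ z.2| / ‖z.1 - z.2‖ ^ e) := by fun_prop
  refine (lintegral_prod_symm_le hmeas (fun z => by
      rw [Prod.fst_swap, Prod.snd_swap, abs_sub_comm, norm_sub_rev, abs_sub_comm (φ z.2)])
    (fun x hx y hy => by simp [hsupp x hx, hsupp y hy]) hsub).trans_lt
    (ENNReal.add_lt_top.2 ⟨?_, ENNReal.mul_lt_top (by simp) ?_⟩)
  · refine (setLIntegral_prod _ hmeas.aemeasurable).symm.trans_lt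
      (lt_of_le_of_lt ?_ (ENNReal.add_lt_top.2 ⟨hnear, hφfin⟩))
    rw [gagliardoEnergy_eq_setLIntegral_prod hv,
      gagliardoEnergy_eq_setLIntegral_prod hφm,
      ← lintegral_add_left (measurable_gagliardoEnergy_integrand hv _ _)]
    refine lintegral_mono fun z => ?_
    rw [← ENNReal.ofReal_add (by positivity) (by positivity), ← add_div]
    gcongr
    exact rpow_sub_one_mul_le_add (by linarith) (abs_nonneg _) (abs_nonneg _)
  · exact setLIntegral_far_lt_top hbd hsupp hρ hfar

/-- The function with which the difference of the equations of two solutions is tested, where `w`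
is the difference of the solutions. -/
noncomputable def testFunction (β : ℝ) (w : 𝔼 → ℝ) (x₀ : 𝔼) (r ρ : ℝ) (x : 𝔼) : ℝ :=
  spow (β - 1) (w x) * cutoff x₀ r ρ x

section testFunction

variable {β r ρ L : ℝ} {w : EuclideanSpace ℝ (Fin N) → ℝ} {x₀ : EuclideanSpace ℝ (Fin N)}

theorem measurable_testFunction (β : ℝ) (hw : Measurable w) (x₀ : 𝔼) (r ρ : ℝ) :
    Measurable (testFunction β w x₀ r ρ) :=
  ((measurable_spow _).comp hw).mul (measurable_cutoff x₀ r ρ)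

theorem testFunction_eq_zero (hρ : 0 < ρ) {x : 𝔼} (hx : x ∉ ball x₀ (r + ρ)) :
    testFunction β w x₀ r ρ x = 0 := by
  rw [testFunction, cutoff_eq_zero hρ hx, mul_zero]

theorem abs_testFunction_le (hβ : 1 ≤ β) (hρ : 0 < ρ) (hL : 0 ≤ L)
    (hw : ∀ x ∈ ball x₀ (r + ρ), |w x| ≤ L) (x : 𝔼) : |testFunction β w x₀ r ρ x| ≤ L ^ β := by
  by_cases hx : x ∈ ball x₀ (r + ρ)
  · rw [testFunction, abs_mul, abs_spow (by linarith), sub_add_cancel,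
      abs_of_nonneg (cutoff_nonneg x₀ r ρ x)]
    calc |w x| ^ β * cutoff x₀ r ρ x ≤ |w x| ^ β * 1 := by gcongr; exact cutoff_le_one x₀ r ρ x
      _ ≤ L ^ β := by rw [mul_one]; gcongr; exact hw x hx
  · rw [testFunction_eq_zero hρ hx, abs_zero]
    positivity

theorem abs_testFunction_sub_le (hβ : 1 ≤ β) (hρ : 0 < ρ) {x y : 𝔼} (hx : |w x| ≤ L)
    (hy : |w y| ≤ L) :
    |testFunction β w x₀ r ρ x - testFunction β w x₀ r ρ y| ≤
      (β * L ^ (β - 1) + L ^ β / ρ) * (|w x - w y| + ‖x - y‖) := by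
  have hL : 0 ≤ L := (abs_nonneg _).trans hx
  have hspow := abs_spow_sub_le (e := β - 1) (by linarith) hx hy
  have hη := abs_cutoff_sub_le x₀ r hρ x y
  rw [sub_add_cancel] at hspow
  calc _ = |(spow (β - 1) (w x) - spow (β - 1) (w y)) * cutoff x₀ r ρ x +
        spow (β - 1) (w y) * (cutoff x₀ r ρ x - cutoff x₀ r ρ y)| := by
        unfold testFunction; congr 1; ring
    _ ≤ |spow (β - 1) (w x) - spow (β - 1) (w y)| * |cutoff x₀ r ρ x| +
        |spow (β - 1) (w y)| * |cutoff x₀ r ρ x - cutoff x₀ r ρ y| := by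
        rw [← abs_mul, ← abs_mul]; exact abs_add_le _ _
    _ ≤ β * L ^ (β - 1) * |w x - w y| * 1 + L ^ β * (‖x - y‖ / ρ) := by
        rw [abs_spow (by linarith), sub_add_cancel, abs_of_nonneg (cutoff_nonneg x₀ r ρ x)]
        gcongr
        exacts [cutoff_nonneg x₀ r ρ x, cutoff_le_one x₀ r ρ x]
    _ ≤ (β * L ^ (β - 1) * |w x - w y| * 1 + L ^ β * (‖x - y‖ / ρ)) +
        (β * L ^ (β - 1) * ‖x - y‖ + L ^ β / ρ * |w x - w y|) :=
        le_add_of_nonneg_right (by positivity)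
    _ = _ := by ring

theorem memW_testFunction (hN : 1 ≤ N) {s m : ℝ} (hs0 : 0 < s) (hs1 : s < 1) (hm : 0 < m)
    (hβ : 1 ≤ β) (hr0 : 0 ≤ r) (hρ : 0 < ρ) (hr : r + 2 * ρ ≤ 1) (hwm : Measurable w)
    (hL : 0 ≤ L) (hw : ∀ x ∈ ball x₀ (r + 2 * ρ), |w x| ≤ L)
    (hfin : gagliardoEnergy (N + s * m) m w (ball x₀ (r + 2 * ρ)) < ∞) :
    MemW s m (testFunction β w x₀ r ρ) univ := by
  rw [show r + 2 * ρ = r + ρ + ρ by ring] at *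
  exact memW_of_abs_sub_le hN hs0 hs1 hm hρ (by linarith) hr (by positivity)
    (measurable_testFunction β hwm x₀ r ρ) hwm (abs_testFunction_le hβ hρ hL fun x hx =>
      hw x (ball_subset_ball (by linarith) hx)) (fun x hx => testFunction_eq_zero hρ hx)
    (fun x hx y hy => abs_testFunction_sub_le hβ hρ (hw x hx) (hw y hy)) hfin

end testFunction

/-- The integrand of `weakForm`, with its two terms under a single integral. -/
noncomputable def weakIntegrand (p s₁ sp : ℝ) (Z : 𝔼 × 𝔼 → ℝ) (u φ : 𝔼 → ℝ) (z : 𝔼 × 𝔼) : ℝ :=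
  Z z * (φ z.1 - φ z.2) / ‖z.1 - z.2‖ ^ (N + s₁) +
    spow (p - 2) (u z.1 - u z.2) * (φ z.1 - φ z.2) / ‖z.1 - z.2‖ ^ (N + sp * p)

theorem LocalSolution.exists_integral_eq_zero {p s₁ sp R M r ρ L : ℝ} (hp : 2 ≤ p) (hsp : 0 < sp)
    {v φ : 𝔼 → ℝ} {x₀ c : 𝔼} (hv : LocalSolution p s₁ sp v x₀ R M) (hR : R ≤ 1) (hρ : 0 < ρ)
    (hc : ball c (r + ρ) ⊆ ball x₀ (R - ρ)) (hφm : Measurable φ) (hφ₁ : MemW s₁ 1 φ univ)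
    (hφ : MemW sp p φ univ) (hbd : ∀ x, |φ x| ≤ L) (hsupp : ∀ x ∉ ball c r, φ x = 0) :
    ∃ Z : 𝔼 × 𝔼 → ℝ, (∀ z, Z z ∈ sgnSet (v z.1 - v z.2)) ∧
      Integrable (weakIntegrand p s₁ sp Z v φ) (volume.prod volume) ∧
      ∫ z, weakIntegrand p s₁ sp Z v φ z ∂(volume.prod volume) = 0 := by
  obtain ⟨C, -, htail⟩ := LocalSolution.exists_lintegral_tail_le (N := N) (s₁ := s₁) (p := p)
    (by linarith) hsp
  obtain ⟨Z, hZm, hZ, hweak⟩ := hv.exists_sign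
  have hR' : ball x₀ (R - ρ) ⊆ ball x₀ R := ball_subset_ball (by linarith)
  have hI₁ := integrable_sign_part hφm hφ₁ hZm fun z => abs_le_one_of_mem_sgnSet (hZ z)
  have hI := integrable_power_part hp hρ hφm hv.measurable hφ hbd hsupp
    ((gagliardoEnergy_mono_set _ _ _ (hc.trans hR')).trans_lt
      (hv.energy_le.trans_lt ENNReal.ofReal_lt_top))
    fun x hx => htail v x₀ R M hv hR ρ x hρ (hc (ball_subset_ball (by linarith) hx))
  refine ⟨Z, hZ, hI₁.add hI, ?_⟩
  unfold weakIntegrand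
  rw [integral_add hI₁ hI]
  exact hweak φ hφ₁ hφ (hasCompactSupport_of_ball hsupp)
    ((tsupport_subset_ball (by linarith) hsupp).trans (hc.trans hR'))

/-- The bound for the difference of the kernels of the equations of `v` and `v'` that multiplies
the oscillation of the cutoff function in the Caccioppoli inequality. -/
noncomputable def kernelBound (p s₁ sp : ℝ) (v v' : 𝔼 → ℝ) (x y : 𝔼) : ℝ :=
  2 * (1 / ‖x - y‖ ^ (N + s₁)) +
    (|v x - v y| ^ (p - 1) + |v' x - v' y| ^ (p - 1)) * (1 / ‖x - y‖ ^ (N + sp * p))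

theorem kernelBound_nonneg (p s₁ sp : ℝ) (v v' : 𝔼 → ℝ) (x y : 𝔼) :
    0 ≤ kernelBound p s₁ sp v v' x y := by
  unfold kernelBound; positivity

theorem kernelBound_comm (p s₁ sp : ℝ) (v v' : 𝔼 → ℝ) (x y : 𝔼) :
    kernelBound p s₁ sp v v' x y = kernelBound p s₁ sp v v' y x := by
  rw [kernelBound, norm_sub_rev, abs_sub_comm, abs_sub_comm (v' x), kernelBound]

theorem measurable_kernelBound (p s₁ sp : ℝ) {v v' : 𝔼 → ℝ} (hv : Measurable v)
    (hv' : Measurable v') : Measurable fun z : 𝔼 × 𝔼 => kernelBound p s₁ sp v v' z.1 z.2 := by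
  unfold kernelBound; fun_prop

theorem ofReal_mul_kernelBound {a t : ℝ} (ha : 0 ≤ a) (ht : 0 ≤ t) (p s₁ sp : ℝ) (v v' : 𝔼 → ℝ)
    (x y : 𝔼) :
    ENNReal.ofReal (a * (t * kernelBound p s₁ sp v v' x y)) =
      ENNReal.ofReal 2 * ENNReal.ofReal (a * (t / ‖x - y‖ ^ (N + s₁))) +
      (ENNReal.ofReal (a * (t * (|v x - v y| ^ (p - 1) / ‖x - y‖ ^ (N + sp * p)))) +
        ENNReal.ofReal (a * (t * (|v' x - v' y| ^ (p - 1) / ‖x - y‖ ^ (N + sp * p))))) := by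
  rw [← ENNReal.ofReal_mul zero_le_two, ← ENNReal.ofReal_add (by positivity) (by positivity),
    ← ENNReal.ofReal_add (by positivity) (by positivity), kernelBound]
  congr 1
  ring

theorem exists_lintegral_kernelBound_near_le (hN : 1 ≤ N) {p s₁ sp β γ : ℝ} (hp : 1 < p)
    (hs₁ : s₁ < 1) (hβ : 0 < β) (hγ : 0 < 1 - sp * p + γ * (p - 1)) :
    ∃ C : ℝ, 0 < C ∧ ∀ w v v' : 𝔼 → ℝ, Measurable w → Measurable v → Measurable v' →
      ∀ (c : 𝔼) (r : ℝ), r ≤ 1 →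
      ∫⁻ x in ball c r, ∫⁻ y in ball c r,
        ENNReal.ofReal (|w x| ^ β * (‖x - y‖ * kernelBound p s₁ sp v v' x y)) ≤
      ENNReal.ofReal C * (1 +
        gagliardoEnergy (N + γ * (p - 1 + β)) (p - 1 + β) v (ball c r) ^ ((p - 1) / (p - 1 + β)) +
        gagliardoEnergy (N + γ * (p - 1 + β)) (p - 1 + β) v' (ball c r) ^
          ((p - 1) / (p - 1 + β))) *
        (∫⁻ x in ball c r, ENNReal.ofReal (|w x| ^ (p - 1 + β))) ^ (β / (p - 1 + β)) := by
  obtain ⟨C₁, hC₁, hnear⟩ := exists_setLIntegral_rpow_mul_kernel_le (β := β) hN hs₁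
  obtain ⟨C₂, hC₂, hvol⟩ := exists_setLIntegral_rpow_le (N := N) (q := p - 1 + β) hβ (by linarith)
  obtain ⟨C₃, hC₃, hhol⟩ := exists_lintegral_holder_le hN (sub_pos.2 hp) hβ hγ
  refine ⟨2 * (C₁ * C₂) + C₃, by positivity, fun w v v' hw hv hv' c r hr => ?_⟩
  simp_rw [ofReal_mul_kernelBound (Real.rpow_nonneg (abs_nonneg (w _)) β) (norm_nonneg (_ - _))]
  set q := p - 1 + β
  set W := ∫⁻ x in ball c r, ENNReal.ofReal (|w x| ^ q)
  set E := gagliardoEnergy (N + γ * q) q v (ball c r) ^ ((p - 1) / q)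
  set E' := gagliardoEnergy (N + γ * q) q v' (ball c r) ^ ((p - 1) / q)
  calc _ = ENNReal.ofReal 2 * (∫⁻ x in ball c r, ∫⁻ y in ball c r,
          ENNReal.ofReal (|w x| ^ β * (‖x - y‖ / ‖x - y‖ ^ (N + s₁)))) +
        ((∫⁻ x in ball c r, ∫⁻ y in ball c r, ENNReal.ofReal
          (|w x| ^ β * (‖x - y‖ * (|v x - v y| ^ (p - 1) / ‖x - y‖ ^ (N + sp * p))))) +
        ∫⁻ x in ball c r, ∫⁻ y in ball c r, ENNReal.ofReal
          (|w x| ^ β * (‖x - y‖ * (|v' x - v' y| ^ (p - 1) / ‖x - y‖ ^ (N + sp * p))))) := by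
        rw [← lintegral_const_mul' _ _ ENNReal.ofReal_ne_top, ← lintegral_add_left (by fun_prop),
          ← lintegral_add_left (by fun_prop)]
        refine lintegral_congr fun x => ?_
        rw [← lintegral_const_mul' _ _ ENNReal.ofReal_ne_top, ← lintegral_add_left (by fun_prop),
          ← lintegral_add_left (by fun_prop)]
    _ ≤ ENNReal.ofReal 2 * (ENNReal.ofReal C₁ * (ENNReal.ofReal C₂ * W ^ (β / q))) +
        (ENNReal.ofReal C₃ * W ^ (β / q) * E + ENNReal.ofReal C₃ * W ^ (β / q) * E') := by
        gcongr
        · exact (hnear w c r hr).trans (by gcongr; exact hvol w hw c r hr)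
        · exact hhol w v hw hv c r hr
        · exact hhol w v' hw hv' c r hr
    _ = (ENNReal.ofReal (2 * (C₁ * C₂)) + ENNReal.ofReal C₃ * (E + E')) * W ^ (β / q) := by
        rw [ENNReal.ofReal_mul zero_le_two, ENNReal.ofReal_mul hC₁.le]
        ring
    _ ≤ _ := by
        rw [add_assoc 1, mul_add (ENNReal.ofReal (_ + _)), mul_one]
        gcongr <;> linarith [mul_pos hC₁ hC₂]

theorem LocalSolution.exists_lintegral_kernelBound_far_le {p s₁ sp : ℝ} (hp : 1 ≤ p)
    (hs₁ : 0 < s₁) (hsp : 0 < sp) :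
    ∃ C : ℝ, 0 < C ∧ ∀ (v v' : 𝔼 → ℝ) (x₀ x₁ : 𝔼) (R M : ℝ),
      LocalSolution p s₁ sp v x₀ R M → LocalSolution p s₁ sp v' x₁ R M → R ≤ 1 →
      ∀ (ρ : ℝ) (x : 𝔼), 0 < ρ → x ∈ ball x₀ (R - ρ) → x ∈ ball x₁ (R - ρ) →
      ∫⁻ y in {y | ρ ≤ ‖x - y‖}, ENNReal.ofReal (kernelBound p s₁ sp v v' x y) ≤
        ENNReal.ofReal (C * M ^ (p - 1) * ρ ^ (-(N + s₁ + 2 * (sp * p)))) := by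
  obtain ⟨C₁, hC₁, hfar⟩ := exists_lintegral_far_le (N := N) hs₁
  obtain ⟨C₂, hC₂, htail⟩ := LocalSolution.exists_lintegral_tail_le (N := N) (s₁ := s₁) hp hsp
  refine ⟨2 * C₁ + 2 * C₂, by positivity, fun v v' x₀ x₁ R M hv hv' hR ρ x hρ hx hx' => ?_⟩
  have hρ1 : ρ ≤ 1 := by linarith [pos_of_mem_ball hx]
  have hM : 1 ≤ M ^ (p - 1) := Real.one_le_rpow hv.one_le (by linarith)
  have hvm := hv.measurable
  set κ : ℝ := N + s₁ + 2 * (sp * p)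
  have hκ₁ : ρ ^ (-(N + s₁)) ≤ ρ ^ (-κ) :=
    Real.rpow_le_rpow_of_exponent_ge hρ hρ1 (by simp only [κ]; nlinarith)
  have hκ₂ : ρ ^ (-(N + 2 * (sp * p))) ≤ ρ ^ (-κ) :=
    Real.rpow_le_rpow_of_exponent_ge hρ hρ1 (by simp only [κ]; linarith)
  have hsplit (y : 𝔼) : ENNReal.ofReal (kernelBound p s₁ sp v v' x y) =
      ENNReal.ofReal 2 * ENNReal.ofReal (1 / ‖x - y‖ ^ (N + s₁)) +
      (ENNReal.ofReal (|v x - v y| ^ (p - 1) / ‖x - y‖ ^ (N + sp * p)) +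
        ENNReal.ofReal (|v' x - v' y| ^ (p - 1) / ‖x - y‖ ^ (N + sp * p))) := by
    simpa only [one_mul] using ofReal_mul_kernelBound zero_le_one zero_le_one p s₁ sp v v' x y
  simp_rw [hsplit]
  rw [lintegral_add_left (by fun_prop), lintegral_const_mul' _ _ ENNReal.ofReal_ne_top,
    lintegral_add_left (by fun_prop)]
  calc _ ≤ ENNReal.ofReal 2 * ENNReal.ofReal (C₁ * ρ ^ (-(N + s₁))) +
        (ENNReal.ofReal (C₂ * M ^ (p - 1) * ρ ^ (-(N + 2 * (sp * p)))) +
          ENNReal.ofReal (C₂ * M ^ (p - 1) * ρ ^ (-(N + 2 * (sp * p))))) := by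
        gcongr
        · exact hfar ρ x hρ hρ1
        · exact htail v x₀ R M hv hR ρ x hρ hx
        · exact htail v' x₁ R M hv' hR ρ x hρ hx'
    _ = ENNReal.ofReal (2 * C₁ * 1 * ρ ^ (-(N + s₁)) +
          2 * C₂ * M ^ (p - 1) * ρ ^ (-(N + 2 * (sp * p)))) := by
        rw [← ENNReal.ofReal_mul zero_le_two,
          ← ENNReal.ofReal_add (by positivity) (by positivity),
          ← ENNReal.ofReal_add (by positivity) (by positivity)]
        congr 1
        ring
    _ ≤ ENNReal.ofReal (2 * C₁ * M ^ (p - 1) * ρ ^ (-κ) + 2 * C₂ * M ^ (p - 1) * ρ ^ (-κ)) := by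
        gcongr
    _ = _ := by rw [← add_mul, ← add_mul]

theorem LocalSolution.memW_testFunction (hN : 1 ≤ N) {p s₁ sp β R M r ρ : ℝ} (hp : 1 ≤ p)
    (hs₁ : 0 < s₁) (hs₁' : s₁ < 1) (hsp : 0 < sp) (hsp' : sp < 1) (hβ : 1 ≤ β) {v v' : 𝔼 → ℝ}
    {x₀ x₁ c : 𝔼} (hv : LocalSolution p s₁ sp v x₀ R M) (hv' : LocalSolution p s₁ sp v' x₁ R M)
    (hr : 0 ≤ r) (hρ : 0 < ρ) (hrρ : r + 2 * ρ ≤ 1) (hc : ball c (r + 2 * ρ) ⊆ ball x₀ R)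
    (hc' : ball c (r + 2 * ρ) ⊆ ball x₁ R) :
    MemW s₁ 1 (testFunction β (v - v') c r ρ) univ ∧
      MemW sp p (testFunction β (v - v') c r ρ) univ ∧
      ∀ x, |testFunction β (v - v') c r ρ x| ≤ (M + M) ^ β := by
  have hvm := hv.measurable
  have hvm' := hv'.measurable
  have hM : 0 ≤ M + M := by linarith [hv.one_le]
  have hbd : ∀ x ∈ ball c (r + 2 * ρ), |(v - v') x| ≤ M + M := fun x hx =>
    (abs_sub _ _).trans (add_le_add (hv.bound x (hc hx)) (hv'.bound x (hc' hx)))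
  have hfin {e q : ℝ} (hq : 0 ≤ q) (h : gagliardoEnergy e q v (ball x₀ R) < ∞)
      (h' : gagliardoEnergy e q v' (ball x₁ R) < ∞) :
      gagliardoEnergy e q (v - v') (ball c (r + 2 * ρ)) < ∞ :=
    (gagliardoEnergy_sub_le hvm hvm' e hq _).trans_lt
      (ENNReal.mul_lt_top ENNReal.ofReal_lt_top (ENNReal.add_lt_top.2
        ⟨(gagliardoEnergy_mono_set _ _ _ hc).trans_lt h,
          (gagliardoEnergy_mono_set _ _ _ hc').trans_lt h'⟩))
  refine ⟨?_, ?_, abs_testFunction_le hβ hρ hM fun x hx =>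
    hbd x (ball_subset_ball (by linarith) hx)⟩
  · exact NonlocalOneP.memW_testFunction hN hs₁ hs₁' one_pos hβ hr hρ hrρ (hvm.sub hvm') hM hbd
      (hfin zero_le_one hv.energy_one_lt_top hv'.energy_one_lt_top)
  · exact NonlocalOneP.memW_testFunction hN hsp hsp' (by linarith) hβ hr hρ hrρ (hvm.sub hvm') hM
      hbd (hfin (by linarith) (hv.energy_le.trans_lt ENNReal.ofReal_lt_top)
        (hv'.energy_le.trans_lt ENNReal.ofReal_lt_top))

theorem min_mul_kernel_le_weakIntegrand_sub {p s₁ sp β r ρ : ℝ} (hp : 2 ≤ p) (hβ : 1 ≤ β)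
    {v v' : 𝔼 → ℝ} {c : 𝔼} {Z Z' : 𝔼 × 𝔼 → ℝ} {z : 𝔼 × 𝔼} (hZ : Z z ∈ sgnSet (v z.1 - v z.2))
    (hZ' : Z' z ∈ sgnSet (v' z.1 - v' z.2)) :
    min (cutoff c r ρ z.1) (cutoff c r ρ z.2) *
      (|(v - v') z.1 - (v - v') z.2| ^ (p - 1 + β) * (1 / ‖z.1 - z.2‖ ^ (N + sp * p))) ≤
    2 ^ (p - 1 + β) * ((weakIntegrand p s₁ sp Z v (testFunction β (v - v') c r ρ) z -
      weakIntegrand p s₁ sp Z' v' (testFunction β (v - v') c r ρ) z) +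
      kernelBound p s₁ sp v v' z.1 z.2 *
        (|(v - v') z.1| ^ β * max (cutoff c r ρ z.1 - cutoff c r ρ z.2) 0 +
          |(v - v') z.2| ^ β * max (cutoff c r ρ z.2 - cutoff c r ρ z.1) 0)) := by
  convert min_mul_abs_sub_rpow_mul_le hp hβ (A := (v - v') z.1) (B := (v - v') z.2)
    (sub_sub_sub_comm ..) hZ hZ' (cutoff_nonneg c r ρ z.1) (cutoff_nonneg c r ρ z.2)
    (k₁ := 1 / ‖z.1 - z.2‖ ^ (N + s₁)) (by positivity)
    (kp := 1 / ‖z.1 - z.2‖ ^ (N + sp * p)) (by positivity) using 3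
  · unfold weakIntegrand testFunction
    ring
  · rfl

theorem LocalSolution.gagliardoEnergy_sub_le (hN : 1 ≤ N) {p s₁ sp β R M r ρ : ℝ} (hp : 2 ≤ p)
    (hs₁ : 0 < s₁) (hs₁' : s₁ < 1) (hsp : 0 < sp) (hsp' : sp < 1) (hβ : 1 ≤ β) {v v' : 𝔼 → ℝ}
    {x₀ x₁ c : 𝔼} (hv : LocalSolution p s₁ sp v x₀ R M) (hv' : LocalSolution p s₁ sp v' x₁ R M)
    (hR : R ≤ 1) (hr : 0 ≤ r) (hρ : 0 < ρ) (hrρ : r + 2 * ρ ≤ 1)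
    (hc : ball c (r + 2 * ρ) ⊆ ball x₀ (R - ρ)) (hc' : ball c (r + 2 * ρ) ⊆ ball x₁ (R - ρ)) :
    gagliardoEnergy (N + sp * p) (p - 1 + β) (v - v') (ball c r) ≤
      ENNReal.ofReal (2 ^ (p - 1 + β)) *
      ∫⁻ z, ENNReal.ofReal (kernelBound p s₁ sp v v' z.1 z.2 *
        (|(v - v') z.1| ^ β * max (cutoff c r ρ z.1 - cutoff c r ρ z.2) 0 +
          |(v - v') z.2| ^ β * max (cutoff c r ρ z.2 - cutoff c r ρ z.1) 0))
        ∂(volume.prod volume) := by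
  have hwm : Measurable (v - v') := hv.measurable.sub hv'.measurable
  have hη : Measurable (cutoff c r ρ) := measurable_cutoff c r ρ
  have hk := measurable_kernelBound p s₁ sp hv.measurable hv'.measurable
  have hR' (x : 𝔼) : ball x (R - ρ) ⊆ ball x R := ball_subset_ball (by linarith)
  obtain ⟨hφ₁, hφ, hφbd⟩ := hv.memW_testFunction hN (by linarith) hs₁ hs₁' hsp hsp' hβ hv' hr hρ
    hrρ (hc.trans (hR' _)) (hc'.trans (hR' _))
  have hφm := measurable_testFunction β hwm c r ρ
  have hφsupp (x : 𝔼) (hx : x ∉ ball c (r + ρ)) : testFunction β (v - v') c r ρ x = 0 :=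
    testFunction_eq_zero hρ hx
  rw [show r + 2 * ρ = r + ρ + ρ by ring] at hc hc'
  obtain ⟨Z, hZ, hI, hI0⟩ :=
    hv.exists_integral_eq_zero hp hsp hR hρ hc hφm hφ₁ hφ hφbd hφsupp
  obtain ⟨Z', hZ', hI', hI0'⟩ :=
    hv'.exists_integral_eq_zero hp hsp hR hρ hc' hφm hφ₁ hφ hφbd hφsupp
  refine le_trans ?_ (lintegral_le_of_le_add (by positivity) (hI.sub hI')
    (by rw [integral_sub' hI hI', hI0, hI0', sub_zero]) (by fun_prop)
    (fun z => mul_nonneg (kernelBound_nonneg ..) (by positivity))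
    (fun z => mul_nonneg (le_min (cutoff_nonneg ..) (cutoff_nonneg ..)) (by positivity))
    fun z => min_mul_kernel_le_weakIntegrand_sub hp hβ (hZ z) (hZ' z))
  rw [gagliardoEnergy_eq_setLIntegral_prod hwm]
  refine (setLIntegral_mono' (measurableSet_ball.prod measurableSet_ball) fun z hz => ?_).trans
    (setLIntegral_le_lintegral _ _)
  rw [cutoff_eq_one hρ hz.1, cutoff_eq_one hρ hz.2, min_self, one_mul, mul_one_div]

theorem lintegral_add_comp_swap {α : Type*} [MeasurableSpace α] {μ : Measure α} [SFinite μ]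
    {F : α × α → ℝ≥0∞} (hF : Measurable F) :
    ∫⁻ z, (F z + F z.swap) ∂(μ.prod μ) = 2 * ∫⁻ z, F z ∂(μ.prod μ) := by
  rw [lintegral_add_left hF, lintegral_prod_swap, two_mul]

theorem lintegral_kernel_mul_cutoff_sub_le {c : 𝔼} {r ρ : ℝ} (hρ : 0 < ρ) {k : 𝔼 → 𝔼 → ℝ}
    (hk : ∀ x y, 0 ≤ k x y) (hkm : Measurable fun z : 𝔼 × 𝔼 => k z.1 z.2) {g : 𝔼 → ℝ}
    (hg : ∀ x, 0 ≤ g x) (hgm : Measurable g) :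
    ∫⁻ z, ENNReal.ofReal (k z.1 z.2 * (g z.1 * max (cutoff c r ρ z.1 - cutoff c r ρ z.2) 0))
        ∂(volume.prod volume) ≤
      ENNReal.ofReal ρ⁻¹ * (∫⁻ x in ball c (r + 2 * ρ), ∫⁻ y in ball c (r + 2 * ρ),
        ENNReal.ofReal (g x * (‖x - y‖ * k x y))) +
      ∫⁻ x in ball c (r + ρ), ENNReal.ofReal (g x) *
        ∫⁻ y in {y | ρ ≤ ‖x - y‖}, ENNReal.ofReal (k x y) := by
  set η := cutoff c r ρ
  have hη : Measurable η := measurable_cutoff c r ρ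
  set F : 𝔼 × 𝔼 → ℝ≥0∞ := fun z => ENNReal.ofReal (k z.1 z.2 * (g z.1 * max (η z.1 - η z.2) 0))
  have hsub : ball c (r + ρ) ⊆ ball c (r + 2 * ρ) := ball_subset_ball (by linarith)
  have hzero (x : 𝔼) (hx : x ∉ ball c (r + ρ)) (y : 𝔼) : F (x, y) = 0 := by
    have hηx : η x = 0 := cutoff_eq_zero hρ hx
    have : max (η x - η y) 0 = 0 := max_eq_right (by linarith [cutoff_nonneg c r ρ y])
    simp only [F, this, mul_zero, ENNReal.ofReal_zero]
  have hnear (x y : 𝔼) :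
      F (x, y) ≤ ENNReal.ofReal ρ⁻¹ * ENNReal.ofReal (g x * (‖x - y‖ * k x y)) := by
    rw [← ENNReal.ofReal_mul (by positivity)]
    refine ENNReal.ofReal_le_ofReal ?_
    calc k x y * (g x * max (η x - η y) 0) ≤ k x y * (g x * (‖x - y‖ / ρ)) :=
          mul_le_mul_of_nonneg_left (mul_le_mul_of_nonneg_left (max_le
            ((le_abs_self _).trans (abs_cutoff_sub_le c r hρ x y)) (by positivity)) (hg x)) (hk x y)
      _ = _ := by ring
  have hfar (x y : 𝔼) : F (x, y) ≤ ENNReal.ofReal (g x) * ENNReal.ofReal (k x y) := by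
    rw [← ENNReal.ofReal_mul (hg x), mul_comm]
    exact ENNReal.ofReal_le_ofReal (mul_le_mul_of_nonneg_left (mul_le_of_le_one_right (hg x)
      (max_le (by linarith [cutoff_le_one c r ρ x, cutoff_nonneg c r ρ y]) zero_le_one)) (hk x y))
  calc ∫⁻ z, F z ∂(volume.prod volume) = ∫⁻ x in ball c (r + ρ), ∫⁻ y, F (x, y) := by
        rw [lintegral_prod _ (by fun_prop)]
        exact (setLIntegral_eq_of_support_subset
          (Function.support_subset_iff'.2 fun x hx => by simp [hzero x hx])).symm
    _ = (∫⁻ x in ball c (r + ρ), ∫⁻ y in ball c (r + 2 * ρ), F (x, y)) +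
          ∫⁻ x in ball c (r + ρ), ∫⁻ y in (ball c (r + 2 * ρ))ᶜ, F (x, y) := by
        rw [← lintegral_add_left (by fun_prop)]
        simp_rw [lintegral_add_compl _ measurableSet_ball]
    _ ≤ _ := by
        refine add_le_add ?_ (setLIntegral_mono' measurableSet_ball fun x hx => ?_)
        · rw [← lintegral_const_mul' _ _ ENNReal.ofReal_ne_top]
          simp_rw [← lintegral_const_mul' _ _ ENNReal.ofReal_ne_top]
          exact (lintegral_mono_set hsub).trans
            (lintegral_mono fun x => lintegral_mono fun y => hnear x y)
        · rw [← lintegral_const_mul' _ _ ENNReal.ofReal_ne_top]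
          rw [show r + 2 * ρ = r + ρ + ρ by ring]
          exact (lintegral_mono_set fun y hy => le_norm_sub_of_mem_ball hx hy).trans
            (lintegral_mono fun y => hfar x y)

theorem LocalSolution.gagliardoEnergy_sub_le_near_add_far (hN : 1 ≤ N) {p s₁ sp β R M r ρ : ℝ}
    (hp : 2 ≤ p) (hs₁ : 0 < s₁) (hs₁' : s₁ < 1) (hsp : 0 < sp) (hsp' : sp < 1) (hβ : 1 ≤ β)
    {v v' : 𝔼 → ℝ} {x₀ x₁ c : 𝔼} (hv : LocalSolution p s₁ sp v x₀ R M)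
    (hv' : LocalSolution p s₁ sp v' x₁ R M) (hR : R ≤ 1) (hr : 0 ≤ r) (hρ : 0 < ρ)
    (hrρ : r + 2 * ρ ≤ 1) (hc : ball c (r + 2 * ρ) ⊆ ball x₀ (R - ρ))
    (hc' : ball c (r + 2 * ρ) ⊆ ball x₁ (R - ρ)) :
    gagliardoEnergy (N + sp * p) (p - 1 + β) (v - v') (ball c r) ≤
      ENNReal.ofReal (2 ^ (p - 1 + β)) * (2 * (ENNReal.ofReal ρ⁻¹ *
        (∫⁻ x in ball c (r + 2 * ρ), ∫⁻ y in ball c (r + 2 * ρ),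
          ENNReal.ofReal (|(v - v') x| ^ β * (‖x - y‖ * kernelBound p s₁ sp v v' x y))) +
        ∫⁻ x in ball c (r + ρ), ENNReal.ofReal (|(v - v') x| ^ β) *
          ∫⁻ y in {y | ρ ≤ ‖x - y‖}, ENNReal.ofReal (kernelBound p s₁ sp v v' x y))) := by
  have hwm : Measurable (v - v') := hv.measurable.sub hv'.measurable
  have hk := measurable_kernelBound p s₁ sp hv.measurable hv'.measurable
  have hη : Measurable (cutoff c r ρ) := measurable_cutoff c r ρ
  have hk0 := kernelBound_nonneg p s₁ sp v v'
  refine (hv.gagliardoEnergy_sub_le hN hp hs₁ hs₁' hsp hsp' hβ hv' hR hr hρ hrρ hc hc').trans ?_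
  refine mul_le_mul_right (le_of_eq_of_le ?_ (mul_le_mul_right
    (lintegral_kernel_mul_cutoff_sub_le (c := c) (r := r) hρ hk0 hk
      (g := fun x => |(v - v') x| ^ β) (fun x => by positivity) (by fun_prop)) 2)) _
  rw [← lintegral_add_comp_swap (by fun_prop)]
  refine lintegral_congr fun z => ?_
  have hkz := hk0 z.1 z.2
  rw [Prod.fst_swap, Prod.snd_swap, kernelBound_comm p s₁ sp v v' z.2,
    ← ENNReal.ofReal_add (by positivity) (by positivity), ← mul_add]

theorem LocalSolution.exists_setLIntegral_mul_far_le {p s₁ sp β : ℝ} (hp : 1 < p)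
    (hs₁ : 0 < s₁) (hsp : 0 < sp) (hβ : 0 < β) :
    ∃ C : ℝ, 0 < C ∧ ∀ (v v' : 𝔼 → ℝ) (x₀ x₁ : 𝔼) (R M : ℝ),
      LocalSolution p s₁ sp v x₀ R M → LocalSolution p s₁ sp v' x₁ R M → R ≤ 1 →
      ∀ (w : 𝔼 → ℝ) (c : 𝔼) (r ρ : ℝ), Measurable w → 0 < ρ → r ≤ 1 →
      ball c r ⊆ ball x₀ (R - ρ) → ball c r ⊆ ball x₁ (R - ρ) →
      ∫⁻ x in ball c r, ENNReal.ofReal (|w x| ^ β) *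
        ∫⁻ y in {y | ρ ≤ ‖x - y‖}, ENNReal.ofReal (kernelBound p s₁ sp v v' x y) ≤
      ENNReal.ofReal (C * ρ ^ (-(N + s₁ + 2 * (sp * p)))) * ENNReal.ofReal (M ^ (p - 1)) *
        (∫⁻ x in ball c r, ENNReal.ofReal (|w x| ^ (p - 1 + β))) ^ (β / (p - 1 + β)) := by
  obtain ⟨C, hC, hfar⟩ :=
    LocalSolution.exists_lintegral_kernelBound_far_le (N := N) hp.le hs₁ hsp
  obtain ⟨C', hC', hvol⟩ := exists_setLIntegral_rpow_le (N := N) hβ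
    (show β < p - 1 + β by linarith)
  refine ⟨C * C', by positivity, fun v v' x₀ x₁ R M hv hv' hR w c r ρ hw hρ hr hc hc' => ?_⟩
  set κ : ℝ := N + s₁ + 2 * (sp * p)
  set W := (∫⁻ x in ball c r, ENNReal.ofReal (|w x| ^ (p - 1 + β))) ^ (β / (p - 1 + β))
  calc _ ≤ ∫⁻ x in ball c r, ENNReal.ofReal (|w x| ^ β) *
          ENNReal.ofReal (C * M ^ (p - 1) * ρ ^ (-κ)) :=
        setLIntegral_mono' measurableSet_ball fun x hx => mul_le_mul_right
          (hfar v v' x₀ x₁ R M hv hv' hR ρ x hρ (hc hx) (hc' hx)) _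
    _ ≤ ENNReal.ofReal C' * W * ENNReal.ofReal (C * M ^ (p - 1) * ρ ^ (-κ)) := by
        rw [lintegral_mul_const' _ _ ENNReal.ofReal_ne_top]
        exact mul_le_mul_left (hvol w hw c r hr) _
    _ = _ := by
        rw [← ENNReal.ofReal_mul (by positivity), mul_right_comm, ← ENNReal.ofReal_mul hC'.le]
        congr 2
        ring

theorem LocalSolution.exists_gagliardoEnergy_sub_le (hN : 1 ≤ N) {p s₁ sp β γ : ℝ} (hp : 2 ≤ p)
    (hs₁ : 0 < s₁) (hs₁' : s₁ < 1) (hsp : 0 < sp) (hsp' : sp < 1) (hβ : 1 ≤ β)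
    (hγ : 0 < 1 - sp * p + γ * (p - 1)) :
    ∃ C κ : ℝ, 0 < C ∧ 0 < κ ∧ ∀ (v v' : 𝔼 → ℝ) (x₀ x₁ : 𝔼) (R M : ℝ),
      LocalSolution p s₁ sp v x₀ R M → LocalSolution p s₁ sp v' x₁ R M → R ≤ 1 →
      ∀ (c : 𝔼) (r ρ : ℝ), 0 ≤ r → 0 < ρ → r + 2 * ρ ≤ 1 →
      ball c (r + 2 * ρ) ⊆ ball x₀ (R - ρ) → ball c (r + 2 * ρ) ⊆ ball x₁ (R - ρ) →
      gagliardoEnergy (N + sp * p) (p - 1 + β) (v - v') (ball c r) ≤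
        ENNReal.ofReal (C * ρ ^ (-κ)) * (ENNReal.ofReal (M ^ (p - 1)) +
          gagliardoEnergy (N + γ * (p - 1 + β)) (p - 1 + β) v (ball c (r + 2 * ρ)) ^
            ((p - 1) / (p - 1 + β)) +
          gagliardoEnergy (N + γ * (p - 1 + β)) (p - 1 + β) v' (ball c (r + 2 * ρ)) ^
            ((p - 1) / (p - 1 + β))) *
        (∫⁻ x in ball c (r + 2 * ρ), ENNReal.ofReal (|(v - v') x| ^ (p - 1 + β))) ^
          (β / (p - 1 + β)) := by
  have hβ0 : 0 < β := by linarith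
  obtain ⟨C₁, hC₁, hnear⟩ := exists_lintegral_kernelBound_near_le hN (by linarith) hs₁' hβ0 hγ
  obtain ⟨C₂, hC₂, hfar⟩ :=
    LocalSolution.exists_setLIntegral_mul_far_le (N := N) (p := p) (by linarith) hs₁ hsp hβ0
  set q := p - 1 + β
  set κ : ℝ := N + s₁ + 2 * (sp * p)
  refine ⟨2 ^ q * (2 * (C₁ + C₂)), κ + 1, by positivity, by positivity,
    fun v v' x₀ x₁ R M hv hv' hR c r ρ hr hρ hrρ hc hc' => ?_⟩
  refine (hv.gagliardoEnergy_sub_le_near_add_far hN hp hs₁ hs₁' hsp hsp' hβ hv' hR hr hρ hrρ hc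
    hc').trans ?_
  have hwm : Measurable (v - v') := hv.measurable.sub hv'.measurable
  have hM : 1 ≤ M ^ (p - 1) := Real.one_le_rpow hv.one_le (by linarith)
  have hρκ : ρ⁻¹ ≤ ρ ^ (-(κ + 1)) := by
    rw [← Real.rpow_neg_one]
    exact Real.rpow_le_rpow_of_exponent_ge hρ (by linarith)
      (by linarith [show 0 < κ by positivity])
  have hρκ' : ρ ^ (-κ) ≤ ρ ^ (-(κ + 1)) :=
    Real.rpow_le_rpow_of_exponent_ge hρ (by linarith) (by linarith)
  set B := ball c (r + 2 * ρ)
  set W := (∫⁻ x in B, ENNReal.ofReal (|(v - v') x| ^ q)) ^ (β / q)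
  set E := gagliardoEnergy (N + γ * q) q v B ^ ((p - 1) / q)
  set E' := gagliardoEnergy (N + γ * q) q v' B ^ ((p - 1) / q)
  have hsub : ball c (r + ρ) ⊆ B := ball_subset_ball (by linarith)
  calc _ ≤ ENNReal.ofReal (2 ^ q) * (2 * (ENNReal.ofReal (ρ ^ (-(κ + 1))) *
        (ENNReal.ofReal C₁ * (ENNReal.ofReal (M ^ (p - 1)) + E + E') * W) +
        ENNReal.ofReal (C₂ * ρ ^ (-(κ + 1))) *
          (ENNReal.ofReal (M ^ (p - 1)) + E + E') * W)) := by
        gcongr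
        · refine (hnear _ v v' hwm hv.measurable hv'.measurable c _ hrρ).trans ?_
          gcongr
          simpa using ENNReal.ofReal_le_ofReal hM
        · refine (lintegral_mono_set hsub).trans
            ((hfar v v' x₀ x₁ R M hv hv' hR _ c _ ρ hwm hρ hrρ hc hc').trans ?_)
          gcongr
          rw [add_assoc]
          exact le_self_add
    _ = _ := by
        rw [ENNReal.ofReal_mul (by positivity : 0 ≤ 2 ^ q * (2 * (C₁ + C₂))),
          ENNReal.ofReal_mul (by positivity : (0 : ℝ) ≤ 2 ^ q), ENNReal.ofReal_mul zero_le_two,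
          ENNReal.ofReal_add hC₁.le hC₂.le, ENNReal.ofReal_mul hC₂.le, ENNReal.ofReal_ofNat]
        ring

theorem LocalSolution.exists_gagliardoEnergy_fwdDiff_le (hN : 1 ≤ N) {p s₁ sp β γ : ℝ}
    (hp : 2 ≤ p) (hs₁ : 0 < s₁) (hs₁' : s₁ < 1) (hsp : 0 < sp) (hsp' : sp < 1) (hβ : 1 ≤ β)
    (hγ : 0 < 1 - sp * p + γ * (p - 1)) :
    ∃ C κ : ℝ, 0 < C ∧ 0 < κ ∧ ∀ (u : 𝔼 → ℝ) (x₀ : 𝔼) (R M : ℝ), LocalSolution p s₁ sp u x₀ R M →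
      R ≤ 1 → ∀ (r ρ : ℝ) (h : 𝔼), 0 ≤ r → 0 < ρ → r + 4 * ρ ≤ R → ‖h‖ ≤ ρ →
      gagliardoEnergy (N + sp * p) (p - 1 + β) (fwdDiff h u) (ball x₀ r) ≤
        ENNReal.ofReal (C * ρ ^ (-κ)) * (ENNReal.ofReal (M ^ (p - 1)) +
          gagliardoEnergy (N + γ * (p - 1 + β)) (p - 1 + β) u (ball x₀ (r + 3 * ρ)) ^
            ((p - 1) / (p - 1 + β))) *
        (∫⁻ x in ball x₀ (r + 2 * ρ), ENNReal.ofReal (|fwdDiff h u x| ^ (p - 1 + β))) ^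
          (β / (p - 1 + β)) := by
  obtain ⟨C, κ, hC, hκ, hsub⟩ :=
    LocalSolution.exists_gagliardoEnergy_sub_le hN hp hs₁ hs₁' hsp hsp' hβ hγ
  refine ⟨2 * C, κ, by positivity, hκ, fun u x₀ R M hu hR r ρ h hr hρ hrρ hh => ?_⟩
  set q := p - 1 + β
  set E := gagliardoEnergy (N + γ * q) q u (ball x₀ (r + 3 * ρ)) ^ ((p - 1) / q)
  have hq0 : 0 ≤ (p - 1) / q := div_nonneg (by linarith) (by linarith)
  have hball : ball x₀ (r + 2 * ρ) ⊆ ball (x₀ - h) (R - ρ) :=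
    ball_subset_ball' (by rw [dist_eq_norm, sub_sub_cancel]; linarith)
  have hE : gagliardoEnergy (N + γ * q) q u (ball x₀ (r + 2 * ρ)) ^ ((p - 1) / q) ≤ E :=
    ENNReal.rpow_le_rpow (gagliardoEnergy_mono_set _ _ _ (ball_subset_ball (by linarith))) hq0
  have hEh : gagliardoEnergy (N + γ * q) q (fun x => u (x + h)) (ball x₀ (r + 2 * ρ)) ^
      ((p - 1) / q) ≤ E := by
    refine ENNReal.rpow_le_rpow ?_ hq0
    refine gagliardoEnergy_comp_add_right_le _ _ _ _ measurableSet_ball measurableSet_ball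
      fun x hx => ?_
    rw [show r + 3 * ρ = r + 2 * ρ + ρ by ring]
    exact add_mem_ball_of_norm_le hh hx
  refine (hsub _ u (x₀ - h) x₀ R M (hu.comp_add_right (by linarith) h) hu hR x₀ r ρ hr hρ
    (by linarith) hball (ball_subset_ball (by linarith))).trans ?_
  gcongr ?_ * _
  calc _ ≤ ENNReal.ofReal (C * ρ ^ (-κ)) * (ENNReal.ofReal (M ^ (p - 1)) + E + E) := by gcongr
    _ ≤ ENNReal.ofReal (C * ρ ^ (-κ)) * (2 * (ENNReal.ofReal (M ^ (p - 1)) + E)) := by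
        gcongr
        rw [mul_add, two_mul, two_mul, add_assoc]
        gcongr
        exact le_self_add
    _ = _ := by
        rw [mul_assoc 2 C, ENNReal.ofReal_mul (p := 2) (by norm_num), ENNReal.ofReal_ofNat]
        ring

/-- The interior estimate in `W^{γ,q}`, uniform over all local solutions: the size `M` enters
homogeneously and the distance `ρ` to the boundary polynomially. -/
def Regular (N : ℕ) (p s₁ sp γ q : ℝ) : Prop :=
  ∃ C κ : ℝ, 0 < C ∧ 0 < κ ∧ ∀ (u : EuclideanSpace ℝ (Fin N) → ℝ)
    (x₀ : EuclideanSpace ℝ (Fin N)) (R M : ℝ), LocalSolution p s₁ sp u x₀ R M → R ≤ 1 →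
    ∀ r ρ : ℝ, 0 ≤ r → 0 < ρ → r + ρ ≤ R →
      gagliardoEnergy (N + γ * q) q u (ball x₀ r) ≤ ENNReal.ofReal (C * M ^ q * ρ ^ (-κ))

theorem LocalSolution.exists_lintegral_fwdDiff_le (p s₁ sp : ℝ) {q : ℝ} (hq : 0 < q) :
    ∃ C : ℝ, 0 < C ∧ ∀ (u : 𝔼 → ℝ) (x₀ : 𝔼) (R M : ℝ), LocalSolution p s₁ sp u x₀ R M → R ≤ 1 →
      ∀ (r ρ : ℝ) (h : 𝔼), 0 < ρ → r + ρ ≤ R → ‖h‖ ≤ ρ →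
        ∫⁻ x in ball x₀ r, ENNReal.ofReal (|fwdDiff h u x| ^ q) ≤ ENNReal.ofReal (C * M ^ q) := by
  obtain ⟨C, hC, hvol⟩ := exists_volume_ball_le (N := N)
  refine ⟨2 ^ q * C, by positivity, fun u x₀ R M hu hR r ρ h hρ hrρ hh => ?_⟩
  have hM : 0 ≤ M := by linarith [hu.one_le]
  have hpt : ∀ x ∈ ball x₀ r, |fwdDiff h u x| ≤ 2 * M := fun x hx => by
    have hx' := hu.bound x (ball_subset_ball (by linarith) hx)
    have hxh := hu.bound (x + h) (ball_subset_ball hrρ (add_mem_ball_of_norm_le hh hx))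
    rw [fwdDiff]
    linarith [abs_sub (u (x + h)) (u x)]
  calc _ ≤ ∫⁻ _ in ball x₀ r, ENNReal.ofReal ((2 * M) ^ q) :=
        setLIntegral_mono' measurableSet_ball fun x hx => ENNReal.ofReal_le_ofReal
          (Real.rpow_le_rpow (abs_nonneg _) (hpt x hx) hq.le)
    _ ≤ ENNReal.ofReal ((2 * M) ^ q) * ENNReal.ofReal C := by
        rw [setLIntegral_const]
        gcongr
        exact hvol x₀ r (by linarith)
    _ = _ := by
        rw [← ENNReal.ofReal_mul (by positivity), Real.mul_rpow (by norm_num) hM]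
        congr 1; ring

theorem add_rpow_mul_rpow {a b γ C t Λ : ℝ} (hab : 0 < a + b) (hC : 0 ≤ C) (hΛ : 0 < Λ)
    (ht : 0 ≤ t) :
    (Λ ^ (a / (a + b)) + Λ ^ (a / (a + b))) * (C * t ^ (γ * (a + b)) * Λ) ^ (b / (a + b)) =
      2 * C ^ (b / (a + b)) * Λ * t ^ (γ * b) := by
  have hΛ' : Λ ^ (a / (a + b)) * Λ ^ (b / (a + b)) = Λ := by
    rw [← Real.rpow_add hΛ, ← add_div, div_self hab.ne', Real.rpow_one]
  rw [Real.mul_rpow (by positivity) hΛ.le, Real.mul_rpow hC (by positivity), ← Real.rpow_mul ht,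
    show γ * (a + b) * (b / (a + b)) = γ * b by field_simp]
  linear_combination (2 * C ^ (b / (a + b)) * t ^ (γ * b)) * hΛ'

theorem Regular.exists_gagliardoEnergy_fwdDiff_le (hN : 1 ≤ N) {p s₁ sp β γ : ℝ} (hp : 2 ≤ p)
    (hs₁ : 0 < s₁) (hs₁' : s₁ < 1) (hsp : 0 < sp) (hsp' : sp < 1) (hβ : 1 ≤ β) (hγ0 : 0 ≤ γ)
    (hγ : 0 < 1 - sp * p + γ * (p - 1)) (hreg : Regular N p s₁ sp γ (p - 1 + β)) :
    ∃ C κ : ℝ, 0 < C ∧ 0 < κ ∧ ∀ (u : 𝔼 → ℝ) (x₀ : 𝔼) (R M : ℝ), LocalSolution p s₁ sp u x₀ R M →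
      R ≤ 1 → ∀ (r ρ : ℝ) (h : 𝔼), 0 ≤ r → 0 < ρ → r + 4 * ρ ≤ R → ‖h‖ ≤ ρ →
      gagliardoEnergy (N + sp * p) (p - 1 + β) (fwdDiff h u) (ball x₀ r) ≤
        ENNReal.ofReal (C * M ^ (p - 1 + β) * ρ ^ (-κ) * ‖h‖ ^ (γ * β)) := by
  have hp1 : 0 < p - 1 := by linarith
  obtain ⟨C₀, κ₀, hC₀, hκ₀, hreg⟩ := hreg
  obtain ⟨C₁, κ₁, hC₁, hκ₁, henergy⟩ :=
    LocalSolution.exists_gagliardoEnergy_fwdDiff_le hN hp hs₁ hs₁' hsp hsp' hβ hγ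
  set q := p - 1 + β
  have hq0 : 0 < q := by positivity
  obtain ⟨C₂, hC₂, hdiff⟩ := exists_lintegral_fwdDiff_le (N := N) (e := N + γ * q) hq0
    (by positivity)
  refine ⟨C₁ * 2 * C₂ ^ (β / q) * (C₀ + 1), κ₁ + κ₀, by positivity, by positivity,
    fun u x₀ R M hu hR r ρ h hr hρ hrρ hh => ?_⟩
  have hM : 0 < M := by linarith [hu.one_le]
  set Λ : ℝ := (C₀ + 1) * M ^ q * ρ ^ (-κ₀) with hΛ
  have hΛ0 : 0 < Λ := by positivity
  have hE : gagliardoEnergy (N + γ * q) q u (ball x₀ (r + 3 * ρ)) ≤ ENNReal.ofReal Λ := by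
    refine (hreg u x₀ R M hu hR (r + 3 * ρ) ρ (by linarith) hρ (by linarith)).trans
      (ENNReal.ofReal_le_ofReal ?_)
    rw [hΛ]
    gcongr; linarith
  have hMΛ : M ^ (p - 1) ≤ Λ ^ ((p - 1) / q) :=
    calc M ^ (p - 1) = (M ^ q) ^ ((p - 1) / q) := by rw [← Real.rpow_mul hM.le]; field_simp
      _ = (1 * M ^ q * 1) ^ ((p - 1) / q) := by rw [one_mul, mul_one]
      _ ≤ _ := by
        rw [hΛ]
        gcongr
        · linarith
        · exact Real.one_le_rpow_of_pos_of_le_one_of_nonpos hρ (by linarith) (by linarith)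
  have hdiff : ∫⁻ x in ball x₀ (r + 2 * ρ), ENNReal.ofReal (|fwdDiff h u x| ^ q) ≤
      ENNReal.ofReal (C₂ * ‖h‖ ^ (γ * q) * Λ) := by
    refine (hdiff u hu.measurable x₀ (r + 2 * ρ) ρ h hh).trans ?_
    rw [ENNReal.ofReal_mul (q := Λ) (by positivity), add_sub_cancel_left,
      show r + 2 * ρ + ρ = r + 3 * ρ by ring]
    gcongr
  refine (henergy u x₀ R M hu hR r ρ h hr hρ hrρ hh).trans ?_
  calc _ ≤ ENNReal.ofReal (C₁ * ρ ^ (-κ₁)) * (ENNReal.ofReal (Λ ^ ((p - 1) / q)) +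
        ENNReal.ofReal Λ ^ ((p - 1) / q)) *
        ENNReal.ofReal (C₂ * ‖h‖ ^ (γ * q) * Λ) ^ (β / q) := by gcongr
    _ = ENNReal.ofReal (C₁ * ρ ^ (-κ₁) * (Λ ^ ((p - 1) / q) + Λ ^ ((p - 1) / q)) *
        (C₂ * ‖h‖ ^ (γ * q) * Λ) ^ (β / q)) := by
        rw [ENNReal.ofReal_rpow_of_nonneg hΛ0.le (by positivity),
          ENNReal.ofReal_rpow_of_nonneg (by positivity) (by positivity),
          ← ENNReal.ofReal_add (by positivity) (by positivity),
          ← ENNReal.ofReal_mul (by positivity), ← ENNReal.ofReal_mul (by positivity)]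
    _ = _ := by
        congr 1
        rw [mul_assoc, add_rpow_mul_rpow hq0 hC₂.le hΛ0 (norm_nonneg h), hΛ, neg_add,
          Real.rpow_add hρ]
        ring

theorem Regular.exists_lintegral_fwdDiff_le (hN : 1 ≤ N) {p s₁ sp β γ : ℝ} (hp : 2 ≤ p)
    (hs₁ : 0 < s₁) (hs₁' : s₁ < 1) (hsp : 0 < sp) (hsp' : sp < 1) (hβ : 1 ≤ β) (hγ0 : 0 ≤ γ)
    (hγ : 0 < 1 - sp * p + γ * (p - 1)) (hlt : sp * p + γ * β < p - 1 + β)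
    (hreg : Regular N p s₁ sp γ (p - 1 + β)) :
    ∃ C κ : ℝ, 0 < C ∧ 0 < κ ∧ ∀ (u : 𝔼 → ℝ) (x₀ : 𝔼) (R M : ℝ), LocalSolution p s₁ sp u x₀ R M →
      R ≤ 1 → ∀ (r ρ : ℝ), 0 ≤ r → 0 < ρ → r + 5 * ρ ≤ R → ∀ h : 𝔼, ‖h‖ ≤ ρ →
      ∫⁻ x in ball x₀ r, ENNReal.ofReal (|fwdDiff h u x| ^ (p - 1 + β)) ≤
        ENNReal.ofReal (C * M ^ (p - 1 + β) * ρ ^ (-κ) * ‖h‖ ^ (sp * p + γ * β)) := by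
  obtain ⟨C₀, κ₀, hC₀, hκ₀, henergy⟩ :=
    hreg.exists_gagliardoEnergy_fwdDiff_le hN hp hs₁ hs₁' hsp hsp' hβ hγ0 hγ
  set q := p - 1 + β
  have hq0 : 0 < q := by simp only [q]; linarith
  set α : ℝ := (sp * p + γ * β) / q with hα
  have hα0 : 0 < α := by positivity
  have hαq : α * q = sp * p + γ * β := div_mul_cancel₀ _ hq0.ne'
  obtain ⟨C₁, hC₁, hbdd⟩ := LocalSolution.exists_lintegral_fwdDiff_le (N := N) p s₁ sp hq0
  obtain ⟨C₂, hC₂, hdiff⟩ := NonlocalOneP.exists_lintegral_fwdDiff_le (N := N) (e := N + sp * p)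
    hq0 (by positivity)
  obtain ⟨C₃, hC₃, hmarchaud⟩ := exists_lintegral_fwdDiff_le_of_iterate (N := N) (q := q)
    (α := α) (by simp only [q]; linarith) hα0.le (by rwa [hα, div_lt_one hq0])
  refine ⟨C₃ * (C₁ + C₂ * C₀), κ₀ + α * q, by positivity, by positivity,
    fun u x₀ R M hu hR r ρ hr hρ hrρ h hh => ?_⟩
  have hM : 0 < M := by linarith [hu.one_le]
  have hρκ : 1 ≤ ρ ^ (-κ₀) :=
    Real.one_le_rpow_of_pos_of_le_one_of_nonpos hρ (by linarith) (by linarith)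
  set Q : ℝ := (C₁ + C₂ * C₀) * M ^ q * ρ ^ (-κ₀) with hQ
  have hfirst : ∀ h : 𝔼, ‖h‖ ≤ ρ →
      ∫⁻ x in ball x₀ r, ENNReal.ofReal (|fwdDiff h u x| ^ q) ≤ ENNReal.ofReal Q := fun h hh => by
    refine (hbdd u x₀ R M hu hR r ρ h hρ (by linarith) hh).trans (ENNReal.ofReal_le_ofReal ?_)
    calc C₁ * M ^ q = (C₁ + 0) * M ^ q * 1 := by ring
      _ ≤ Q := by rw [hQ]; gcongr; positivity
  have hsecond : ∀ h : 𝔼, ‖h‖ ≤ ρ →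
      ∫⁻ x in ball x₀ r, ENNReal.ofReal (|fwdDiff h (fwdDiff h u) x| ^ q) ≤
        ENNReal.ofReal (Q * ‖h‖ ^ (α * q)) := fun h hh => by
    refine (hdiff _ (measurable_fwdDiff hu.measurable h) x₀ r ρ h hh).trans ?_
    refine (mul_le_mul_right (henergy u x₀ R M hu hR (r + ρ) ρ h (by linarith) hρ (by linarith)
      hh) _).trans ?_
    rw [← ENNReal.ofReal_mul (by positivity), add_sub_cancel_left, hαq,
      Real.rpow_add' (norm_nonneg h) (by positivity)]
    refine ENNReal.ofReal_le_ofReal ?_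
    calc _ = (0 + C₂ * C₀) * M ^ q * ρ ^ (-κ₀) * (‖h‖ ^ (sp * p) * ‖h‖ ^ (γ * β)) := by ring
      _ ≤ _ := by rw [hQ]; gcongr
  refine (hmarchaud u hu.measurable (ball x₀ r) ρ Q hρ (by linarith) (by positivity) hfirst
    hsecond h hh).trans_eq ?_
  rw [hQ, neg_add, Real.rpow_add hρ, hαq]
  congr 1; ring

theorem Regular.improve (hN : 1 ≤ N) {p s₁ sp β γ γ' : ℝ} (hp : 2 ≤ p) (hs₁ : 0 < s₁)
    (hs₁' : s₁ < 1) (hsp : 0 < sp) (hsp' : sp < 1) (hβ : 1 ≤ β) (hγ0 : 0 ≤ γ)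
    (hγ : 0 < 1 - sp * p + γ * (p - 1)) (hγ'0 : 0 ≤ γ')
    (hγ' : γ' * (p - 1 + β) < sp * p + γ * β) (hlt : sp * p + γ * β < p - 1 + β)
    (hreg : Regular N p s₁ sp γ (p - 1 + β)) : Regular N p s₁ sp γ' (p - 1 + β) := by
  obtain ⟨C₀, κ₀, hC₀, hκ₀, hdiff⟩ :=
    hreg.exists_lintegral_fwdDiff_le hN hp hs₁ hs₁' hsp hsp' hβ hγ0 hγ hlt
  set q := p - 1 + β
  have hq0 : 0 < q := by simp only [q]; linarith
  set e : ℝ := N + γ' * q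
  have he : 0 ≤ e := by positivity
  obtain ⟨C₁, hC₁, henergy⟩ := exists_gagliardoEnergy_le_of_fwdDiff hN (q := q) (e := e)
    (b := sp * p + γ * β) hq0 he (by simp only [e]; linarith)
  refine ⟨C₁ * (C₀ + 1) * 5 ^ (κ₀ + e), κ₀ + e, by positivity, by positivity,
    fun u x₀ R M hu hR r ρ' hr hρ' hrρ => ?_⟩
  obtain ⟨ρ, rfl⟩ : ∃ ρ, ρ' = 5 * ρ := ⟨ρ' / 5, by ring⟩
  have hρ : 0 < ρ := by linarith
  have hM : 0 ≤ M := by linarith [hu.one_le]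
  refine (henergy u hu.measurable x₀ r ρ (C₀ * M ^ q * ρ ^ (-κ₀)) M (by linarith) hρ
    (by linarith) (by positivity) hM
    (fun x hx => hu.bound x (ball_subset_ball (by linarith) hx))
    (hdiff u x₀ R M hu hR r ρ hr hρ hrρ)).trans (ENNReal.ofReal_le_ofReal ?_)
  have hrpow {a : ℝ} (ha : a ≤ κ₀ + e) : ρ ^ (-a) ≤ ρ ^ (-(κ₀ + e)) :=
    Real.rpow_le_rpow_of_exponent_ge hρ (by linarith) (by linarith)
  calc _ ≤ C₁ * (C₀ * M ^ q * ρ ^ (-(κ₀ + e)) + M ^ q * ρ ^ (-(κ₀ + e))) := by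
        gcongr 1
        exact add_le_add (mul_le_mul_of_nonneg_left (hrpow (by linarith)) (by positivity))
          (mul_le_mul_of_nonneg_left (hrpow (by linarith)) (by positivity))
    _ = _ := by
        rw [Real.mul_rpow (by norm_num) hρ.le, Real.rpow_neg (x := 5) (by norm_num)]
        field_simp

theorem regular_base (p s₁ sp : ℝ) : Regular N p s₁ sp sp p := by
  refine ⟨1, 1, one_pos, one_pos, fun u x₀ R M hu hR r ρ hr hρ hrρ => ?_⟩
  have hM : 0 ≤ M := by linarith [hu.one_le]
  refine (gagliardoEnergy_mono_set _ _ _ (ball_subset_ball (by linarith))).trans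
    (hu.energy_le.trans (ENNReal.ofReal_le_ofReal ?_))
  rw [one_mul]
  exact le_mul_of_one_le_right (by positivity)
    (Real.one_le_rpow_of_pos_of_le_one_of_nonpos hρ (by linarith) (by norm_num))

theorem gagliardoEnergy_le_of_abs_le {e q q' M : ℝ} (hqq' : q ≤ q') (hq' : 0 < q') {u : 𝔼 → ℝ}
    {A : Set 𝔼} (hA : MeasurableSet A) (hu : ∀ x ∈ A, |u x| ≤ M) :
    gagliardoEnergy e q' u A ≤ ENNReal.ofReal ((2 * M) ^ (q' - q)) * gagliardoEnergy e q u A := by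
  have hpt : ∀ x ∈ A, ∀ y ∈ A, ENNReal.ofReal (|u x - u y| ^ q' / ‖x - y‖ ^ e) ≤
      ENNReal.ofReal ((2 * M) ^ (q' - q)) *
        ENNReal.ofReal (|u x - u y| ^ q / ‖x - y‖ ^ e) := fun x hx y hy => by
    have huxy : |u x - u y| ≤ 2 * M := by linarith [abs_sub (u x) (u y), hu x hx, hu y hy]
    have hM : 0 ≤ 2 * M := (abs_nonneg _).trans huxy
    rw [← ENNReal.ofReal_mul (by positivity), ← mul_div_assoc]
    refine ENNReal.ofReal_le_ofReal ?_
    gcongr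
    calc |u x - u y| ^ q' = |u x - u y| ^ (q' - q) * |u x - u y| ^ q := by
          rw [← Real.rpow_add' (abs_nonneg _) (by linarith), sub_add_cancel]
      _ ≤ _ := by gcongr
  unfold gagliardoEnergy
  rw [← lintegral_const_mul' _ _ ENNReal.ofReal_ne_top]
  refine setLIntegral_mono' hA fun x hx => ?_
  rw [← lintegral_const_mul' _ _ ENNReal.ofReal_ne_top]
  exact setLIntegral_mono' hA (hpt x hx)

theorem Regular.raise {p s₁ sp γ q q' : ℝ} (hq : 0 < q) (hqq' : q ≤ q')
    (h : Regular N p s₁ sp γ q) : Regular N p s₁ sp (γ * (q / q')) q' := by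
  obtain ⟨C, κ, hC, hκ, h⟩ := h
  have hq' : 0 < q' := hq.trans_le hqq'
  refine ⟨2 ^ (q' - q) * C, κ, by positivity, hκ, fun u x₀ R M hu hR r ρ hr hρ hrρ => ?_⟩
  have hM : 0 < M := by linarith [hu.one_le]
  have hMq' : M ^ q' = M ^ (q' - q) * M ^ q := by rw [← Real.rpow_add hM, sub_add_cancel]
  rw [show γ * (q / q') * q' = γ * q by field_simp]
  calc _ ≤ ENNReal.ofReal ((2 * M) ^ (q' - q)) * gagliardoEnergy (N + γ * q) q u (ball x₀ r) :=
        gagliardoEnergy_le_of_abs_le hqq' hq' measurableSet_ball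
          fun x hx => hu.bound x (ball_subset_ball (by linarith) hx)
    _ ≤ ENNReal.ofReal ((2 * M) ^ (q' - q)) * ENNReal.ofReal (C * M ^ q * ρ ^ (-κ)) := by
        gcongr
        exact h u x₀ R M hu hR r ρ hr hρ hrρ
    _ = _ := by
        rw [← ENNReal.ofReal_mul (by positivity), hMq', Real.mul_rpow (by norm_num) hM.le]
        congr 1; ring

theorem forall_lt_of_forall_lt_convexComb {P : ℝ → Prop} {a₀ σ θ : ℝ} (hθ0 : 0 ≤ θ) (hθ1 : θ < 1)
    (ha₀ : 0 ≤ a₀) (ha₀σ : a₀ < σ) (h₀ : P a₀)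
    (hstep : ∀ a b, a₀ ≤ a → a < σ → P a → 0 ≤ b → b < (1 - θ) * σ + θ * a → P b) :
    ∀ a, 0 ≤ a → a < σ → P a := by
  obtain ⟨η, hθη, hη1⟩ := exists_between hθ1
  have hη0 : 0 < η := hθ0.trans_lt hθη
  have hδ : 0 < σ - a₀ := sub_pos.2 ha₀σ
  have hpow : ∀ n : ℕ, a₀ ≤ σ - η ^ n * (σ - a₀) := fun n => by
    nlinarith [pow_le_one₀ (n := n) hη0.le hη1.le]
  have hlt : ∀ n : ℕ, σ - η ^ n * (σ - a₀) < σ := fun n => sub_lt_self _ (by positivity)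
  have hiter : ∀ n : ℕ, P (σ - η ^ n * (σ - a₀)) := fun n => by
    induction n with
    | zero => simpa using h₀
    | succ n ih =>
      refine hstep _ _ (hpow n) (hlt n) ih (ha₀.trans (hpow _)) ?_
      have : θ * (η ^ n * (σ - a₀)) < η * (η ^ n * (σ - a₀)) := by gcongr
      rw [pow_succ]
      linarith
  intro a ha haσ
  obtain ⟨n, hn⟩ := exists_pow_lt_of_lt_one (div_pos (sub_pos.2 haσ) hδ) hη1
  rw [lt_div_iff₀ hδ] at hn
  refine hstep _ a (hpow n) (hlt n) (hiter n) ha ?_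
  nlinarith [hlt n]

theorem Regular.of_lt (hN : 1 ≤ N) {p s₁ sp q γ₀ : ℝ} (hp : 2 ≤ p) (hs₁ : 0 < s₁)
    (hs₁' : s₁ < 1) (hsp : 0 < sp) (hsp' : sp * p ≤ p - 1) (hq : p ≤ q) (hγ₀ : 0 ≤ γ₀)
    (hγ₀' : γ₀ < sp * p / (p - 1)) (hγ : 0 < 1 - sp * p + γ₀ * (p - 1))
    (hreg : Regular N p s₁ sp γ₀ q) :
    ∀ γ, 0 ≤ γ → γ < sp * p / (p - 1) → Regular N p s₁ sp γ q := by
  have hp1 : 0 < p - 1 := by linarith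
  obtain ⟨β, rfl⟩ : ∃ β, q = p - 1 + β := ⟨q - (p - 1), by ring⟩
  have hq0 : 0 < p - 1 + β := by linarith
  set σ := sp * p / (p - 1) with hσ
  have hσp : σ * (p - 1) = sp * p := div_mul_cancel₀ _ hp1.ne'
  have hσ1 : σ ≤ 1 := by rw [hσ, div_le_one hp1]; exact hsp'
  refine forall_lt_of_forall_lt_convexComb (θ := β / (p - 1 + β))
    (div_nonneg (by linarith) hq0.le) (by rw [div_lt_one hq0]; linarith) hγ₀ hγ₀' hreg ?_
  intro a b ha haσ hrega hb hlt
  rw [show (1 - β / (p - 1 + β)) * σ + β / (p - 1 + β) * a =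
    (sp * p + a * β) / (p - 1 + β) by rw [← hσp]; field_simp; ring, lt_div_iff₀ hq0] at hlt
  exact hrega.improve hN hp hs₁ hs₁' hsp (by nlinarith) (by linarith) (hγ₀.trans ha)
    (by nlinarith) hb hlt (by nlinarith)

theorem Regular.of_le_add_one (hN : 1 ≤ N) {p s₁ sp q q' : ℝ} (hp : 2 ≤ p) (hs₁ : 0 < s₁)
    (hs₁' : s₁ < 1) (hsp : 0 < sp) (hsp' : sp * p ≤ p - 1) (hq : p ≤ q) (hqq' : q ≤ q')
    (hq' : q' ≤ q + 1) (hreg : ∀ γ, 0 ≤ γ → γ < sp * p / (p - 1) → Regular N p s₁ sp γ q) :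
    ∀ γ, 0 ≤ γ → γ < sp * p / (p - 1) → Regular N p s₁ sp γ q' := by
  have hp1 : 0 < p - 1 := by linarith
  have hq0 : 0 < q := by linarith
  have hq'0 : 0 < q' := by linarith
  set σ := sp * p / (p - 1)
  have hσ0 : 0 < σ := by positivity
  have hσp : σ * (p - 1) = sp * p := div_mul_cancel₀ _ hp1.ne'
  have hlarge : (sp * p - 1) * q' / (q * (p - 1)) < σ := by
    rw [div_lt_iff₀ (by positivity), mul_left_comm, hσp]
    nlinarith
  obtain ⟨a, ha, haσ⟩ := exists_between (max_lt hσ0 hlarge)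
  obtain ⟨ha0, ha⟩ := max_lt_iff.1 ha
  refine ((hreg a ha0.le haσ).raise hq0 hqq').of_lt hN hp hs₁ hs₁' hsp hsp' (hq.trans hqq')
    (by positivity) ((mul_le_of_le_one_right ha0.le ((div_le_one hq'0).2 hqq')).trans_lt haσ) ?_
  rw [div_lt_iff₀ (by positivity)] at ha
  have : sp * p - 1 < a * (q / q') * (p - 1) := by
    rw [show a * (q / q') * (p - 1) = a * (q * (p - 1)) / q' by ring, lt_div_iff₀ hq'0]
    exact ha
  linarith

theorem regular_of_lt (hN : 1 ≤ N) {p s₁ sp q : ℝ} (hp : 2 ≤ p) (hs₁ : 0 < s₁)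
    (hs₁' : s₁ < 1) (hsp : 0 < sp) (hsp' : sp * p ≤ p - 1) (hq : p ≤ q) :
    ∀ γ, 0 ≤ γ → γ < sp * p / (p - 1) → Regular N p s₁ sp γ q := by
  obtain ⟨n, hn⟩ := exists_nat_ge (q - p)
  induction n generalizing q with
  | zero =>
    obtain rfl : q = p := le_antisymm (by simpa using hn) hq
    have hp1 : 0 < q - 1 := by linarith
    exact (regular_base q s₁ sp).of_lt hN hp hs₁ hs₁' hsp hsp' le_rfl hsp.le
      (by rw [lt_div_iff₀ hp1]; nlinarith) (by nlinarith)
  | succ n ih =>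
    push_cast at hn
    exact Regular.of_le_add_one hN hp hs₁ hs₁' hsp hsp' (le_max_left p (q - 1))
      (max_le hq (by linarith)) (by linarith [le_max_right p (q - 1)])
      (ih (le_max_left _ _) (by rw [sub_le_iff_le_add]; exact max_le (by linarith) (by linarith)))

theorem gagliardoEnergy_congr_ae {e q : ℝ} {u v : 𝔼 → ℝ} (h : u =ᵐ[volume] v) (A : Set 𝔼) :
    gagliardoEnergy e q u A = gagliardoEnergy e q v A := by
  have hA := ae_restrict_of_ae (s := A) h
  refine lintegral_congr_ae ?_
  filter_upwards [hA] with x hx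
  refine lintegral_congr_ae ?_
  filter_upwards [hA] with y hy
  rw [hx, hy]

theorem gagliardo_rpow {s q : ℝ} (hq : 0 < q) (u : 𝔼 → ℝ) (A : Set 𝔼) :
    gagliardo s q u A ^ q = gagliardoEnergy (N + s * q) q u A := by
  unfold gagliardo gagliardoEnergy
  rw [← ENNReal.rpow_mul, one_div_mul_cancel hq.ne', ENNReal.rpow_one]

theorem MemTailSpace.aestronglyMeasurable {q a : ℝ} {u : 𝔼 → ℝ} (h : MemTailSpace q a u) :
    AEStronglyMeasurable u volume := by
  rw [← Measure.restrict_univ (μ := volume), ← iUnion_closedBall_nat (0 : 𝔼),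
    aestronglyMeasurable_iUnion_iff]
  exact fun n => (h.1 _ (isCompact_closedBall _ _)).1

theorem MemTailSpace.tail_lt_top {p sp : ℝ} (hp : 1 < p) (hsp : 0 ≤ sp) {u : 𝔼 → ℝ}
    (h : MemTailSpace (p - 1) (sp * p) u) (x₀ : 𝔼) {R : ℝ} (hR : 0 < R) :
    tail p sp u x₀ R < ∞ := by
  unfold tail
  have : 0 < p - 1 := by linarith
  set e : ℝ := N + sp * p
  have : 0 ≤ e := by positivity
  rw [ENNReal.rpow_lt_top_iff_of_pos (by positivity)]
  refine ENNReal.mul_lt_top ENNReal.ofReal_lt_top ?_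
  set c : ℝ := (1 + ‖x₀‖) / R + 1
  have hc : ∀ x ∈ (ball x₀ R)ᶜ, 1 + ‖x‖ ≤ c * ‖x - x₀‖ := fun x hx => by
    rw [mem_compl_iff, mem_ball, not_lt, dist_eq_norm] at hx
    calc 1 + ‖x‖ ≤ (1 + ‖x₀‖) / R * R + ‖x - x₀‖ := by
          rw [div_mul_cancel₀ _ hR.ne']
          linarith [norm_le_norm_add_norm_sub' x x₀]
      _ ≤ (1 + ‖x₀‖) / R * ‖x - x₀‖ + ‖x - x₀‖ := by gcongr
      _ = c * ‖x - x₀‖ := by simp only [c]; ring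
  calc _ ≤ ∫⁻ x in (ball x₀ R)ᶜ, ENNReal.ofReal (c ^ e) *
        ENNReal.ofReal (|u x| ^ (p - 1) / (1 + ‖x‖) ^ e) := by
        refine setLIntegral_mono' measurableSet_ball.compl fun x hx => ?_
        have hd : 0 < ‖x - x₀‖ :=
          pos_of_mul_pos_right ((by positivity : (0 : ℝ) < 1 + ‖x‖).trans_le (hc x hx))
            (by positivity)
        rw [← ENNReal.ofReal_mul (by positivity), ← mul_div_assoc]
        refine ENNReal.ofReal_le_ofReal ?_
        rw [div_le_div_iff₀ (by positivity) (by positivity), mul_comm (c ^ e), mul_assoc,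
          ← Real.mul_rpow (by positivity) hd.le]
        gcongr
        exact hc x hx
    _ ≤ ENNReal.ofReal (c ^ e) * ∫⁻ x, ENNReal.ofReal (|u x| ^ (p - 1) / (1 + ‖x‖) ^ e) := by
        rw [lintegral_const_mul' _ _ ENNReal.ofReal_ne_top]
        gcongr
        exact Measure.restrict_le_self
    _ < ∞ := ENNReal.mul_lt_top ENNReal.ofReal_lt_top h.2

theorem setLIntegral_tail_le {p sp R M : ℝ} (hp : 1 < p) (hR : 0 < R) (hM : 0 ≤ M) {u : 𝔼 → ℝ}
    {x₀ : 𝔼} (h : tail p sp u x₀ R ≤ ENNReal.ofReal M) :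
    ∫⁻ x in (ball x₀ R)ᶜ, ENNReal.ofReal (|u x| ^ (p - 1) / ‖x - x₀‖ ^ (N + sp * p)) ≤
      ENNReal.ofReal (M ^ (p - 1) * R ^ (-(sp * p))) := by
  have hRpos : 0 < R ^ (sp * p) := by positivity
  rwa [tail, one_div, ENNReal.rpow_inv_le_iff (by linarith),
    ENNReal.ofReal_rpow_of_nonneg hM (by linarith), mul_comm,
    ← ENNReal.le_div_iff_mul_le (Or.inl (ENNReal.ofReal_pos.2 hRpos).ne')
      (Or.inl ENNReal.ofReal_ne_top), ← ENNReal.ofReal_div_of_pos hRpos, div_eq_mul_inv,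
    ← Real.rpow_neg hR.le] at h

open scoped Classical in
theorem exists_measurable_forall_mem_of_ae {α β : Type*} [MeasurableSpace α] [MeasurableSpace β]
    {μ : Measure α} {f d : α → β} {S : α → Set β} (hf : AEMeasurable f μ) (hd : Measurable d)
    (hfS : ∀ᵐ x ∂μ, f x ∈ S x) (hdS : ∀ x, d x ∈ S x) :
    ∃ g, Measurable g ∧ f =ᵐ[μ] g ∧ ∀ x, g x ∈ S x := by
  set T := toMeasurable μ {x | hf.mk f x ∉ S x}
  have hT : ∀ᵐ x ∂μ, x ∉ T := by
    refine measure_eq_zero_iff_ae_notMem.1 ((measure_toMeasurable _).trans (ae_iff.1 ?_))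
    filter_upwards [hfS, hf.ae_eq_mk] with x hx hfx
    rwa [← hfx]
  refine ⟨T.piecewise d (hf.mk f),
    hd.piecewise (measurableSet_toMeasurable _ _) hf.measurable_mk, ?_, fun x => ?_⟩
  · filter_upwards [hT, hf.ae_eq_mk] with x hx hfx
    rw [piecewise_eq_of_notMem _ _ _ hx, hfx]
  · by_cases hx : x ∈ T
    · rw [piecewise_eq_of_mem _ _ _ hx]
      exact hdS x
    · rw [piecewise_eq_of_notMem _ _ _ hx]
      exact not_not.1 fun h => hx (subset_toMeasurable _ _ h)

theorem div_abs_mem_sgnSet (t : ℝ) : t / |t| ∈ sgnSet t := by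
  refine ⟨abs_le.1 ?_, fun _ => rfl⟩
  rw [abs_div, abs_abs]
  exact div_self_le_one _

theorem IsWeakSolution.exists_measurable_sign {p s₁ sp : ℝ} {Ω : Set 𝔼} {u v : 𝔼 → ℝ}
    (hu : IsWeakSolution p s₁ sp Ω u) (hv : Measurable v) (huv : u =ᵐ[volume] v) :
    ∃ Z : 𝔼 × 𝔼 → ℝ, Measurable Z ∧ (∀ z, Z z ∈ sgnSet (v z.1 - v z.2)) ∧
      ∀ φ : 𝔼 → ℝ, MemW s₁ 1 φ univ → MemW sp p φ univ → HasCompactSupport φ →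
        tsupport φ ⊆ Ω → weakForm p s₁ sp Z v φ = 0 := by
  obtain ⟨Z, hZm, hZ, heq⟩ := hu.exists_sign
  have huv' : ∀ᵐ z : 𝔼 × 𝔼 ∂(volume.prod volume), u z.1 - u z.2 = v z.1 - v z.2 := by
    filter_upwards [Measure.quasiMeasurePreserving_fst.ae huv,
      Measure.quasiMeasurePreserving_snd.ae huv] with z hz₁ hz₂
    rw [hz₁, hz₂]
  obtain ⟨Z', hZ'm, hZZ', hZ'⟩ := exists_measurable_forall_mem_of_ae
    (S := fun z : 𝔼 × 𝔼 => sgnSet (v z.1 - v z.2)) hZm.1.aemeasurable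
    (d := fun z => (v z.1 - v z.2) / |v z.1 - v z.2|) (by fun_prop)
    (by filter_upwards [hZ, huv'] with z hz hz'; rwa [← hz']) fun z => div_abs_mem_sgnSet _
  refine ⟨Z', hZ'm, hZ', fun φ hφ₁ hφp hφc hφΩ => ?_⟩
  rw [← heq φ hφ₁ hφp hφc hφΩ]
  refine congr_arg₂ (· + ·) (integral_congr_ae ?_) (integral_congr_ae ?_)
  · filter_upwards [hZZ'] with z hz
    rw [hz]
  · filter_upwards [huv'] with z hz
    rw [hz, spow]

theorem ae_abs_le_of_eLpNorm_le {α : Type*} [MeasurableSpace α] {μ : Measure α} {u : α → ℝ}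
    {M : ℝ} (hM : 0 ≤ M) (h : eLpNorm u ∞ μ ≤ ENNReal.ofReal M) : ∀ᵐ x ∂μ, |u x| ≤ M := by
  rw [eLpNorm_exponent_top] at h
  filter_upwards [enorm_ae_le_eLpNormEssSup u μ] with x hx
  rw [← ENNReal.ofReal_le_ofReal_iff hM, ← Real.enorm_eq_ofReal_abs]
  exact hx.trans h

theorem IsWeakSolution.supTail_add_gagliardo_ne_top {p s₁ sp : ℝ} (hp : 1 < p) (hsp : 0 ≤ sp)
    {Ω : Set 𝔼} {u : 𝔼 → ℝ} (hu : IsWeakSolution p s₁ sp Ω u) (hbd : LocallyBounded u Ω)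
    {x₀ : 𝔼} {R : ℝ} (hR : 0 < R) (hΩ : closedBall x₀ R ⊆ Ω) :
    supTail p sp u x₀ R + gagliardo sp p u (ball x₀ R) + 1 ≠ ∞ := by
  have hK : IsCompact (closure (ball x₀ R)) := isBounded_ball.isCompact_closure
  have hKΩ : closure (ball x₀ R) ⊆ Ω := closure_ball_subset_closedBall.trans hΩ
  exact ENNReal.add_ne_top.2 ⟨ENNReal.add_ne_top.2 ⟨ENNReal.add_ne_top.2
    ⟨(hbd _ isOpen_ball hK hKΩ).2.ne, (hu.memTail.tail_lt_top hp hsp x₀ hR).ne⟩,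
    (hu.memW_p _ isOpen_ball hK hKΩ).2.ne⟩, ENNReal.one_ne_top⟩

theorem IsWeakSolution.exists_localSolution {p s₁ sp : ℝ} (hp : 1 < p) (hsp : 0 ≤ sp) {Ω : Set 𝔼}
    {u : 𝔼 → ℝ} (hu : IsWeakSolution p s₁ sp Ω u) (hbd : LocallyBounded u Ω) {x₀ : 𝔼} {R : ℝ}
    (hR : 0 < R) (hΩ : closedBall x₀ R ⊆ Ω) :
    ∃ v : 𝔼 → ℝ, u =ᵐ[volume] v ∧ LocalSolution p s₁ sp v x₀ R
      (supTail p sp u x₀ R + gagliardo sp p u (ball x₀ R) + 1).toReal := by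
  have hp0 : 0 < p := by linarith
  set M := (supTail p sp u x₀ R + gagliardo sp p u (ball x₀ R) + 1).toReal
  have hM : ENNReal.ofReal M = supTail p sp u x₀ R + gagliardo sp p u (ball x₀ R) + 1 :=
    ENNReal.ofReal_toReal (hu.supTail_add_gagliardo_ne_top hp hsp hbd hR hΩ)
  have hM0 : 0 ≤ M := ENNReal.toReal_nonneg
  have hsup : eLpNorm u ∞ (volume.restrict (ball x₀ R)) ≤ ENNReal.ofReal M := by
    rw [hM, supTail, add_assoc, add_assoc]
    exact le_self_add
  have htail : tail p sp u x₀ R ≤ ENNReal.ofReal M := by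
    rw [hM, supTail]
    exact (le_add_self.trans le_self_add).trans le_self_add
  have henergy : gagliardo sp p u (ball x₀ R) ≤ ENNReal.ofReal M := by
    rw [hM]
    exact le_add_self.trans le_self_add
  obtain ⟨v, hv, huv, hvM⟩ := exists_measurable_forall_mem_of_ae (d := fun _ => (0 : ℝ))
    (S := fun x => {t | x ∈ ball x₀ R → |t| ≤ M}) hu.memTail.aestronglyMeasurable.aemeasurable
    measurable_const
    ((ae_restrict_iff' measurableSet_ball).1 (ae_abs_le_of_eLpNorm_le hM0 hsup))
    fun _ _ => by simpa using hM0
  obtain ⟨Z, hZ, hZv, heq⟩ := hu.exists_measurable_sign hv huv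
  refine ⟨v, huv, hv, ?_, hvM, ?_, ?_, ?_, Z, hZ, hZv, fun φ hφ₁ hφp hφc hφR =>
    heq φ hφ₁ hφp hφc (hφR.trans (ball_subset_closedBall.trans hΩ))⟩
  · rw [← ENNReal.ofReal_le_ofReal_iff hM0, hM, ENNReal.ofReal_one]
    exact le_add_self
  · refine (lintegral_congr_ae (ae_restrict_of_ae ?_)).trans_le
      (setLIntegral_tail_le hp hR hM0 htail)
    filter_upwards [huv] with x hx
    rw [hx]
  · rw [← gagliardoEnergy_congr_ae huv, ← gagliardo_rpow hp0,
      ← ENNReal.ofReal_rpow_of_nonneg hM0 hp0.le]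
    exact ENNReal.rpow_le_rpow henergy hp0.le
  · rw [← gagliardoEnergy_congr_ae huv, ← gagliardo_lt_top_iff one_pos]
    exact (hu.memW_one _ isOpen_ball isBounded_ball.isCompact_closure
      (closure_ball_subset_closedBall.trans hΩ)).2

theorem setLIntegral_kernel_le_of_mem_ball {e q M δ : ℝ} (he : 0 ≤ e) (hq : 0 ≤ q) (hδ : 0 < δ)
    {u : 𝔼 → ℝ} {V : Set 𝔼} (hV : MeasurableSet V) (hM : ∀ᵐ y ∂(volume.restrict V), |u y| ≤ M)
    {x₀ x : 𝔼} (hx : x ∈ ball x₀ δ) (hxM : |u x| ≤ M) :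
    ∫⁻ y in V, ENNReal.ofReal (|u x - u y| ^ q / ‖x - y‖ ^ e) ≤
      (∫⁻ y in ball x₀ (δ + δ), ENNReal.ofReal (|u x - u y| ^ q / ‖x - y‖ ^ e)) +
        ENNReal.ofReal ((2 * M) ^ q / δ ^ e) * volume V := by
  have hM0 : 0 ≤ M := (abs_nonneg _).trans hxM
  rw [← lintegral_inter_add_sdiff _ V (measurableSet_ball (x := x₀) (ε := δ + δ))]
  gcongr
  · exact inter_subset_right
  calc _ ≤ ∫⁻ _ in V \ ball x₀ (δ + δ), ENNReal.ofReal ((2 * M) ^ q / δ ^ e) := by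
        refine lintegral_mono_ae ?_
        filter_upwards [ae_restrict_mem (hV.diff measurableSet_ball),
          ae_restrict_of_ae_restrict_of_subset sdiff_subset hM] with y hy hyM
        have hxy : δ ≤ ‖x - y‖ := le_norm_sub_of_mem_ball hx hy.2
        have huxy : |u x - u y| ≤ 2 * M := by linarith [abs_sub (u x) (u y)]
        gcongr
    _ ≤ _ := by
        rw [setLIntegral_const]
        gcongr
        exact sdiff_subset

theorem gagliardoEnergy_lt_top_of_forall_ball {e q M : ℝ} (he : 0 ≤ e) (hq : 0 ≤ q) {u : 𝔼 → ℝ}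
    {V : Set 𝔼} (hV : IsOpen V) (hVc : IsCompact (closure V))
    (hM : ∀ᵐ x ∂(volume.restrict V), |u x| ≤ M) {δ : ℝ} (hδ : 0 < δ)
    (h : ∀ x₀ ∈ closure V, gagliardoEnergy e q u (ball x₀ (δ + δ)) < ∞) :
    gagliardoEnergy e q u V < ∞ := by
  have hVfin : volume V < ∞ := (measure_mono subset_closure).trans_lt hVc.measure_lt_top
  set F : 𝔼 → ℝ≥0∞ := fun x => ∫⁻ y in V, ENNReal.ofReal (|u x - u y| ^ q / ‖x - y‖ ^ e)
  have hball : ∀ x₀ ∈ closure V, ∫⁻ x in ball x₀ δ ∩ V, F x < ∞ := fun x₀ hx₀ => by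
    set D := ENNReal.ofReal ((2 * M) ^ q / δ ^ e) * volume V
    have hD : D < ∞ := ENNReal.mul_lt_top ENNReal.ofReal_lt_top hVfin
    calc _ ≤ ∫⁻ x in ball x₀ δ ∩ V, ((∫⁻ y in ball x₀ (δ + δ),
          ENNReal.ofReal (|u x - u y| ^ q / ‖x - y‖ ^ e)) + D) := by
          refine lintegral_mono_ae ?_
          filter_upwards [ae_restrict_mem (measurableSet_ball.inter hV.measurableSet),
            ae_restrict_of_ae_restrict_of_subset inter_subset_right hM] with x hx hxM
          exact setLIntegral_kernel_le_of_mem_ball he hq hδ hV.measurableSet hM hx.1 hxM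
      _ ≤ gagliardoEnergy e q u (ball x₀ (δ + δ)) + D * volume V := by
          rw [lintegral_add_right _ measurable_const, setLIntegral_const]
          refine add_le_add (lintegral_mono_set ?_) (by gcongr; exact inter_subset_right)
          exact inter_subset_left.trans (ball_subset_ball (by linarith))
      _ < ∞ := ENNReal.add_lt_top.2 ⟨h x₀ hx₀, ENNReal.mul_lt_top hD hVfin⟩
  have hcompact : ∫⁻ x in closure V ∩ V, F x < ∞ := by
    refine hVc.induction_on (p := fun S => ∫⁻ x in S ∩ V, F x < ∞) (by simp)
      (fun S T hST hT => (lintegral_mono_set (inter_subset_inter_left _ hST)).trans_lt hT)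
      (fun S T hS hT => ?_) fun x₀ hx₀ =>
        ⟨ball x₀ δ, mem_nhdsWithin_of_mem_nhds (ball_mem_nhds _ hδ), hball x₀ hx₀⟩
    rw [union_inter_distrib_right]
    exact (lintegral_union_le _ _ _).trans_lt (ENNReal.add_lt_top.2 ⟨hS, hT⟩)
  rwa [inter_eq_self_of_subset_right subset_closure] at hcompact

theorem LocallyBounded.memWLoc {q γ : ℝ} (hq : 0 < q) (hγ : 0 ≤ γ) {Ω : Set 𝔼} (hΩ : IsOpen Ω)
    {u : 𝔼 → ℝ} (hbd : LocallyBounded u Ω)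
    (h : ∀ (x₀ : 𝔼) (R r : ℝ), 0 < R → R < 1 → closedBall x₀ R ⊆ Ω → 0 < r → r < R →
      gagliardoEnergy (N + γ * q) q u (ball x₀ r) < ∞) : MemWLoc γ q u Ω := by
  intro V hV hVc hVΩ
  have hVb := hbd V hV hVc hVΩ
  have : IsFiniteMeasure (volume.restrict V) :=
    ⟨by simpa using (measure_mono subset_closure).trans_lt hVc.measure_lt_top⟩
  refine ⟨hVb.mono_exponent le_top, (gagliardo_lt_top_iff hq u V).2 ?_⟩
  have hM : ∀ᵐ x ∂(volume.restrict V), |u x| ≤ (eLpNorm u ∞ (volume.restrict V)).toReal :=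
    ae_abs_le_of_eLpNorm_le ENNReal.toReal_nonneg (ENNReal.ofReal_toReal hVb.2.ne).ge
  obtain ⟨δ, hδ, hδΩ⟩ := hVc.exists_cthickening_subset_open hΩ hVΩ
  set R := min δ (1 / 2)
  have hR0 : 0 < R := lt_min hδ (by norm_num)
  have hR1 : R < 1 := (min_le_right _ _).trans_lt (by norm_num)
  refine gagliardoEnergy_lt_top_of_forall_ball (by positivity) hq.le hV hVc hM
    (δ := R / 4) (by linarith) fun x₀ hx₀ => h x₀ R _ hR0 hR1 ?_ (by linarith) (by linarith)
  exact ((closedBall_subset_closedBall (min_le_left _ _)).trans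
    (closedBall_subset_cthickening hx₀ δ)).trans hδΩ

end NonlocalOneP

open NonlocalOneP Metric Set in
theorem theorem1p2_general {N : ℕ} (hN : 1 ≤ N) {p s₁ sp q γ : ℝ} (hp : 2 ≤ p)
    (hs₁ : s₁ ∈ Ioo (0 : ℝ) 1) (hsp : sp ∈ Ioc 0 ((p - 1) / p)) (hq : p ≤ q)
    (hγ : γ ∈ Ioo 0 (sp * p / (p - 1))) :
    ∃ C κ : ℝ, 0 < C ∧ 0 < κ ∧
      ∀ (Ω : Set (EuclideanSpace ℝ (Fin N))) (u : EuclideanSpace ℝ (Fin N) → ℝ), IsOpen Ω →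
        IsWeakSolution p s₁ sp Ω u → LocallyBounded u Ω → MemWLoc γ q u Ω ∧
        ∀ (x₀ : EuclideanSpace ℝ (Fin N)) (R r : ℝ), 0 < R → R < 1 → closedBall x₀ R ⊆ Ω →
          0 < r → r < R →
          gagliardo γ q u (ball x₀ r) ^ q ≤ ENNReal.ofReal C *
            (supTail p sp u x₀ R + gagliardo sp p u (ball x₀ R) + 1) ^ q /
              ENNReal.ofReal ((R - r) ^ κ) := by
  have hq0 : 0 < q := by linarith
  obtain ⟨C, κ, hC, hκ, hreg⟩ := regular_of_lt hN hp hs₁.1 hs₁.2 hsp.1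
    ((le_div_iff₀ (by linarith)).1 hsp.2) hq γ hγ.1.le hγ.2
  refine ⟨C, κ, hC, hκ, fun Ω u hΩ hu hbd => ?_⟩
  have hball : ∀ (x₀ : EuclideanSpace ℝ (Fin N)) (R r : ℝ), 0 < R → R < 1 →
      closedBall x₀ R ⊆ Ω → 0 < r → r < R →
      gagliardoEnergy (N + γ * q) q u (ball x₀ r) ≤ ENNReal.ofReal
        (C * (supTail p sp u x₀ R + gagliardo sp p u (ball x₀ R) + 1).toReal ^ q *
          (R - r) ^ (-κ)) := fun x₀ R r hR hR1 hRΩ hr hrR => by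
    obtain ⟨v, huv, hv⟩ := hu.exists_localSolution (by linarith) hsp.1.le hbd hR hRΩ
    rw [gagliardoEnergy_congr_ae huv]
    exact hreg v x₀ R _ hv hR1.le r (R - r) hr.le (by linarith) (by linarith)
  refine ⟨hbd.memWLoc hq0 hγ.1.le hΩ fun x₀ R r hR hR1 hRΩ hr hrR =>
    (hball x₀ R r hR hR1 hRΩ hr hrR).trans_lt ENNReal.ofReal_lt_top,
    fun x₀ R r hR hR1 hRΩ hr hrR => ?_⟩
  have hfin := hu.supTail_add_gagliardo_ne_top (by linarith) hsp.1.le hbd hR hRΩ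
  have hRr : 0 < R - r := by linarith
  rw [gagliardo_rpow hq0]
  refine (hball x₀ R r hR hR1 hRΩ hr hrR).trans_eq ?_
  rw [Real.rpow_neg hRr.le, ← div_eq_mul_inv, ENNReal.ofReal_div_of_pos (by positivity),
    ENNReal.ofReal_mul hC.le, ← ENNReal.ofReal_rpow_of_nonneg ENNReal.toReal_nonneg hq0.le,
    ENNReal.ofReal_toReal hfin]

theorem theorem1p2 (N : ℕ) (hN : 2 ≤ N) (p s₁ sp q γ : ℝ) (hp : 2 ≤ p)
    (hs₁ : s₁ ∈ Set.Ioo (0 : ℝ) 1) (hsp : sp ∈ Set.Ioc 0 ((p - 1) / p))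
    (hq : p ≤ q) (hγ : γ ∈ Set.Ioo 0 (sp * p / (p - 1))) :
    ∃ C κ : ℝ, 0 < C ∧ 0 < κ ∧
      ∀ (Ω : Set (EuclideanSpace ℝ (Fin N))) (u : EuclideanSpace ℝ (Fin N) → ℝ),
        IsOpen Ω → IsConnected Ω → Bornology.IsBounded Ω →
        NonlocalOneP.IsWeakSolution p s₁ sp Ω u → NonlocalOneP.LocallyBounded u Ω →
        NonlocalOneP.MemWLoc γ q u Ω ∧
        ∀ (x₀ : EuclideanSpace ℝ (Fin N)) (R r : ℝ), 0 < R → R < 1 →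
          Metric.closedBall x₀ R ⊆ Ω → 0 < r → r < R →
          NonlocalOneP.gagliardo γ q u (Metric.ball x₀ r) ^ q ≤
            ENNReal.ofReal C *
              (NonlocalOneP.supTail p sp u x₀ R +
                NonlocalOneP.gagliardo sp p u (Metric.ball x₀ R) + 1) ^ q /
              ENNReal.ofReal ((R - r) ^ κ) := by
  obtain ⟨C, κ, hC, hκ, h⟩ := theorem1p2_general (N := N) (by omega) hp hs₁ hsp hq hγ
  exact ⟨C, κ, hC, hκ, fun Ω u hΩ _ _ => h Ω u hΩ⟩
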